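/- Let $M$ be a (Hausdorff, paracompact, finite-dimensional) smooth manifold with a smooth involution $\tau\colon M\to M$. A \emph{bundle gerbe} $(P,Y)$ over $M$ is a surjective submersion $\pi\colon Y\to M$, a smooth principal $U(1)$-bundle $P$ over $Y^{[2]}=Y\times_M Y$ and a smooth product $P_{(y_1,y_2)}\otimes P_{(y_2,y_3)}\to P_{(y_1,y_3)}$, an isomorphism of $U(1)$-bundles over $Y^{[3]}$ that is associative over $Y^{[4]}$. It is a \emph{Real bundle gerbe} if it is equipped with a smooth involution $\tau_Y$ of $Y$ covering $\tau$ and a smooth involution $\tau_P$ of $P$ covering $\tau_Y\times\tau_Y$ that satisfies $\tau_P(pz)=\tau_P(p)\bar z$ for $z\in U(1)$ and commutes with the product. The dual $P^*$ is $P$ with the conjugate $U(1)$-action, and for Real bundle gerbes $(P,Y)$ and $(Q,X)$ the product $P\otimes Q$ is the tensor product of their pullbacks to $Y\times_M X$. A \emph{Real line bundle} $R\to Y$ is a hermitian line bundle, regarded as a principal $U(1)$-bundle, with a smooth conjugate involution covering $\tau_Y$; it defines the Real bundle gerbe $\delta R$ with $(\delta R)_{(y_1,y_2)}=R_{y_1}^*\otimes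 R_{y_2}$, the canonical product and the induced Real structure. $P$ is \emph{Real trivial} if $P\cong\delta R$, compatibly with products and Real structures, for some Real line bundle $R\to Y$. Real bundle gerbes $P$ and $Q$ are \emph{Real stably isomorphic} if $Q\otimes P^*$ is Real trivial. A \emph{Real open cover} of $M$ is an open cover $\{U_a\}_{a\in A}$ with a fixed-point free involution $a\mapsto\bar a$ of $A$ such that $U_{\bar a}=\tau(U_a)$. The group $H^2(M;\mathbb Z_2,\overline{\mathcal U(1)})$ is the inductive limit, over refinements of Real open covers, of the second cohomology of the complexes of those \v{C}ech cochains $g_{a_0\cdots a_p}\colon U_{a_0\cdots a_p}\to U(1)$ (smooth) that satisfy $g_{\bar a_0\cdots\bar a_p}\circ\tau=\overline{g_{a_0\cdots a_p}}$. The \emph{Real Dixmier--Douady class} $\mathrm{DD}_R(P)\in H^2(M;\mathbb Z_2,\overline{\mathcal U(1)})$ of a Real bundle gerbe $(P,Y)$ is the class of the cocycle $g_{abc}$ defined by $\sigma_{ab}\,\sigma_{bc}=\sigma_{ac}\,g_{abc}$, where $\{U_a\}$ is a Real open cover, $s_a\colon U_a\to Y$ are smooth sections of $\pi$ with $s_{\bar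 a}=\tau_Y\circ s_a\circ\tau$, and $\sigma_{ab}$ are smooth sections of $(s_a,s_b)^{-1}(P)\to U_{ab}$ with $\sigma_{\bar a\bar b}=\tau_P\circ\sigma_{ab}\circ\tau$. Then: 1. for every Real bundle gerbe $P$ over $M$ such data exist, and their class $\mathrm{DD}_R(P)$ does not depend on the choices; 2. $\mathrm{DD}_R(P)=0$ if and only if $P$ is Real trivial; 3. $\mathrm{DD}_R(P\otimes Q)=\mathrm{DD}_R(P)+\mathrm{DD}_R(Q)$ for all Real bundle gerbes $P$ and $Q$ over $M$; 4. two Real bundle gerbes $P$ and $Q$ over $M$ are Real stably isomorphic if and only if $\mathrm{DD}_R(P)=\mathrm{DD}_R(Q)$. -/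

import Mathlib

open scoped Manifold ContDiff

universe u

noncomputable section

namespace RealGerbe

/-! ### Principal `U(1)`-bundles

Throughout, a smooth space is given as a subset `S` of a manifold `N` (an embedded submanifold in
all applications, and `S = univ` for the manifold `N` itself); a map on `S` is smooth if it is
`ContMDiffOn` on `S`. -/

section Bundles

variable {E H N E' H' N' : Type u}
  [NormedAddCommGroup E] [NormedSpace ℝ E] [TopologicalSpace H] [TopologicalSpace N]
  [ChartedSpace H N]
  [NormedAddCommGroup E'] [NormedSpace ℝ E'] [TopologicalSpace H'] [TopologicalSpace N']
  [ChartedSpace H' N']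
  {I : ModelWithCorners ℝ E H} {I' : ModelWithCorners ℝ E' H'} {S : Set N} {S' : Set N'}

/-- A smooth principal `U(1)`-bundle over the subset `S` of the manifold `N`, given by its total
space, its action, its projection and a smooth trivialising atlas. The trivialisation number `i`,
over `S ∩ dom i`, is `p ↦ (proj p, coord i p)`. The action is commutative, so it is written on the
left; that it is free follows from `coord_smul`. -/
structure U1Bundle (I : ModelWithCorners ℝ E H) (S : Set N) : Type (u + 1) where
  Tot : Type u
  [act : MulAction Circle Tot]
  proj : Tot → N
  proj_mem : ∀ p, proj p ∈ S
  proj_smul : ∀ (z : Circle) p, proj (z • p) = proj p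
  exists_fibre : ∀ x ∈ S, ∃ p, proj p = x
  exists_smul : ∀ p q, proj p = proj q → ∃ z : Circle, z • p = q
  ι : Type u
  dom : ι → Set N
  isOpen_dom : ∀ i, IsOpen (dom i)
  exists_dom : ∀ x ∈ S, ∃ i, x ∈ dom i
  coord : ι → Tot → Circle
  coord_smul : ∀ i (z : Circle) p, proj p ∈ dom i → coord i (z • p) = z * coord i p
  transition : ∀ i j, ∃ g : N → Circle,
    ContMDiffOn I (𝓡 1) ∞ g {x | x ∈ S ∧ x ∈ dom i ∧ x ∈ dom j} ∧
    ∀ p, proj p ∈ dom i → proj p ∈ dom j → coord j p = g (proj p) * coord i p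

attribute [instance] U1Bundle.act

/-- `F : B → B'` is a smooth morphism of `U(1)`-bundles covering `f`. -/
structure IsBundleMap (B : U1Bundle I S) (B' : U1Bundle I' S') (f : N → N')
    (F : B.Tot → B'.Tot) : Prop where
  proj : ∀ p, B'.proj (F p) = f (B.proj p)
  smul : ∀ (z : Circle) p, F (z • p) = z • F p
  smooth : ∀ i j, ∃ g : N → Circle,
    ContMDiffOn I (𝓡 1) ∞ g {x | x ∈ S ∧ x ∈ B.dom i ∧ f x ∈ B'.dom j} ∧
    ∀ p, B.proj p ∈ B.dom i → f (B.proj p) ∈ B'.dom j →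
      B'.coord j (F p) = g (B.proj p) * B.coord i p

/-- `F : B → B'` is a smooth conjugate-equivariant map of `U(1)`-bundles covering `f`
(on the unit circle, `z⁻¹` is the complex conjugate of `z`). -/
structure IsConjBundleMap (B : U1Bundle I S) (B' : U1Bundle I' S') (f : N → N')
    (F : B.Tot → B'.Tot) : Prop where
  proj : ∀ p, B'.proj (F p) = f (B.proj p)
  smul : ∀ (z : Circle) p, F (z • p) = z⁻¹ • F p
  smooth : ∀ i j, ∃ g : N → Circle,
    ContMDiffOn I (𝓡 1) ∞ g {x | x ∈ S ∧ x ∈ B.dom i ∧ f x ∈ B'.dom j} ∧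
    ∀ p, B.proj p ∈ B.dom i → f (B.proj p) ∈ B'.dom j →
      B'.coord j (F p) = g (B.proj p) * (B.coord i p)⁻¹

/-- `s`, defined on the subset `V` of a manifold `N'`, is a smooth section of `B` along the map
`f : V → S`, that is a smooth section of the pullback of `B` by `f`. -/
structure IsSmoothSectionAlong (B : U1Bundle I S) (I' : ModelWithCorners ℝ E' H') (V : Set N')
    (f : N' → N) (s : N' → B.Tot) : Prop where
  proj : ∀ x ∈ V, B.proj (s x) = f x
  smooth : ∀ i, ContMDiffOn I' (𝓡 1) ∞ (fun x => B.coord i (s x)) {x | x ∈ V ∧ f x ∈ B.dom i}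

namespace U1Bundle

/-- The dual bundle: the same space with the conjugate action. -/
def dual (B : U1Bundle I S) : U1Bundle I S where
  Tot := B.Tot
  act :=
    { smul := fun z p => z⁻¹ • p
      one_smul := fun p => by
        change (1 : Circle)⁻¹ • p = p
        simp
      mul_smul := fun z w p => by
        change (z * w)⁻¹ • p = z⁻¹ • w⁻¹ • p
        rw [mul_inv, mul_smul] }
  proj := B.proj
  proj_mem := B.proj_mem
  proj_smul := fun z p => B.proj_smul z⁻¹ p
  exists_fibre := B.exists_fibre
  exists_smul := fun p q h => by
    obtain ⟨z, hz⟩ := B.exists_smul p q h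
    refine ⟨z⁻¹, ?_⟩
    change (z⁻¹)⁻¹ • p = q
    rwa [inv_inv]
  ι := B.ι
  dom := B.dom
  isOpen_dom := B.isOpen_dom
  exists_dom := B.exists_dom
  coord := fun i p => (B.coord i p)⁻¹
  coord_smul := fun i z p hp => by
    change (B.coord i (z⁻¹ • p))⁻¹ = z * (B.coord i p)⁻¹
    rw [B.coord_smul i _ p hp, mul_inv, inv_inv]
  transition := fun i j => by
    obtain ⟨g, hg, h⟩ := B.transition i j
    refine ⟨fun x => (g x)⁻¹, hg.inv, fun p hi hj => ?_⟩
    rw [h p hi hj, mul_inv]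

/-- The pullback of a bundle by a smooth map `f` that sends `S'` to `S`. -/
def pullback (B : U1Bundle I S) (I' : ModelWithCorners ℝ E' H') (S' : Set N') (f : N' → N)
    (hf : ContMDiff I' I ∞ f) (hS : Set.MapsTo f S' S) : U1Bundle I' S' where
  Tot := {x : N' × B.Tot // x.1 ∈ S' ∧ B.proj x.2 = f x.1}
  act :=
    { smul := fun z x => ⟨(x.1.1, z • x.1.2), x.2.1, by rw [B.proj_smul]; exact x.2.2⟩
      one_smul := fun x => Subtype.ext (Prod.ext rfl (one_smul _ _))
      mul_smul := fun z w x => Subtype.ext (Prod.ext rfl (mul_smul _ _ _)) }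
  proj := fun x => x.1.1
  proj_mem := fun x => x.2.1
  proj_smul := fun _ _ => rfl
  exists_fibre := fun x hx => by
    obtain ⟨p, hp⟩ := B.exists_fibre (f x) (hS hx)
    exact ⟨⟨(x, p), hx, hp⟩, rfl⟩
  exists_smul := fun x y h => by
    obtain ⟨z, hz⟩ := B.exists_smul x.1.2 y.1.2 (by rw [x.2.2, y.2.2, h])
    exact ⟨z, Subtype.ext (Prod.ext h hz)⟩
  ι := B.ι
  dom := fun i => f ⁻¹' B.dom i
  isOpen_dom := fun i => (B.isOpen_dom i).preimage hf.continuous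
  exists_dom := fun x hx => B.exists_dom (f x) (hS hx)
  coord := fun i x => B.coord i x.1.2
  coord_smul := fun i z x hx => B.coord_smul i z x.1.2 (by rw [x.2.2]; exact hx)
  transition := fun i j => by
    obtain ⟨g, hg, h⟩ := B.transition i j
    refine ⟨fun x => g (f x), hg.comp hf.contMDiffOn fun x hx => ⟨hS hx.1, hx.2⟩, ?_⟩
    intro x hi hj
    have := h x.1.2 (by rw [x.2.2]; exact hi) (by rw [x.2.2]; exact hj)
    rw [this, x.2.2]

/-- Pairs `(p, q)` and `(z p, z⁻¹ q)` are identified in the tensor product. -/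
def tensorSetoid (B B' : U1Bundle I S) :
    Setoid {x : B.Tot × B'.Tot // B.proj x.1 = B'.proj x.2} where
  r x y := ∃ z : Circle, z • x.1.1 = y.1.1 ∧ z⁻¹ • x.1.2 = y.1.2
  iseqv :=
    { refl := fun x => ⟨1, by simp⟩
      symm := by
        rintro x y ⟨z, h1, h2⟩
        exact ⟨z⁻¹, by rw [← h1]; simp, by rw [← h2]; simp⟩
      trans := by
        rintro x y w ⟨z, h1, h2⟩ ⟨z', h1', h2'⟩
        exact ⟨z' * z, by rw [← h1', ← h1, mul_smul],
          by rw [← h2', ← h2, ← mul_smul, mul_inv]⟩ }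

/-- The product of the coordinates of the factors does not depend on the representative. -/
theorem coord_out (B B' : U1Bundle I S) (i : B.ι) (j : B'.ι)
    (x : {x : B.Tot × B'.Tot // B.proj x.1 = B'.proj x.2})
    (hi : B.proj x.1.1 ∈ B.dom i) (hj : B.proj x.1.1 ∈ B'.dom j) :
    B.coord i (Quotient.mk (tensorSetoid B B') x).out.1.1 *
      B'.coord j (Quotient.mk (tensorSetoid B B') x).out.1.2 =
    B.coord i x.1.1 * B'.coord j x.1.2 := by
  obtain ⟨w, h1, h2⟩ := (tensorSetoid B B').symm (Quotient.mk_out (s := tensorSetoid B B') x)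
  rw [← h1, ← h2, B.coord_smul i w _ hi, B'.coord_smul j w⁻¹ _ (by rw [← x.2]; exact hj),
    mul_mul_mul_comm, mul_inv_cancel, one_mul]

/-- The tensor product (contracted product) of two bundles. -/
def tensor (B B' : U1Bundle I S) : U1Bundle I S where
  Tot := Quotient (tensorSetoid B B')
  act :=
    { smul := fun z => Quotient.map
        (fun x => ⟨(z • x.1.1, x.1.2), by rw [B.proj_smul]; exact x.2⟩) (by
          rintro x y ⟨w, h1, h2⟩
          exact ⟨w, by
            change w • z • x.1.1 = z • y.1.1
            rw [← h1, smul_comm], h2⟩)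
      one_smul := by
        rintro ⟨x⟩
        exact congrArg (Quotient.mk _) (Subtype.ext (Prod.ext (one_smul _ _) rfl))
      mul_smul := by
        rintro z w ⟨x⟩
        exact congrArg (Quotient.mk _) (Subtype.ext (Prod.ext (mul_smul _ _ _) rfl)) }
  proj := Quotient.lift (fun x => B.proj x.1.1) (by
    rintro x y ⟨z, h, -⟩
    rw [← h, B.proj_smul])
  proj_mem := by
    rintro ⟨x⟩
    exact B.proj_mem _
  proj_smul := by
    rintro z ⟨x⟩
    exact B.proj_smul z x.1.1
  exists_fibre := fun x hx => by
    obtain ⟨p, hp⟩ := B.exists_fibre x hx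
    obtain ⟨q, hq⟩ := B'.exists_fibre x hx
    exact ⟨Quotient.mk _ ⟨(p, q), hp.trans hq.symm⟩, hp⟩
  exists_smul := by
    rintro ⟨x⟩ ⟨y⟩ h
    have h : B.proj x.1.1 = B.proj y.1.1 := h
    obtain ⟨z, hz⟩ := B.exists_smul _ _ h
    obtain ⟨w, hw⟩ := B'.exists_smul x.1.2 y.1.2 (by rw [← x.2, ← y.2, h])
    refine ⟨w * z, Quotient.sound ⟨w⁻¹, ?_, ?_⟩⟩
    · change w⁻¹ • (w * z) • x.1.1 = y.1.1
      rw [← hz, mul_smul, inv_smul_smul]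
    · change w⁻¹⁻¹ • x.1.2 = y.1.2
      rw [← hw, inv_inv]
  ι := B.ι × B'.ι
  dom := fun i => B.dom i.1 ∩ B'.dom i.2
  isOpen_dom := fun i => (B.isOpen_dom i.1).inter (B'.isOpen_dom i.2)
  exists_dom := fun x hx => by
    obtain ⟨i, hi⟩ := B.exists_dom x hx
    obtain ⟨j, hj⟩ := B'.exists_dom x hx
    exact ⟨(i, j), hi, hj⟩
  coord := fun i t => B.coord i.1 t.out.1.1 * B'.coord i.2 t.out.1.2
  coord_smul := by
    rintro i z ⟨x⟩ ⟨hi, hj⟩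
    have hi : B.proj x.1.1 ∈ B.dom i.1 := hi
    have hj : B.proj x.1.1 ∈ B'.dom i.2 := hj
    refine (coord_out B B' i.1 i.2 ⟨(z • x.1.1, x.1.2), by rw [B.proj_smul]; exact x.2⟩
      (by rw [B.proj_smul]; exact hi) (by rw [B.proj_smul]; exact hj)).trans ?_
    refine Eq.trans ?_ (congrArg (z * ·) (coord_out B B' i.1 i.2 x hi hj)).symm
    rw [B.coord_smul _ _ _ hi, mul_assoc]
  transition := fun i j => by
    obtain ⟨g, hg, h⟩ := B.transition i.1 j.1
    obtain ⟨g', hg', h'⟩ := B'.transition i.2 j.2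
    refine ⟨fun x => g x * g' x,
      (hg.mono fun x hx => ⟨hx.1, hx.2.1.1, hx.2.2.1⟩).mul
        (hg'.mono fun x hx => ⟨hx.1, hx.2.1.2, hx.2.2.2⟩), ?_⟩
    rintro ⟨x⟩ ⟨hi, hi'⟩ ⟨hj, hj'⟩
    have hi : B.proj x.1.1 ∈ B.dom i.1 := hi
    have hi' : B.proj x.1.1 ∈ B'.dom i.2 := hi'
    have hj : B.proj x.1.1 ∈ B.dom j.1 := hj
    have hj' : B.proj x.1.1 ∈ B'.dom j.2 := hj'
    refine (coord_out B B' j.1 j.2 x hj hj').trans ?_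
    refine Eq.trans ?_ (congrArg (g _ * g' _ * ·) (coord_out B B' i.1 i.2 x hi hi')).symm
    change _ = g (B.proj x.1.1) * g' (B.proj x.1.1) * _
    rw [h _ hi hj, h' _ (by rw [← x.2]; exact hi') (by rw [← x.2]; exact hj'), ← x.2,
      mul_mul_mul_comm]

/-- The action of `U(1)` is free. -/
theorem smul_right_injective (B : U1Bundle I S) {z w : Circle} {p : B.Tot} (h : z • p = w • p) :
    z = w := by
  obtain ⟨i, hi⟩ := B.exists_dom _ (B.proj_mem p)
  have := congrArg (B.coord i) h
  rwa [B.coord_smul i z p hi, B.coord_smul i w p hi, mul_left_inj] at this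

open Classical in
/-- The quotient `p / q` of two points of the same fibre, the element with `(p / q) q = p`
(a junk value if `p` and `q` are in different fibres). -/
def div (B : U1Bundle I S) (p q : B.Tot) : Circle :=
  if h : ∃ z : Circle, z • q = p then h.choose else 1

theorem div_smul (B : U1Bundle I S) {p q : B.Tot} (h : B.proj q = B.proj p) :
    B.div p q • q = p := by
  have h' := B.exists_smul q p h
  rw [div, dif_pos h']
  exact h'.choose_spec

theorem div_eq (B : U1Bundle I S) {p q : B.Tot} {z : Circle} (h : z • q = p) :
    B.div p q = z := by
  refine B.smul_right_injective (p := q) ?_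
  rw [h, B.div_smul]
  rw [← h, B.proj_smul]

end U1Bundle

theorem IsConjBundleMap.dual {B : U1Bundle I S} {f : N → N} {F : B.Tot → B.Tot}
    (h : IsConjBundleMap B B f F) : IsConjBundleMap B.dual B.dual f F where
  proj := h.proj
  smul := fun z p => h.smul z⁻¹ p
  smooth := fun i j => by
    obtain ⟨g, hg, hh⟩ := h.smooth i j
    refine ⟨fun x => (g x)⁻¹, hg.inv, fun p hi hj => ?_⟩
    change (B.coord j (F p))⁻¹ = (g (B.proj p))⁻¹ * ((B.coord i p)⁻¹)⁻¹
    rw [hh p hi hj, mul_inv]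

/-- The map of pullback bundles induced by a map `F` of bundles covering `φ` and by a map `φ'` of
the new base. -/
def U1Bundle.pullbackMap (B : U1Bundle I S) {f : N' → N} (hf : ContMDiff I' I ∞ f)
    (hS : Set.MapsTo f S' S) {φ : N → N} {φ' : N' → N'} (hφ' : Set.MapsTo φ' S' S')
    (hφ : ∀ x ∈ S', f (φ' x) = φ (f x)) (F : B.Tot → B.Tot)
    (hF : ∀ p, B.proj (F p) = φ (B.proj p)) :
    (B.pullback I' S' f hf hS).Tot → (B.pullback I' S' f hf hS).Tot :=
  fun x => ⟨(φ' x.1.1, F x.1.2), hφ' x.2.1, by rw [hF, x.2.2, hφ _ x.2.1]⟩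

theorem IsConjBundleMap.pullback {B : U1Bundle I S} {f : N' → N} (hf : ContMDiff I' I ∞ f)
    (hS : Set.MapsTo f S' S) {φ : N → N} {φ' : N' → N'} (hφ' : Set.MapsTo φ' S' S')
    (hφ : ∀ x ∈ S', f (φ' x) = φ (f x)) {F : B.Tot → B.Tot} (h : IsConjBundleMap B B φ F) :
    IsConjBundleMap (B.pullback I' S' f hf hS) (B.pullback I' S' f hf hS) φ'
      (B.pullbackMap hf hS hφ' hφ F h.proj) where
  proj := fun _ => rfl
  smul := fun z x => Subtype.ext (Prod.ext rfl (h.smul z x.1.2))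
  smooth := fun i j => by
    obtain ⟨g, hg, hh⟩ := h.smooth i j
    refine ⟨fun x => g (f x), hg.comp hf.contMDiffOn ?_, ?_⟩
    · rintro x ⟨hx, hi, hj⟩
      exact ⟨hS hx, hi, by rw [← hφ x hx]; exact hj⟩
    · rintro x hi hj
      have := hh x.1.2 (by rw [x.2.2]; exact hi)
        (by rw [x.2.2, ← hφ _ x.2.1]; exact hj)
      rw [x.2.2] at this
      exact this

/-- The tensor product of two conjugate-equivariant maps. -/
def U1Bundle.tensorConj {B B' : U1Bundle I S} {f : N → N} {F : B.Tot → B.Tot}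
    {F' : B'.Tot → B'.Tot} (h : IsConjBundleMap B B f F) (h' : IsConjBundleMap B' B' f F') :
    (B.tensor B').Tot → (B.tensor B').Tot :=
  Quotient.map (fun x => ⟨(F x.1.1, F' x.1.2), by rw [h.proj, h'.proj, x.2]⟩) (by
    rintro x y ⟨z, h1, h2⟩
    exact ⟨z⁻¹, (h.smul _ _).symm.trans (congrArg F h1),
      (h'.smul _ _).symm.trans (congrArg F' h2)⟩)

theorem IsConjBundleMap.tensor {B B' : U1Bundle I S} {f : N → N} {F : B.Tot → B.Tot}
    {F' : B'.Tot → B'.Tot} (h : IsConjBundleMap B B f F) (h' : IsConjBundleMap B' B' f F') :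
    IsConjBundleMap (B.tensor B') (B.tensor B') f (U1Bundle.tensorConj h h') where
  proj := by
    rintro ⟨x⟩
    exact h.proj _
  smul := by
    rintro z ⟨x⟩
    exact congrArg (Quotient.mk _) (Subtype.ext (Prod.ext (h.smul _ _) rfl))
  smooth := fun i j => by
    obtain ⟨g, hg, hh⟩ := h.smooth i.1 j.1
    obtain ⟨g', hg', hh'⟩ := h'.smooth i.2 j.2
    refine ⟨fun x => g x * g' x,
      (hg.mono fun x hx => ⟨hx.1, hx.2.1.1, hx.2.2.1⟩).mul
        (hg'.mono fun x hx => ⟨hx.1, hx.2.1.2, hx.2.2.2⟩), ?_⟩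
    rintro ⟨x⟩ ⟨hi, hi'⟩ ⟨hj, hj'⟩
    have hi : B.proj x.1.1 ∈ B.dom i.1 := hi
    have hi' : B.proj x.1.1 ∈ B'.dom i.2 := hi'
    have hj : f (B.proj x.1.1) ∈ B.dom j.1 := hj
    have hj' : f (B.proj x.1.1) ∈ B'.dom j.2 := hj'
    refine (U1Bundle.coord_out B B' j.1 j.2
      ⟨(F x.1.1, F' x.1.2), by rw [h.proj, h'.proj, x.2]⟩
      (by rw [h.proj]; exact hj) (by rw [h.proj]; exact hj')).trans ?_
    refine Eq.trans ?_ (congrArg (fun t => g _ * g' _ * t⁻¹)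
      (U1Bundle.coord_out B B' i.1 i.2 x hi hi')).symm
    change _ = g (B.proj x.1.1) * g' (B.proj x.1.1) * _
    rw [hh _ hi hj, hh' _ (by rw [← x.2]; exact hi') (by rw [← x.2]; exact hj'), ← x.2,
      mul_inv, mul_mul_mul_comm]

end Bundles

/-! ### Surjective submersions -/

section Submersions

variable {EM M : Type u} [NormedAddCommGroup EM] [NormedSpace ℝ EM] [TopologicalSpace M]
  [ChartedSpace EM M]

variable (EM M) in
/-- A smooth space `Y` with a surjective submersion `π : Y → M`. The space `Y` is an embedded
submanifold `carrier` of a manifold `N` with the induced smooth structure; `carrier = univ` is the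
case `Y = N` (see `ofIsSubmersion`), and the general form makes fibre products, which are embedded
submanifolds of products, objects of the same kind. The field `submersion` is the local
normal form: near each of its points `Y` is diffeomorphic, by `(π, χ)` with inverse `ψ`, to an open
subset `O` of a product `M × F`, and this identifies `π` with the projection to `M`. -/
structure SurjSubmersion : Type (u + 1) where
  E : Type u
  H : Type u
  N : Type u
  [normedGroup : NormedAddCommGroup E]
  [normedSpace : NormedSpace ℝ E]
  [topH : TopologicalSpace H]
  [topN : TopologicalSpace N]
  [charted : ChartedSpace H N]
  I : ModelWithCorners ℝ E H
  [manifold : IsManifold I ∞ N]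
  carrier : Set N
  π : N → M
  smooth_π : ContMDiffOn I 𝓘(ℝ, EM) ∞ π carrier
  surj_π : ∀ m, ∃ y ∈ carrier, π y = m
  submersion : ∀ y ∈ carrier, ∃ (F : Type u) (_ : NormedAddCommGroup F) (_ : NormedSpace ℝ F)
    (V : Set N) (O : Set (M × F)) (χ : N → F) (ψ : M × F → N),
    IsOpen V ∧ y ∈ V ∧ IsOpen O ∧
    ContMDiffOn I 𝓘(ℝ, F) ∞ χ {x | x ∈ carrier ∧ x ∈ V} ∧
    ContMDiffOn (𝓘(ℝ, EM).prod 𝓘(ℝ, F)) I ∞ ψ O ∧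
    (∀ x ∈ carrier, x ∈ V → (π x, χ x) ∈ O ∧ ψ (π x, χ x) = x) ∧
    (∀ q ∈ O, ψ q ∈ carrier ∧ ψ q ∈ V ∧ π (ψ q) = q.1 ∧ χ (ψ q) = q.2)

attribute [instance] SurjSubmersion.normedGroup SurjSubmersion.normedSpace SurjSubmersion.topH
  SurjSubmersion.topN SurjSubmersion.charted SurjSubmersion.manifold

namespace SurjSubmersion

/-- The fibre product `Y^{[2]}` of `Y` with itself over `M`. -/
def fib2 (Z : SurjSubmersion EM M) : Set (Z.N × Z.N) :=
  {y | y.1 ∈ Z.carrier ∧ y.2 ∈ Z.carrier ∧ Z.π y.1 = Z.π y.2}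

/-- The triple fibre product `Y^{[3]}`. -/
def fib3 (Z : SurjSubmersion EM M) : Set (Z.N × Z.N × Z.N) :=
  {y | (y.1, y.2.1) ∈ Z.fib2 ∧ (y.2.1, y.2.2) ∈ Z.fib2}

/-- The fibre product `Y ×_M X`. -/
def fibreProd (Z W : SurjSubmersion EM M) : SurjSubmersion EM M where
  E := Z.E × W.E
  H := ModelProd Z.H W.H
  N := Z.N × W.N
  I := Z.I.prod W.I
  carrier := {y | y.1 ∈ Z.carrier ∧ y.2 ∈ W.carrier ∧ Z.π y.1 = W.π y.2}
  π := fun y => Z.π y.1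
  smooth_π := Z.smooth_π.comp contMDiff_fst.contMDiffOn fun _ hy => hy.1
  surj_π := fun m => by
    obtain ⟨y, hy, h⟩ := Z.surj_π m
    obtain ⟨x, hx, h'⟩ := W.surj_π m
    exact ⟨(y, x), ⟨hy, hx, h.trans h'.symm⟩, h⟩
  submersion := by
    rintro ⟨y, x⟩ ⟨hy, hx, hyx⟩
    obtain ⟨F, _, _, V, O, χ, ψ, hV, hyV, hO, hχ, hψ, h1, h2⟩ := Z.submersion y hy
    obtain ⟨F', _, _, V', O', χ', ψ', hV', hxV', hO', hχ', hψ', h1', h2'⟩ := W.submersion x hx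
    have s1 : ContMDiff (𝓘(ℝ, EM).prod 𝓘(ℝ, F × F')) (𝓘(ℝ, EM).prod 𝓘(ℝ, F)) ∞
        (fun q : M × (F × F') => (q.1, q.2.1)) :=
      contMDiff_fst.prodMk ((contDiff_fst.contMDiff (n := ∞)).comp contMDiff_snd)
    have s2 : ContMDiff (𝓘(ℝ, EM).prod 𝓘(ℝ, F × F')) (𝓘(ℝ, EM).prod 𝓘(ℝ, F')) ∞
        (fun q : M × (F × F') => (q.1, q.2.2)) :=
      contMDiff_fst.prodMk ((contDiff_snd.contMDiff (n := ∞)).comp contMDiff_snd)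
    refine ⟨F × F', inferInstance, inferInstance, V ×ˢ V',
      {q | (q.1, q.2.1) ∈ O ∧ (q.1, q.2.2) ∈ O'}, fun z => (χ z.1, χ' z.2),
      fun q => (ψ (q.1, q.2.1), ψ' (q.1, q.2.2)), hV.prod hV', ⟨hyV, hxV'⟩,
      (hO.preimage s1.continuous).inter (hO'.preimage s2.continuous), ?_, ?_, ?_, ?_⟩
    · refine ContMDiffOn.prodMk_space ?_ ?_
      · exact hχ.comp contMDiff_fst.contMDiffOn fun z hz => ⟨hz.1.1, hz.2.1⟩
      · exact hχ'.comp contMDiff_snd.contMDiffOn fun z hz => ⟨hz.1.2.1, hz.2.2⟩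
    · exact (hψ.comp s1.contMDiffOn fun q hq => hq.1).prodMk
        (hψ'.comp s2.contMDiffOn fun q hq => hq.2)
    · rintro ⟨a, b⟩ ⟨ha, hb, hab⟩ ⟨haV, hbV⟩
      have hab : Z.π a = W.π b := hab
      have ha' := h1 a ha haV
      have hb' := h1' b hb hbV
      rw [← hab] at hb'
      exact ⟨⟨ha'.1, hb'.1⟩, Prod.ext ha'.2 hb'.2⟩
    · rintro ⟨m, a, b⟩ ⟨ha, hb⟩
      have ha' := h2 _ ha
      have hb' := h2' _ hb
      exact ⟨⟨ha'.1, hb'.1, ha'.2.2.1.trans hb'.2.2.1.symm⟩, ⟨ha'.2.1, hb'.2.1⟩,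
        ha'.2.2.1, Prod.ext ha'.2.2.2 hb'.2.2.2⟩

/-- A surjective submersion from a manifold `Y` without boundary to `M`. -/
def ofIsSubmersion [IsManifold 𝓘(ℝ, EM) ∞ M] {E H Y : Type u} [NormedAddCommGroup E]
    [NormedSpace ℝ E] [TopologicalSpace H] [TopologicalSpace Y] [ChartedSpace H Y]
    (I : ModelWithCorners ℝ E H) [I.Boundaryless] [IsManifold I ∞ Y] (π : Y → M)
    (hπ : Manifold.IsSubmersion I 𝓘(ℝ, EM) ∞ π) (hsurj : Function.Surjective π) :
    SurjSubmersion EM M where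
  E := E
  H := H
  N := Y
  I := I
  carrier := Set.univ
  π := π
  smooth_π := hπ.contMDiff.contMDiffOn
  surj_π := fun m => (hsurj m).imp fun _ h => ⟨trivial, h⟩
  submersion := fun y _ => by
    obtain ⟨F, _, _, h⟩ := hπ.isSubmersionAt y
    have key : ∀ v ∈ (h.domChart.extend I).target,
        (h.codChart.extend 𝓘(ℝ, EM)) (π ((h.domChart.extend I).symm v)) = (h.equiv v).1 :=
      fun v hv => h.writtenInCharts hv
    have hφ : ContMDiffOn I 𝓘(ℝ, E) ∞ (h.domChart.extend I) h.domChart.source :=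
      h.domChart.contMDiffOn_extend h.domChart_mem_maximalAtlas
    have hφ' : ContMDiffOn 𝓘(ℝ, E) I ∞ (h.domChart.extend I).symm (h.domChart.extend I).target :=
      (contMDiffOn_extend_symm h.domChart_mem_maximalAtlas).mono
        (by simp [I.image_eq])
    have hψ : ContMDiffOn 𝓘(ℝ, EM) 𝓘(ℝ, EM) ∞ (h.codChart.extend 𝓘(ℝ, EM)) h.codChart.source :=
      h.codChart.contMDiffOn_extend h.codChart_mem_maximalAtlas
    have hw : ContMDiffOn (𝓘(ℝ, EM).prod 𝓘(ℝ, F)) 𝓘(ℝ, E) ∞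
        (fun q : M × F => h.equiv.symm (h.codChart.extend 𝓘(ℝ, EM) q.1, q.2))
        (h.codChart.source ×ˢ Set.univ) := by
      refine h.equiv.symm.contDiff.contMDiff.comp_contMDiffOn (ContMDiffOn.prodMk_space ?_ ?_)
      · exact hψ.comp contMDiff_fst.contMDiffOn fun q hq => hq.1
      · exact contMDiff_snd.contMDiffOn
    have hsrc : ∀ x ∈ h.domChart.source, (h.domChart.extend I) x ∈ (h.domChart.extend I).target ∧
        (h.domChart.extend I).symm ((h.domChart.extend I) x) = x := fun x hx => by
      rw [← h.domChart.extend_source (I := I)] at hx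
      exact ⟨(h.domChart.extend I).map_source hx, (h.domChart.extend I).left_inv hx⟩
    have htgt : ∀ v ∈ (h.domChart.extend I).target,
        (h.domChart.extend I).symm v ∈ h.domChart.source ∧
        (h.domChart.extend I) ((h.domChart.extend I).symm v) = v := fun v hv => by
      refine ⟨?_, (h.domChart.extend I).right_inv hv⟩
      rw [← h.domChart.extend_source (I := I)]
      exact (h.domChart.extend I).map_target hv
    refine ⟨F, inferInstance, inferInstance, h.domChart.source,
      (h.codChart.source ×ˢ Set.univ) ∩
        (fun q : M × F => h.equiv.symm (h.codChart.extend 𝓘(ℝ, EM) q.1, q.2)) ⁻¹'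
          (h.domChart.extend I).target,
      fun x => (h.equiv (h.domChart.extend I x)).2,
      fun q => (h.domChart.extend I).symm
        (h.equiv.symm (h.codChart.extend 𝓘(ℝ, EM) q.1, q.2)),
      h.domChart.open_source, h.mem_domChart_source, ?_, ?_, ?_, ?_, ?_⟩
    · exact hw.continuousOn.isOpen_inter_preimage (h.codChart.open_source.prod isOpen_univ)
        h.domChart.isOpen_extend_target
    · have : ContDiff ℝ ∞ (fun v => (h.equiv v).2) := contDiff_snd.comp h.equiv.contDiff
      exact this.contMDiff.comp_contMDiffOn (hφ.mono fun x hx => hx.2)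
    · exact hφ'.comp (hw.mono Set.inter_subset_left) fun q hq => hq.2
    · intro x _ hx
      have e := key _ (hsrc x hx).1
      rw [(hsrc x hx).2] at e
      have e' : h.equiv.symm (h.codChart.extend 𝓘(ℝ, EM) (π x),
          (h.equiv (h.domChart.extend I x)).2) = h.domChart.extend I x := by
        rw [e, Prod.mk.eta, h.equiv.symm_apply_apply]
      refine ⟨⟨⟨h.source_subset_preimage_source hx, Set.mem_univ _⟩, ?_⟩, ?_⟩
      · change h.equiv.symm (h.codChart.extend 𝓘(ℝ, EM) (π x),
          (h.equiv (h.domChart.extend I x)).2) ∈ (h.domChart.extend I).target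
        rw [e']
        exact (hsrc x hx).1
      · exact (congrArg _ e').trans (hsrc x hx).2
    · rintro ⟨m, w⟩ ⟨⟨hm, -⟩, hv⟩
      have hm : m ∈ h.codChart.source := hm
      have hv : h.equiv.symm (h.codChart.extend 𝓘(ℝ, EM) m, w) ∈
        (h.domChart.extend I).target := hv
      have e := key _ hv
      rw [h.equiv.apply_symm_apply] at e
      refine ⟨Set.mem_univ _, (htgt _ hv).1, ?_, ?_⟩
      · refine (h.codChart.extend 𝓘(ℝ, EM)).injOn ?_ ?_ e
        · rw [h.codChart.extend_source]
          exact h.source_subset_preimage_source (htgt _ hv).1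
        · rwa [h.codChart.extend_source]
      · change (h.equiv (h.domChart.extend I ((h.domChart.extend I).symm _))).2 = w
        rw [(htgt _ hv).2, h.equiv.apply_symm_apply]

end SurjSubmersion

/-! ### Bundle gerbes -/

/-- A bundle gerbe over `M` with the surjective submersion `Z`. The product is a total function,
whose values `mul p q` matter only for composable `p` and `q`. -/
structure BundleGerbe (Z : SurjSubmersion EM M) : Type (u + 1) where
  bundle : U1Bundle (Z.I.prod Z.I) Z.fib2
  mul : bundle.Tot → bundle.Tot → bundle.Tot
  proj_mul : ∀ p q, (bundle.proj p).2 = (bundle.proj q).1 →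
    bundle.proj (mul p q) = ((bundle.proj p).1, (bundle.proj q).2)
  smul_mul : ∀ (z : Circle) p q, (bundle.proj p).2 = (bundle.proj q).1 →
    mul (z • p) q = z • mul p q
  mul_smul : ∀ (z : Circle) p q, (bundle.proj p).2 = (bundle.proj q).1 →
    mul p (z • q) = z • mul p q
  mul_assoc : ∀ p q r, (bundle.proj p).2 = (bundle.proj q).1 →
    (bundle.proj q).2 = (bundle.proj r).1 → mul (mul p q) r = mul p (mul q r)
  smooth_mul : ∀ i j k, ∃ g : Z.N × Z.N × Z.N → Circle,
    ContMDiffOn (Z.I.prod (Z.I.prod Z.I)) (𝓡 1) ∞ g {y | y ∈ Z.fib3 ∧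
      (y.1, y.2.1) ∈ bundle.dom i ∧ (y.2.1, y.2.2) ∈ bundle.dom j ∧
      (y.1, y.2.2) ∈ bundle.dom k} ∧
    ∀ p q, (bundle.proj p).2 = (bundle.proj q).1 →
      bundle.proj p ∈ bundle.dom i → bundle.proj q ∈ bundle.dom j →
      ((bundle.proj p).1, (bundle.proj q).2) ∈ bundle.dom k →
      bundle.coord k (mul p q) =
        g ((bundle.proj p).1, bundle.proj q) * (bundle.coord i p * bundle.coord j q)

namespace BundleGerbe

variable {Z : SurjSubmersion EM M}

/-- The dual bundle gerbe. -/
def dual (P : BundleGerbe Z) : BundleGerbe Z where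
  bundle := P.bundle.dual
  mul := P.mul
  proj_mul := P.proj_mul
  smul_mul := fun z => P.smul_mul z⁻¹
  mul_smul := fun z => P.mul_smul z⁻¹
  mul_assoc := P.mul_assoc
  smooth_mul := fun i j k => by
    obtain ⟨g, hg, h⟩ := P.smooth_mul i j k
    refine ⟨fun x => (g x)⁻¹, hg.inv, fun p q hpq hi hj hk => ?_⟩
    refine (congrArg (·⁻¹) (h p q hpq hi hj hk)).trans ?_
    rw [mul_inv, mul_inv]
    rfl

theorem mapsTo_fib2 {Z' : SurjSubmersion EM M} {f : Z'.N → Z.N}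
    (hS : Set.MapsTo f Z'.carrier Z.carrier) (hπ : ∀ y ∈ Z'.carrier, Z.π (f y) = Z'.π y) :
    Set.MapsTo (Prod.map f f) Z'.fib2 Z.fib2 := fun _ hy =>
  ⟨hS hy.1, hS hy.2.1, ((hπ _ hy.1).trans hy.2.2).trans (hπ _ hy.2.1).symm⟩

/-- The bundle of the pullback of a bundle gerbe by a smooth map of smooth spaces over `M`. -/
def pullbackBundle (P : BundleGerbe Z) {Z' : SurjSubmersion EM M} {f : Z'.N → Z.N}
    (hf : ContMDiff Z'.I Z.I ∞ f) (hS : Set.MapsTo f Z'.carrier Z.carrier)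
    (hπ : ∀ y ∈ Z'.carrier, Z.π (f y) = Z'.π y) : U1Bundle (Z'.I.prod Z'.I) Z'.fib2 :=
  P.bundle.pullback (Z'.I.prod Z'.I) Z'.fib2 (Prod.map f f) (hf.prodMap hf) (mapsTo_fib2 hS hπ)

theorem pullback_composable (P : BundleGerbe Z) {Z' : SurjSubmersion EM M} {f : Z'.N → Z.N}
    (hf : ContMDiff Z'.I Z.I ∞ f) (hS : Set.MapsTo f Z'.carrier Z.carrier)
    (hπ : ∀ y ∈ Z'.carrier, Z.π (f y) = Z'.π y) {a b : (P.pullbackBundle hf hS hπ).Tot}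
    (h : a.1.1.2 = b.1.1.1) : (P.bundle.proj a.1.2).2 = (P.bundle.proj b.1.2).1 := by
  rw [a.2.2, b.2.2]
  exact congrArg f h

open Classical in
/-- The product of a pullback. -/
def pullbackMul (P : BundleGerbe Z) {Z' : SurjSubmersion EM M} {f : Z'.N → Z.N}
    (hf : ContMDiff Z'.I Z.I ∞ f) (hS : Set.MapsTo f Z'.carrier Z.carrier)
    (hπ : ∀ y ∈ Z'.carrier, Z.π (f y) = Z'.π y) (a b : (P.pullbackBundle hf hS hπ).Tot) :
    (P.pullbackBundle hf hS hπ).Tot :=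
  if h : a.1.1.2 = b.1.1.1 then
    ⟨((a.1.1.1, b.1.1.2), P.mul a.1.2 b.1.2),
      ⟨a.2.1.1, b.2.1.2.1, (a.2.1.2.2.trans (congrArg Z'.π h)).trans b.2.1.2.2⟩, by
        rw [P.proj_mul _ _ (P.pullback_composable hf hS hπ h), a.2.2, b.2.2]
        rfl⟩
  else a

theorem pullbackMul_val (P : BundleGerbe Z) {Z' : SurjSubmersion EM M} {f : Z'.N → Z.N}
    (hf : ContMDiff Z'.I Z.I ∞ f) (hS : Set.MapsTo f Z'.carrier Z.carrier)
    (hπ : ∀ y ∈ Z'.carrier, Z.π (f y) = Z'.π y) {a b : (P.pullbackBundle hf hS hπ).Tot}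
    (h : a.1.1.2 = b.1.1.1) :
    (P.pullbackMul hf hS hπ a b).1 = ((a.1.1.1, b.1.1.2), P.mul a.1.2 b.1.2) :=
  congrArg Subtype.val (dif_pos h)

/-- The pullback of a bundle gerbe by a smooth map `f` of smooth spaces over `M`. -/
def pullback (P : BundleGerbe Z) (Z' : SurjSubmersion EM M) (f : Z'.N → Z.N)
    (hf : ContMDiff Z'.I Z.I ∞ f) (hS : Set.MapsTo f Z'.carrier Z.carrier)
    (hπ : ∀ y ∈ Z'.carrier, Z.π (f y) = Z'.π y) : BundleGerbe Z' where
  bundle := P.pullbackBundle hf hS hπ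
  mul := P.pullbackMul hf hS hπ
  proj_mul := fun a b h => congrArg Prod.fst (P.pullbackMul_val hf hS hπ (a := a) (b := b) h)
  smul_mul := fun z a b h => by
    refine Subtype.ext ((P.pullbackMul_val hf hS hπ (a := z • a) (b := b) h).trans ?_)
    refine Eq.trans ?_ (congrArg (fun t => (t.1, z • t.2))
      (P.pullbackMul_val hf hS hπ (a := a) (b := b) h)).symm
    exact Prod.ext rfl (P.smul_mul z _ _ (P.pullback_composable hf hS hπ h))
  mul_smul := fun z a b h => by
    refine Subtype.ext ((P.pullbackMul_val hf hS hπ (a := a) (b := z • b) h).trans ?_)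
    refine Eq.trans ?_ (congrArg (fun t => (t.1, z • t.2))
      (P.pullbackMul_val hf hS hπ (a := a) (b := b) h)).symm
    exact Prod.ext rfl (P.mul_smul z _ _ (P.pullback_composable hf hS hπ h))
  mul_assoc := fun a b c h h' => by
    have e := P.pullbackMul_val hf hS hπ (a := a) (b := b) h
    have e' := P.pullbackMul_val hf hS hπ (a := b) (b := c) h'
    refine Subtype.ext ?_
    refine (P.pullbackMul_val hf hS hπ (a := P.pullbackMul hf hS hπ a b) (b := c)
      ((congrArg (fun t => t.1.2) e).trans h')).trans ?_
    refine Eq.trans ?_ (P.pullbackMul_val hf hS hπ (a := a) (b := P.pullbackMul hf hS hπ b c)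
      (h.trans (congrArg (fun t => t.1.1) e').symm)).symm
    rw [e, e']
    exact Prod.ext rfl (P.mul_assoc _ _ _ (P.pullback_composable hf hS hπ h)
      (P.pullback_composable hf hS hπ h'))
  smooth_mul := fun i j k => by
    obtain ⟨g, hg, hh⟩ := P.smooth_mul i j k
    refine ⟨fun y => g (f y.1, f y.2.1, f y.2.2),
      hg.comp (hf.prodMap (hf.prodMap hf)).contMDiffOn ?_, fun a b h hi hj hk => ?_⟩
    · rintro y ⟨⟨h1, h2⟩, h3⟩
      exact ⟨⟨mapsTo_fib2 hS hπ h1, mapsTo_fib2 hS hπ h2⟩, h3⟩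
    · have := hh a.1.2 b.1.2 (P.pullback_composable hf hS hπ h)
        (by rw [a.2.2]; exact hi) (by rw [b.2.2]; exact hj) (by rw [a.2.2, b.2.2]; exact hk)
      rw [a.2.2, b.2.2] at this
      exact (congrArg (fun t => P.bundle.coord k t.2)
        (P.pullbackMul_val hf hS hπ (a := a) (b := b) h)).trans this

open Classical in
/-- The product of a tensor product, `(p ⊗ q) (p' ⊗ q') = p p' ⊗ q q'`. -/
def tensorMul (P Q : BundleGerbe Z) (t t' : (P.bundle.tensor Q.bundle).Tot) :
    (P.bundle.tensor Q.bundle).Tot :=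
  if h : (P.bundle.proj t.out.1.1).2 = (P.bundle.proj t'.out.1.1).1 then
    Quotient.mk _ ⟨(P.mul t.out.1.1 t'.out.1.1, Q.mul t.out.1.2 t'.out.1.2), by
      have e := t.out.2
      have e' := t'.out.2
      rw [P.proj_mul _ _ h, Q.proj_mul _ _ (by rw [← e, ← e', h]), e, e']⟩
  else t

theorem tensorMul_mk (P Q : BundleGerbe Z)
    (x y : {x : P.bundle.Tot × Q.bundle.Tot // P.bundle.proj x.1 = Q.bundle.proj x.2})
    (h : (P.bundle.proj x.1.1).2 = (P.bundle.proj y.1.1).1) :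
    P.tensorMul Q (Quotient.mk _ x) (Quotient.mk _ y) =
      Quotient.mk _ ⟨(P.mul x.1.1 y.1.1, Q.mul x.1.2 y.1.2), by
        rw [P.proj_mul _ _ h, Q.proj_mul _ _ (by rw [← x.2, ← y.2, h]), x.2, y.2]⟩ := by
  obtain ⟨w, h1, h2⟩ := Quotient.mk_out (s := U1Bundle.tensorSetoid P.bundle Q.bundle) x
  obtain ⟨v, h3, h4⟩ := Quotient.mk_out (s := U1Bundle.tensorSetoid P.bundle Q.bundle) y
  have e1 := congrArg P.bundle.proj h1
  have e3 := congrArg P.bundle.proj h3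
  rw [P.bundle.proj_smul] at e1 e3
  have h' : (P.bundle.proj (Quotient.mk (U1Bundle.tensorSetoid P.bundle Q.bundle) x).out.1.1).2 =
    (P.bundle.proj (Quotient.mk (U1Bundle.tensorSetoid P.bundle Q.bundle) y).out.1.1).1 := by
    rw [e1, e3, h]
  refine (dif_pos h').trans ?_
  have h'' := h'
  rw [(Quotient.mk (U1Bundle.tensorSetoid P.bundle Q.bundle) x).out.2,
    (Quotient.mk (U1Bundle.tensorSetoid P.bundle Q.bundle) y).out.2] at h''
  refine Quotient.sound ⟨w * v, ?_, ?_⟩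
  · change (w * v) • P.mul _ _ = P.mul x.1.1 y.1.1
    rw [← h1, ← h3, P.smul_mul, P.mul_smul, SemigroupAction.mul_smul]
    · exact h'
    · rw [P.bundle.proj_smul]
      exact h'
  · change (w * v)⁻¹ • Q.mul _ _ = Q.mul x.1.2 y.1.2
    rw [← h2, ← h4, Q.smul_mul, Q.mul_smul, mul_inv, SemigroupAction.mul_smul]
    · exact h''
    · rw [Q.bundle.proj_smul]
      exact h''

/-- The tensor product of two bundle gerbes with the same submersion. -/
def tensor (P Q : BundleGerbe Z) : BundleGerbe Z where
  bundle := P.bundle.tensor Q.bundle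
  mul := P.tensorMul Q
  proj_mul := by
    rintro ⟨x⟩ ⟨y⟩ h
    exact (congrArg _ (P.tensorMul_mk Q x y h)).trans (P.proj_mul _ _ h)
  smul_mul := by
    rintro z ⟨x⟩ ⟨y⟩ h
    have h : (P.bundle.proj x.1.1).2 = (P.bundle.proj y.1.1).1 := h
    refine (P.tensorMul_mk Q ⟨(z • x.1.1, x.1.2), by rw [P.bundle.proj_smul]; exact x.2⟩ y
      (by rw [P.bundle.proj_smul]; exact h)).trans ?_
    refine Eq.trans ?_ (congrArg (z • ·) (P.tensorMul_mk Q x y h)).symm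
    exact congrArg (Quotient.mk _) (Subtype.ext (Prod.ext (P.smul_mul z _ _ h) rfl))
  mul_smul := by
    rintro z ⟨x⟩ ⟨y⟩ h
    have h : (P.bundle.proj x.1.1).2 = (P.bundle.proj y.1.1).1 := h
    refine (P.tensorMul_mk Q x ⟨(z • y.1.1, y.1.2), by rw [P.bundle.proj_smul]; exact y.2⟩
      (by rw [P.bundle.proj_smul]; exact h)).trans ?_
    refine Eq.trans ?_ (congrArg (z • ·) (P.tensorMul_mk Q x y h)).symm
    exact congrArg (Quotient.mk _) (Subtype.ext (Prod.ext (P.mul_smul z _ _ h) rfl))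
  mul_assoc := by
    rintro ⟨x⟩ ⟨y⟩ ⟨w⟩ h h'
    have h : (P.bundle.proj x.1.1).2 = (P.bundle.proj y.1.1).1 := h
    have h' : (P.bundle.proj y.1.1).2 = (P.bundle.proj w.1.1).1 := h'
    refine (congrArg (fun t => P.tensorMul Q t _) (P.tensorMul_mk Q x y h)).trans ?_
    refine Eq.trans ?_ (congrArg (fun t => P.tensorMul Q _ t) (P.tensorMul_mk Q y w h')).symm
    refine (P.tensorMul_mk Q _ w (by rw [P.proj_mul _ _ h]; exact h')).trans ?_
    refine Eq.trans ?_ (P.tensorMul_mk Q x _ (by rw [P.proj_mul _ _ h']; exact h)).symm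
    refine congrArg (Quotient.mk _) (Subtype.ext (Prod.ext (P.mul_assoc _ _ _ h h') ?_))
    exact Q.mul_assoc _ _ _ (by rw [← x.2, ← y.2, h]) (by rw [← y.2, ← w.2, h'])
  smooth_mul := fun i j k => by
    obtain ⟨g, hg, hh⟩ := P.smooth_mul i.1 j.1 k.1
    obtain ⟨g', hg', hh'⟩ := Q.smooth_mul i.2 j.2 k.2
    refine ⟨fun y => g y * g' y,
      (hg.mono fun y hy => ⟨hy.1, hy.2.1.1, hy.2.2.1.1, hy.2.2.2.1⟩).mul
        (hg'.mono fun y hy => ⟨hy.1, hy.2.1.2, hy.2.2.1.2, hy.2.2.2.2⟩), ?_⟩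
    rintro ⟨x⟩ ⟨y⟩ h ⟨hi, hi'⟩ ⟨hj, hj'⟩ ⟨hk, hk'⟩
    have h : (P.bundle.proj x.1.1).2 = (P.bundle.proj y.1.1).1 := h
    have h' : (Q.bundle.proj x.1.2).2 = (Q.bundle.proj y.1.2).1 := by rw [← x.2, ← y.2, h]
    have hi : P.bundle.proj x.1.1 ∈ P.bundle.dom i.1 := hi
    have hi' : P.bundle.proj x.1.1 ∈ Q.bundle.dom i.2 := hi'
    have hj : P.bundle.proj y.1.1 ∈ P.bundle.dom j.1 := hj
    have hj' : P.bundle.proj y.1.1 ∈ Q.bundle.dom j.2 := hj'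
    have hk : ((P.bundle.proj x.1.1).1, (P.bundle.proj y.1.1).2) ∈ P.bundle.dom k.1 := hk
    have hk' : ((P.bundle.proj x.1.1).1, (P.bundle.proj y.1.1).2) ∈ Q.bundle.dom k.2 := hk'
    refine (congrArg _ (P.tensorMul_mk Q x y h)).trans ?_
    refine (U1Bundle.coord_out P.bundle Q.bundle k.1 k.2 _ (by rw [P.proj_mul _ _ h]; exact hk)
      (by rw [P.proj_mul _ _ h]; exact hk')).trans ?_
    refine Eq.trans ?_ (congrArg₂ (fun a b => g _ * g' _ * (a * b))
      (U1Bundle.coord_out P.bundle Q.bundle i.1 i.2 x hi hi')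
      (U1Bundle.coord_out P.bundle Q.bundle j.1 j.2 y hj hj')).symm
    change _ = g ((P.bundle.proj x.1.1).1, P.bundle.proj y.1.1) *
      g' ((P.bundle.proj x.1.1).1, P.bundle.proj y.1.1) * _
    rw [hh _ _ h hi hj hk, hh' _ _ h' (by rw [← x.2]; exact hi') (by rw [← y.2]; exact hj')
      (by rw [← x.2, ← y.2]; exact hk'), ← x.2, ← y.2, mul_mul_mul_comm,
      mul_mul_mul_comm (P.bundle.coord i.1 x.1.1)]

/-- The bundle `δR = π₁⁻¹(R) ⊗ π₂⁻¹(R)^*` over `Y^{[2]}`, where `π₁` and `π₂` omit the first and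
the second point: the fibre over `(y₁, y₂)` is `R_{y₂} ⊗ R_{y₁}^*`. -/
def deltaBundle (R : U1Bundle Z.I Z.carrier) : U1Bundle (Z.I.prod Z.I) Z.fib2 :=
  (R.pullback (Z.I.prod Z.I) Z.fib2 Prod.snd contMDiff_snd fun _ hy => hy.2.1).tensor
    (R.pullback (Z.I.prod Z.I) Z.fib2 Prod.fst contMDiff_fst fun _ hy => hy.1).dual

/-- The element `r₁^* ⊗ r₂` of `δR`. -/
def deltaMk (R : U1Bundle Z.I Z.carrier) (r₁ r₂ : R.Tot)
    (h : Z.π (R.proj r₁) = Z.π (R.proj r₂)) : (deltaBundle R).Tot :=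
  Quotient.mk _
    ⟨(⟨((R.proj r₁, R.proj r₂), r₂), ⟨R.proj_mem _, R.proj_mem _, h⟩, rfl⟩,
      ⟨((R.proj r₁, R.proj r₂), r₁), ⟨R.proj_mem _, R.proj_mem _, h⟩, rfl⟩), rfl⟩

theorem exists_deltaMk (R : U1Bundle Z.I Z.carrier) (t : (deltaBundle R).Tot) :
    ∃ x : {x : R.Tot × R.Tot // Z.π (R.proj x.1) = Z.π (R.proj x.2)},
      t = deltaMk R x.1.1 x.1.2 x.2 := by
  obtain ⟨⟨⟨⟨y, r₂⟩, hy, h₂⟩, ⟨⟨y', r₁⟩, hy', h₁⟩⟩, h⟩ := t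
  have h : y = y' := h
  subst h
  have h₂ : R.proj r₂ = y.2 := h₂
  have h₁ : R.proj r₁ = y.1 := h₁
  have e : y = (R.proj r₁, R.proj r₂) := Prod.ext h₁.symm h₂.symm
  refine ⟨⟨(r₁, r₂), by rw [h₁, h₂]; exact hy.2.2⟩, ?_⟩
  exact congrArg (Quotient.mk _) (Subtype.ext (Prod.ext (Subtype.ext (Prod.ext e rfl))
    (Subtype.ext (Prod.ext e rfl))))

theorem deltaMk_inj (R : U1Bundle Z.I Z.carrier) {r₁ r₂ r₁' r₂' : R.Tot}
    {h : Z.π (R.proj r₁) = Z.π (R.proj r₂)} {h' : Z.π (R.proj r₁') = Z.π (R.proj r₂')}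
    (e : deltaMk R r₁ r₂ h = deltaMk R r₁' r₂' h') :
    ∃ z : Circle, z • r₁ = r₁' ∧ z • r₂ = r₂' := by
  obtain ⟨z, h1, h2⟩ := Quotient.exact e
  have h2 : z⁻¹⁻¹ • r₁ = r₁' := congrArg (fun t => t.1.2) h2
  rw [inv_inv] at h2
  exact ⟨z, h2, congrArg (fun t => t.1.2) h1⟩

theorem deltaMk_smul (R : U1Bundle Z.I Z.carrier) {r₁ r₂ : R.Tot}
    (h : Z.π (R.proj r₁) = Z.π (R.proj r₂)) (z w : Circle) :
    deltaMk R (z • r₁) (w • r₂) (by rwa [R.proj_smul, R.proj_smul]) =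
      (w * z⁻¹) • deltaMk R r₁ r₂ h := by
  refine Quotient.sound ⟨z⁻¹, Subtype.ext (Prod.ext ?_ ?_), Subtype.ext (Prod.ext ?_ ?_)⟩
  · exact Prod.ext (R.proj_smul _ _) (R.proj_smul _ _)
  · change z⁻¹ • w • r₂ = (w * z⁻¹) • r₂
    rw [← SemigroupAction.mul_smul, mul_comm]
  · exact Prod.ext (R.proj_smul _ _) (R.proj_smul _ _)
  · change z⁻¹⁻¹⁻¹ • z • r₁ = r₁
    rw [inv_inv, inv_smul_smul]

open Classical in
/-- The canonical product of `δR`, with `(r₁^* ⊗ r₂) (r₂^* ⊗ r₃) = r₁^* ⊗ r₃`. -/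
def deltaMul (R : U1Bundle Z.I Z.carrier) (t t' : (deltaBundle R).Tot) : (deltaBundle R).Tot :=
  if h : Z.π (R.proj (exists_deltaMk R t).choose.1.1) =
      Z.π (R.proj (exists_deltaMk R t').choose.1.2) then
    R.div (exists_deltaMk R t).choose.1.2 (exists_deltaMk R t').choose.1.1 •
      deltaMk R (exists_deltaMk R t).choose.1.1 (exists_deltaMk R t').choose.1.2 h
  else t

theorem deltaMul_mk (R : U1Bundle Z.I Z.carrier) {r₁ r₂ r₂' r₃ : R.Tot}
    (h : Z.π (R.proj r₁) = Z.π (R.proj r₂)) (h' : Z.π (R.proj r₂') = Z.π (R.proj r₃))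
    (e : R.proj r₂ = R.proj r₂') :
    deltaMul R (deltaMk R r₁ r₂ h) (deltaMk R r₂' r₃ h') =
      R.div r₂ r₂' • deltaMk R r₁ r₃ (h.trans ((congrArg Z.π e).trans h')) := by
  obtain ⟨z, h1, h2⟩ := deltaMk_inj R (exists_deltaMk R (deltaMk R r₁ r₂ h)).choose_spec
  obtain ⟨w, h3, h4⟩ := deltaMk_inj R (exists_deltaMk R (deltaMk R r₂' r₃ h')).choose_spec
  unfold deltaMul
  generalize (exists_deltaMk R (deltaMk R r₁ r₂ h)).choose = x at *
  generalize (exists_deltaMk R (deltaMk R r₂' r₃ h')).choose = y at *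
  obtain ⟨⟨x₁, x₂⟩, hx⟩ := x
  obtain ⟨⟨y₁, y₂⟩, hy⟩ := y
  have h1 : z • r₁ = x₁ := h1
  have h2 : z • r₂ = x₂ := h2
  have h3 : w • r₂' = y₁ := h3
  have h4 : w • r₃ = y₂ := h4
  subst h1 h2 h3 h4
  have e1 : R.div (z • r₂) (w • r₂') = z * R.div r₂ r₂' * w⁻¹ := by
    refine R.div_eq ?_
    rw [SemigroupAction.mul_smul, inv_smul_smul, SemigroupAction.mul_smul, R.div_smul e.symm]
  have h0 := h.trans ((congrArg Z.π e).trans h')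
  refine (dif_pos (by
    change Z.π (R.proj (z • r₁)) = Z.π (R.proj (w • r₃))
    rwa [R.proj_smul, R.proj_smul])).trans ?_
  refine (congrArg₂ (fun (a : Circle) b => a • b) e1 (deltaMk_smul R h0 z w)).trans ?_
  rw [← SemigroupAction.mul_smul]
  congr 1
  rw [_root_.mul_assoc, inv_mul_cancel_left, mul_comm z, mul_inv_cancel_right]

theorem coord_deltaMk (R : U1Bundle Z.I Z.carrier) {r₁ r₂ : R.Tot}
    (h : Z.π (R.proj r₁) = Z.π (R.proj r₂)) (i j : R.ι) (hi : R.proj r₂ ∈ R.dom i)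
    (hj : R.proj r₁ ∈ R.dom j) :
    (deltaBundle R).coord (i, j) (deltaMk R r₁ r₂ h) = R.coord i r₂ * (R.coord j r₁)⁻¹ :=
  U1Bundle.coord_out
    (R.pullback (Z.I.prod Z.I) Z.fib2 Prod.snd contMDiff_snd fun _ hy => hy.2.1)
    (R.pullback (Z.I.prod Z.I) Z.fib2 Prod.fst contMDiff_fst fun _ hy => hy.1).dual i j
    ⟨(⟨((R.proj r₁, R.proj r₂), r₂), ⟨R.proj_mem _, R.proj_mem _, h⟩, rfl⟩,
      ⟨((R.proj r₁, R.proj r₂), r₁), ⟨R.proj_mem _, R.proj_mem _, h⟩, rfl⟩), rfl⟩ hi hj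

theorem deltaMk_smul_right (R : U1Bundle Z.I Z.carrier) {r₁ r₂ : R.Tot}
    (h : Z.π (R.proj r₁) = Z.π (R.proj r₂)) (z : Circle) :
    deltaMk R r₁ (z • r₂) (by rwa [R.proj_smul]) = z • deltaMk R r₁ r₂ h := by
  have e := deltaMk_smul R h 1 z
  rw [inv_one, mul_one] at e
  rw [← e]
  congr 1
  exact (one_smul _ _).symm

theorem deltaMul_smul_left (R : U1Bundle Z.I Z.carrier) (z : Circle) (p q : (deltaBundle R).Tot)
    (h : ((deltaBundle R).proj p).2 = ((deltaBundle R).proj q).1) :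
    deltaMul R (z • p) q = z • deltaMul R p q := by
  obtain ⟨⟨⟨r₁, r₂⟩, h1⟩, rfl⟩ := exists_deltaMk R p
  obtain ⟨⟨⟨r₂', r₃⟩, h2⟩, rfl⟩ := exists_deltaMk R q
  have h : R.proj r₂ = R.proj r₂' := h
  rw [← deltaMk_smul_right R h1, deltaMul_mk R _ h2 (by rwa [R.proj_smul]), deltaMul_mk R h1 h2 h,
    ← SemigroupAction.mul_smul]
  congr 1
  refine R.div_eq ?_
  rw [SemigroupAction.mul_smul, R.div_smul h.symm]

theorem deltaMul_smul_right (R : U1Bundle Z.I Z.carrier) (z : Circle)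
    (p q : (deltaBundle R).Tot) (h : ((deltaBundle R).proj p).2 = ((deltaBundle R).proj q).1) :
    deltaMul R p (z • q) = z • deltaMul R p q := by
  obtain ⟨⟨⟨r₁, r₂⟩, h1⟩, rfl⟩ := exists_deltaMk R p
  obtain ⟨⟨⟨r₂', r₃⟩, h2⟩, rfl⟩ := exists_deltaMk R q
  have h : R.proj r₂ = R.proj r₂' := h
  rw [← deltaMk_smul_right R h2, deltaMul_mk R h1 _ h, deltaMul_mk R h1 h2 h,
    deltaMk_smul_right R (h1.trans ((congrArg Z.π h).trans h2)), smul_comm]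

/-- The trivial bundle gerbe `δR` of a bundle `R` over `Y`. -/
def delta (R : U1Bundle Z.I Z.carrier) : BundleGerbe Z where
  bundle := deltaBundle R
  mul := deltaMul R
  proj_mul := fun p q h => by
    obtain ⟨⟨⟨r₁, r₂⟩, h1⟩, rfl⟩ := exists_deltaMk R p
    obtain ⟨⟨⟨r₂', r₃⟩, h2⟩, rfl⟩ := exists_deltaMk R q
    rw [deltaMul_mk R h1 h2 h, U1Bundle.proj_smul]
    rfl
  smul_mul := deltaMul_smul_left R
  mul_smul := deltaMul_smul_right R
  mul_assoc := fun p q s h h' => by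
    obtain ⟨⟨⟨r₁, r₂⟩, h1⟩, rfl⟩ := exists_deltaMk R p
    obtain ⟨⟨⟨r₂', r₃⟩, h2⟩, rfl⟩ := exists_deltaMk R q
    obtain ⟨⟨⟨r₃', r₄⟩, h3⟩, rfl⟩ := exists_deltaMk R s
    have h : R.proj r₂ = R.proj r₂' := h
    have h' : R.proj r₃ = R.proj r₃' := h'
    have h13 := h1.trans ((congrArg Z.π h).trans h2)
    have h24 := h2.trans ((congrArg Z.π h').trans h3)
    rw [deltaMul_mk R h1 h2 h, deltaMul_mk R h2 h3 h',
      deltaMul_smul_left R _ (deltaMk R r₁ r₃ h13) (deltaMk R r₃' r₄ h3) h',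
      deltaMul_smul_right R _ (deltaMk R r₁ r₂ h1) (deltaMk R r₂' r₄ h24) h,
      deltaMul_mk R h13 h3 h',
      deltaMul_mk R h1 h24 h, smul_comm]
  smooth_mul := fun i j k => by
    obtain ⟨i₂, i₁⟩ := i
    obtain ⟨j₃, j₂⟩ := j
    obtain ⟨k₃, k₁⟩ := k
    obtain ⟨a, ha, ha'⟩ := R.transition i₁ k₁
    obtain ⟨b, hb, hb'⟩ := R.transition i₂ j₂
    obtain ⟨c, hc, hc'⟩ := R.transition j₃ k₃
    have p1 : ContMDiff (Z.I.prod (Z.I.prod Z.I)) Z.I ∞ (fun y : Z.N × Z.N × Z.N => y.1) :=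
      contMDiff_fst
    have p2 : ContMDiff (Z.I.prod (Z.I.prod Z.I)) Z.I ∞ (fun y : Z.N × Z.N × Z.N => y.2.1) :=
      contMDiff_fst.comp contMDiff_snd
    have p3 : ContMDiff (Z.I.prod (Z.I.prod Z.I)) Z.I ∞ (fun y : Z.N × Z.N × Z.N => y.2.2) :=
      contMDiff_snd.comp contMDiff_snd
    refine ⟨fun y => c y.2.2 * (a y.1)⁻¹ * b y.2.1, ?_, ?_⟩
    · refine ((hc.comp p3.contMDiffOn ?_).mul (ha.comp p1.contMDiffOn ?_).inv).mul
        (hb.comp p2.contMDiffOn ?_)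
      · rintro y ⟨hy, hi, hj, hk⟩
        exact ⟨hy.2.2.1, hj.1, hk.1⟩
      · rintro y ⟨hy, hi, hj, hk⟩
        exact ⟨hy.1.1, hi.2, hk.2⟩
      · rintro y ⟨hy, hi, hj, hk⟩
        exact ⟨hy.2.1, hi.1, hj.2⟩
    · intro p q h hi hj hk
      obtain ⟨⟨⟨r₁, r₂⟩, h1⟩, rfl⟩ := exists_deltaMk R p
      obtain ⟨⟨⟨r₂', r₃⟩, h2⟩, rfl⟩ := exists_deltaMk R q
      obtain ⟨hi2, hi1⟩ : R.proj r₂ ∈ R.dom i₂ ∧ R.proj r₁ ∈ R.dom i₁ := hi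
      obtain ⟨hj3, hj2⟩ : R.proj r₃ ∈ R.dom j₃ ∧ R.proj r₂' ∈ R.dom j₂ := hj
      obtain ⟨hk3, hk1⟩ : R.proj r₃ ∈ R.dom k₃ ∧ R.proj r₁ ∈ R.dom k₁ := hk
      have h : R.proj r₂ = R.proj r₂' := h
      have h13 := h1.trans ((congrArg Z.π h).trans h2)
      have e : R.coord i₂ r₂ = R.div r₂ r₂' * R.coord i₂ r₂' := by
        rw [← R.coord_smul i₂ _ _ (by rwa [← h]), R.div_smul h.symm]
      rw [deltaMul_mk R h1 h2 h, (deltaBundle R).coord_smul (k₃, k₁) _ (deltaMk R r₁ r₃ h13) ⟨hk3, hk1⟩,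
        coord_deltaMk R h13 k₃ k₁ hk3 hk1, coord_deltaMk R h1 i₂ i₁ hi2 hi1,
        coord_deltaMk R h2 j₃ j₂ hj3 hj2, hc' _ hj3 hk3, ha' _ hi1 hk1, e,
        hb' _ (by rwa [← h]) hj2]
      change _ = c (R.proj r₃) * (a (R.proj r₁))⁻¹ * b (R.proj r₂') * _
      rw [mul_inv (a _), mul_inv (b _)]
      generalize R.coord i₂ r₂' = t
      have ht : t * t⁻¹ = 1 := mul_inv_cancel t
      have hb1 : b (R.proj r₂') * (b (R.proj r₂'))⁻¹ = 1 := mul_inv_cancel _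
      generalize (b (R.proj r₂'))⁻¹ = b' at *
      generalize t⁻¹ = t' at *
      calc _ = R.div r₂ r₂' * (c (R.proj r₃) * R.coord j₃ r₃ * ((a (R.proj r₁))⁻¹ *
            (R.coord i₁ r₁)⁻¹)) * (t * t') * (b (R.proj r₂') * b') := by
              rw [ht, hb1, mul_one, mul_one]
        _ = _ := by ac_rfl

end BundleGerbe

/-! ### Real bundle gerbes -/

/-- A surjective submersion `π : Y → M` with a smooth involution `inv` of `Y` that covers `τ`. -/
structure RealSubmersion (EM : Type u) {M : Type u} [NormedAddCommGroup EM] [NormedSpace ℝ EM]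
    [TopologicalSpace M] [ChartedSpace EM M] (τ : M → M) : Type (u + 1)
    extends SurjSubmersion EM M where
  inv : N → N
  smooth_inv : ContMDiffOn I I ∞ inv carrier
  inv_mem : ∀ y ∈ carrier, inv y ∈ carrier
  inv_inv : ∀ y ∈ carrier, inv (inv y) = y
  π_inv : ∀ y ∈ carrier, π (inv y) = τ (π y)

variable {τ : M → M}

namespace RealSubmersion

/-- The fibre product `Y ×_M X` with the diagonal involution. -/
def fibreProd (Z W : RealSubmersion EM τ) : RealSubmersion EM τ where
  toSurjSubmersion := Z.toSurjSubmersion.fibreProd W.toSurjSubmersion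
  inv := Prod.map Z.inv W.inv
  smooth_inv := (Z.smooth_inv.comp contMDiff_fst.contMDiffOn fun _ hy => hy.1).prodMk
    (W.smooth_inv.comp contMDiff_snd.contMDiffOn fun _ hy => hy.2.1)
  inv_mem := fun _ hy => ⟨Z.inv_mem _ hy.1, W.inv_mem _ hy.2.1,
    ((Z.π_inv _ hy.1).trans (congrArg τ hy.2.2)).trans (W.π_inv _ hy.2.1).symm⟩
  inv_inv := fun _ hy => Prod.ext (Z.inv_inv _ hy.1) (W.inv_inv _ hy.2.1)
  π_inv := fun _ hy => Z.π_inv _ hy.1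

theorem mapsTo_inv (Z : RealSubmersion EM τ) : Set.MapsTo (Prod.map Z.inv Z.inv) Z.fib2 Z.fib2 :=
  fun _ hy => ⟨Z.inv_mem _ hy.1, Z.inv_mem _ hy.2.1,
    ((Z.π_inv _ hy.1).trans (congrArg τ hy.2.2)).trans (Z.π_inv _ hy.2.1).symm⟩

end RealSubmersion

/-- A Real bundle gerbe over `(M, τ)` with the surjective submersion `Z`: a bundle gerbe with a
conjugate involution `conj` of its bundle that covers the involution of `Y^{[2]}` and commutes with
the product. -/
structure RealBundleGerbe (Z : RealSubmersion EM τ) : Type (u + 1)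
    extends BundleGerbe Z.toSurjSubmersion where
  conj : bundle.Tot → bundle.Tot
  isConj : IsConjBundleMap bundle bundle (Prod.map Z.inv Z.inv) conj
  conj_conj : ∀ p, conj (conj p) = p
  conj_mul : ∀ p q, (bundle.proj p).2 = (bundle.proj q).1 →
    conj (mul p q) = mul (conj p) (conj q)

/-- A Real line bundle over `Y`, in the form of a principal `U(1)`-bundle with a conjugate
involution that covers the involution of `Y`. -/
structure RealLineBundle (Z : RealSubmersion EM τ) : Type (u + 1)
    extends U1Bundle Z.I Z.carrier where
  conj : Tot → Tot
  isConj : IsConjBundleMap toU1Bundle toU1Bundle Z.inv conj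
  conj_conj : ∀ p, conj (conj p) = p

namespace RealBundleGerbe

variable {Z : RealSubmersion EM τ}

/-- The dual Real bundle gerbe `P^*`. -/
def dual (P : RealBundleGerbe Z) : RealBundleGerbe Z where
  toBundleGerbe := P.toBundleGerbe.dual
  conj := P.conj
  isConj := P.isConj.dual
  conj_conj := P.conj_conj
  conj_mul := P.conj_mul

/-- The pullback of a Real bundle gerbe by an equivariant smooth map of spaces over `M`. -/
def pullback (P : RealBundleGerbe Z) (Z' : RealSubmersion EM τ) (f : Z'.N → Z.N)
    (hf : ContMDiff Z'.I Z.I ∞ f) (hS : Set.MapsTo f Z'.carrier Z.carrier)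
    (hπ : ∀ y ∈ Z'.carrier, Z.π (f y) = Z'.π y)
    (hinv : ∀ y ∈ Z'.carrier, f (Z'.inv y) = Z.inv (f y)) : RealBundleGerbe Z' where
  toBundleGerbe := P.toBundleGerbe.pullback Z'.toSurjSubmersion f hf hS hπ
  conj := P.bundle.pullbackMap (φ := Prod.map Z.inv Z.inv) (hf.prodMap hf)
    (BundleGerbe.mapsTo_fib2 hS hπ) Z'.mapsTo_inv
    (fun _ hx => Prod.ext (hinv _ hx.1) (hinv _ hx.2.1)) P.conj P.isConj.proj
  isConj := P.isConj.pullback (φ := Prod.map Z.inv Z.inv) (hf.prodMap hf) (BundleGerbe.mapsTo_fib2 hS hπ) Z'.mapsTo_inv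
    (fun _ hx => Prod.ext (hinv _ hx.1) (hinv _ hx.2.1))
  conj_conj := fun x => Subtype.ext (Prod.ext
    (Prod.ext (Z'.inv_inv _ x.2.1.1) (Z'.inv_inv _ x.2.1.2.1)) (P.conj_conj _))
  conj_mul := fun a b h => by
    have h : a.1.1.2 = b.1.1.1 := h
    have e := P.toBundleGerbe.pullbackMul_val hf hS hπ (a := a) (b := b) h
    refine Subtype.ext ?_
    refine Eq.trans ?_ (P.toBundleGerbe.pullbackMul_val hf hS hπ
      (congrArg Z'.inv h)).symm
    refine (congrArg (fun t => (Prod.map Z'.inv Z'.inv t.1, P.conj t.2)) e).trans ?_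
    exact Prod.ext rfl (P.conj_mul _ _ (P.toBundleGerbe.pullback_composable hf hS hπ h))

/-- The tensor product of two Real bundle gerbes with the same submersion. -/
def tensorSame (P Q : RealBundleGerbe Z) : RealBundleGerbe Z where
  toBundleGerbe := P.toBundleGerbe.tensor Q.toBundleGerbe
  conj := U1Bundle.tensorConj P.isConj Q.isConj
  isConj := P.isConj.tensor Q.isConj
  conj_conj := by
    rintro ⟨x⟩
    exact congrArg (Quotient.mk _)
      (Subtype.ext (Prod.ext (P.conj_conj x.1.1) (Q.conj_conj x.1.2)))
  conj_mul := by
    rintro ⟨x⟩ ⟨y⟩ h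
    have h : (P.bundle.proj x.1.1).2 = (P.bundle.proj y.1.1).1 := h
    have hQ : (Q.bundle.proj x.1.2).2 = (Q.bundle.proj y.1.2).1 := by rw [← x.2, ← y.2, h]
    have h' : (P.bundle.proj (P.conj x.1.1)).2 = (P.bundle.proj (P.conj y.1.1)).1 := by
      rw [P.isConj.proj, P.isConj.proj]
      exact congrArg Z.inv h
    refine (congrArg (U1Bundle.tensorConj P.isConj Q.isConj)
      (P.toBundleGerbe.tensorMul_mk Q.toBundleGerbe x y h)).trans ?_
    refine Eq.trans ?_ (P.toBundleGerbe.tensorMul_mk Q.toBundleGerbe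
      ⟨(P.conj x.1.1, Q.conj x.1.2), by rw [P.isConj.proj, Q.isConj.proj, x.2]⟩
      ⟨(P.conj y.1.1, Q.conj y.1.2), by rw [P.isConj.proj, Q.isConj.proj, y.2]⟩ h').symm
    exact congrArg (Quotient.mk _)
      (Subtype.ext (Prod.ext (P.conj_mul _ _ h) (Q.conj_mul _ _ hQ)))

/-- The tensor product `(P ⊗ Q, Y ×_M X)` of Real bundle gerbes `(P, Y)` and `(Q, X)`: the tensor
product of their pullbacks to `Y ×_M X`. -/
def tensor {W : RealSubmersion EM τ} (P : RealBundleGerbe Z) (Q : RealBundleGerbe W) :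
    RealBundleGerbe (Z.fibreProd W) :=
  (P.pullback (Z.fibreProd W) Prod.fst contMDiff_fst (fun _ hy => hy.1) (fun _ _ => rfl)
    (fun _ _ => rfl)).tensorSame
  (Q.pullback (Z.fibreProd W) Prod.snd contMDiff_snd (fun _ hy => hy.2.1)
    (fun _ hy => hy.2.2.symm) (fun _ _ => rfl))

end RealBundleGerbe

namespace RealLineBundle

variable {Z : RealSubmersion EM τ}

/-- The Real structure `r₁^* ⊗ r₂ ↦ conj(r₁)^* ⊗ conj(r₂)` of `δR`. -/
def deltaConj (R : RealLineBundle Z) :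
    (BundleGerbe.deltaBundle R.toU1Bundle).Tot → (BundleGerbe.deltaBundle R.toU1Bundle).Tot :=
  U1Bundle.tensorConj
    (R.isConj.pullback contMDiff_snd (fun _ hy => hy.2.1) Z.mapsTo_inv (fun _ _ => rfl))
    (R.isConj.pullback contMDiff_fst (fun _ hy => hy.1) Z.mapsTo_inv (fun _ _ => rfl)).dual

theorem deltaConj_mk (R : RealLineBundle Z) {r₁ r₂ : R.Tot}
    (h : Z.π (R.proj r₁) = Z.π (R.proj r₂)) :
    R.deltaConj (BundleGerbe.deltaMk R.toU1Bundle r₁ r₂ h) =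
      BundleGerbe.deltaMk R.toU1Bundle (R.conj r₁) (R.conj r₂) (by
        rw [R.isConj.proj, R.isConj.proj, Z.π_inv _ (R.proj_mem _), Z.π_inv _ (R.proj_mem _), h]) := by
  have e : Prod.map Z.inv Z.inv (R.proj r₁, R.proj r₂) =
      (R.proj (R.conj r₁), R.proj (R.conj r₂)) :=
    Prod.ext (R.isConj.proj _).symm (R.isConj.proj _).symm
  exact congrArg (Quotient.mk _) (Subtype.ext (Prod.ext (Subtype.ext (Prod.ext e rfl))
    (Subtype.ext (Prod.ext e rfl))))

/-- The Real bundle gerbe `δR` of a Real line bundle `R` over `Y`. -/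
def delta (R : RealLineBundle Z) : RealBundleGerbe Z where
  toBundleGerbe := BundleGerbe.delta R.toU1Bundle
  conj := R.deltaConj
  isConj := (R.isConj.pullback contMDiff_snd (fun _ hy => hy.2.1) Z.mapsTo_inv
      (fun _ _ => rfl)).tensor
    (R.isConj.pullback contMDiff_fst (fun _ hy => hy.1) Z.mapsTo_inv (fun _ _ => rfl)).dual
  conj_conj := fun p => by
    obtain ⟨⟨⟨r₁, r₂⟩, h⟩, rfl⟩ := BundleGerbe.exists_deltaMk R.toU1Bundle p
    rw [deltaConj_mk R h, deltaConj_mk R]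
    congr 1
    · exact R.conj_conj r₁
    · exact R.conj_conj r₂
  conj_mul := fun p q h => by
    obtain ⟨⟨⟨r₁, r₂⟩, h1⟩, rfl⟩ := BundleGerbe.exists_deltaMk R.toU1Bundle p
    obtain ⟨⟨⟨r₂', r₃⟩, h2⟩, rfl⟩ := BundleGerbe.exists_deltaMk R.toU1Bundle q
    have h : R.proj r₂ = R.proj r₂' := h
    have h' : R.proj (R.conj r₂) = R.proj (R.conj r₂') := by
      rw [R.isConj.proj, R.isConj.proj, h]
    have h13 := h1.trans ((congrArg Z.π h).trans h2)
    refine (congrArg R.deltaConj (BundleGerbe.deltaMul_mk R.toU1Bundle h1 h2 h)).trans ?_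
    rw [deltaConj_mk R h1, deltaConj_mk R h2]
    refine Eq.trans ?_ (BundleGerbe.deltaMul_mk R.toU1Bundle _ _ h').symm
    rw [← deltaConj_mk R h13]
    refine (((R.isConj.pullback contMDiff_snd (fun _ hy => hy.2.1) Z.mapsTo_inv
      (fun _ _ => rfl)).tensor (R.isConj.pullback contMDiff_fst (fun _ hy => hy.1) Z.mapsTo_inv
      (fun _ _ => rfl)).dual).smul _ _).trans ?_
    refine congrArg (fun z : Circle => z • R.deltaConj _) (R.div_eq ?_).symm
    rw [← R.isConj.smul, R.div_smul h.symm]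

end RealLineBundle

namespace RealBundleGerbe

variable {Z : RealSubmersion EM τ}

/-- An isomorphism of Real bundle gerbes with the same submersion: an isomorphism of the bundles
over `Y^{[2]}` (a morphism of principal bundles over the identity is an isomorphism) that commutes
with the products and with the Real structures. -/
structure Iso (P Q : RealBundleGerbe Z) : Type u where
  toFun : P.bundle.Tot → Q.bundle.Tot
  isBundleMap : IsBundleMap P.bundle Q.bundle id toFun
  map_mul : ∀ p q, (P.bundle.proj p).2 = (P.bundle.proj q).1 →
    toFun (P.mul p q) = Q.mul (toFun p) (toFun q)
  map_conj : ∀ p, toFun (P.conj p) = Q.conj (toFun p)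

/-- `P` is Real trivial if `P ≅ δR` for a Real line bundle `R` over `Y`. -/
def IsRealTrivial (P : RealBundleGerbe Z) : Prop :=
  ∃ R : RealLineBundle Z, Nonempty (Iso P R.delta)

/-- `P` and `Q` are Real stably isomorphic if `Q ⊗ P^*` is Real trivial. -/
def IsRealStablyIso {W : RealSubmersion EM τ} (P : RealBundleGerbe Z) (Q : RealBundleGerbe W) :
    Prop :=
  (Q.tensor P.dual).IsRealTrivial

end RealBundleGerbe

/-! ### Čech cohomology of Real covers -/

/-- A Real open cover of `(M, τ)`, with a free involution `bar` of its index set. -/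
structure RealCover (τ : M → M) : Type (u + 1) where
  A : Type u
  U : A → Set M
  isOpen : ∀ a, IsOpen (U a)
  exists_mem : ∀ m, ∃ a, m ∈ U a
  bar : A → A
  bar_bar : ∀ a, bar (bar a) = a
  bar_ne : ∀ a, bar a ≠ a
  U_bar : ∀ a, U (bar a) = τ ⁻¹' U a

namespace RealCover

/-- A refinement of Real covers, an equivariant map of the index sets. -/
structure Refinement (𝓥 𝓤 : RealCover τ) : Type u where
  map : 𝓥.A → 𝓤.A
  map_bar : ∀ a, map (𝓥.bar a) = 𝓤.bar (map a)
  subset : ∀ a, 𝓥.U a ⊆ 𝓤.U (map a)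

/-- The common refinement of two Real covers by the intersections of their members. -/
def inter (𝓤 𝓥 : RealCover τ) : RealCover τ where
  A := 𝓤.A × 𝓥.A
  U := fun a => 𝓤.U a.1 ∩ 𝓥.U a.2
  isOpen := fun a => (𝓤.isOpen a.1).inter (𝓥.isOpen a.2)
  exists_mem := fun m => by
    obtain ⟨a, ha⟩ := 𝓤.exists_mem m
    obtain ⟨b, hb⟩ := 𝓥.exists_mem m
    exact ⟨(a, b), ha, hb⟩
  bar := fun a => (𝓤.bar a.1, 𝓥.bar a.2)
  bar_bar := fun a => Prod.ext (𝓤.bar_bar _) (𝓥.bar_bar _)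
  bar_ne := fun a h => 𝓤.bar_ne _ (congrArg Prod.fst h)
  U_bar := fun a => by rw [𝓤.U_bar, 𝓥.U_bar, Set.preimage_inter]

def interLeft (𝓤 𝓥 : RealCover τ) : Refinement (inter 𝓤 𝓥) 𝓤 :=
  ⟨Prod.fst, fun _ => rfl, fun _ => Set.inter_subset_left⟩

def interRight (𝓤 𝓥 : RealCover τ) : Refinement (inter 𝓤 𝓥) 𝓥 :=
  ⟨Prod.snd, fun _ => rfl, fun _ => Set.inter_subset_right⟩

def Refinement.refl (𝓤 : RealCover τ) : Refinement 𝓤 𝓤 :=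
  ⟨id, fun _ => rfl, fun _ => subset_rfl⟩

def Refinement.comp {𝓤 𝓥 𝓦 : RealCover τ} (g : Refinement 𝓥 𝓤) (f : Refinement 𝓦 𝓥) :
    Refinement 𝓦 𝓤 :=
  ⟨g.map ∘ f.map, fun a => by simp [f.map_bar, g.map_bar],
    fun a => (f.subset a).trans (g.subset _)⟩

variable (τ) in
/-- The Real cover by two copies of `M`. -/
def trivial : RealCover τ where
  A := ULift Bool
  U := fun _ => Set.univ
  isOpen := fun _ => isOpen_univ
  exists_mem := fun _ => ⟨⟨true⟩, _root_.trivial⟩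
  bar := fun a => ⟨!a.down⟩
  bar_bar := fun a => by simp
  bar_ne := fun a h => by
    have := congrArg ULift.down h
    simp at this
  U_bar := fun _ => rfl

end RealCover

/-- A Real `1`-cochain of a Real cover `𝓤`, a family of smooth maps `h_{ab} : U_{ab} → U(1)` with
`h_{āb̄} ∘ τ` the conjugate of `h_{ab}`. (The values outside of `U_{ab}` do not matter.) -/
structure RealCochain₁ (EM : Type u) {M : Type u} [NormedAddCommGroup EM] [NormedSpace ℝ EM]
    [TopologicalSpace M] [ChartedSpace EM M] {τ : M → M} (𝓤 : RealCover τ) : Type u where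
  val : 𝓤.A → 𝓤.A → M → Circle
  smooth : ∀ a b, ContMDiffOn 𝓘(ℝ, EM) (𝓡 1) ∞ (val a b) (𝓤.U a ∩ 𝓤.U b)
  real : ∀ a b, ∀ m ∈ 𝓤.U a ∩ 𝓤.U b, val (𝓤.bar a) (𝓤.bar b) (τ m) = (val a b m)⁻¹

/-- A Real `2`-cocycle of a Real cover `𝓤`, a family of smooth maps `g_{abc} : U_{abc} → U(1)` with
`g_{āb̄c̄} ∘ τ` the conjugate of `g_{abc}` that satisfies the cocycle condition on
`U_{abcd}`. -/
structure RealCocycle₂ (EM : Type u) {M : Type u} [NormedAddCommGroup EM] [NormedSpace ℝ EM]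
    [TopologicalSpace M] [ChartedSpace EM M] {τ : M → M} (𝓤 : RealCover τ) : Type u where
  val : 𝓤.A → 𝓤.A → 𝓤.A → M → Circle
  smooth : ∀ a b c, ContMDiffOn 𝓘(ℝ, EM) (𝓡 1) ∞ (val a b c) (𝓤.U a ∩ 𝓤.U b ∩ 𝓤.U c)
  real : ∀ a b c, ∀ m ∈ 𝓤.U a ∩ 𝓤.U b ∩ 𝓤.U c,
    val (𝓤.bar a) (𝓤.bar b) (𝓤.bar c) (τ m) = (val a b c m)⁻¹
  cocycle : ∀ a b c d, ∀ m ∈ 𝓤.U a ∩ 𝓤.U b ∩ 𝓤.U c ∩ 𝓤.U d,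
    val b c d m * (val a c d m)⁻¹ * val a b d m * (val a b c m)⁻¹ = 1

/-- A Real cover with a Real `2`-cocycle of it. -/
structure CechPair (EM : Type u) {M : Type u} [NormedAddCommGroup EM] [NormedSpace ℝ EM]
    [TopologicalSpace M] [ChartedSpace EM M] (τ : M → M) : Type (u + 1) where
  cover : RealCover τ
  cocycle : RealCocycle₂ EM cover

namespace CechPair

/-- Two cocycles are cohomologous if they differ by a Real coboundary on a common refinement. -/
def Cohomologous (x y : CechPair EM τ) : Prop :=
  ∃ (𝓦 : RealCover τ) (f : 𝓦.Refinement x.cover) (f' : 𝓦.Refinement y.cover)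
    (h : RealCochain₁ EM 𝓦), ∀ a b c, ∀ m ∈ 𝓦.U a ∩ 𝓦.U b ∩ 𝓦.U c,
      x.cocycle.val (f.map a) (f.map b) (f.map c) m =
        y.cocycle.val (f'.map a) (f'.map b) (f'.map c) m *
          (h.val b c m * (h.val a c m)⁻¹ * h.val a b m)

theorem Cohomologous.of_eq {x y : CechPair EM τ} (𝓦 : RealCover τ)
    (f : 𝓦.Refinement x.cover) (f' : 𝓦.Refinement y.cover)
    (h : ∀ a b c, ∀ m ∈ 𝓦.U a ∩ 𝓦.U b ∩ 𝓦.U c,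
      x.cocycle.val (f.map a) (f.map b) (f.map c) m =
        y.cocycle.val (f'.map a) (f'.map b) (f'.map c) m) : Cohomologous x y :=
  ⟨𝓦, f, f', ⟨fun _ _ _ => 1, fun _ _ => contMDiffOn_const, fun _ _ _ _ => by simp⟩,
    fun a b c m hm => by simp [h a b c m hm]⟩

theorem Cohomologous.symm {x y : CechPair EM τ} : Cohomologous x y → Cohomologous y x := by
  rintro ⟨𝓦, f, f', h, H⟩
  refine ⟨𝓦, f', f, ⟨fun a b m => (h.val a b m)⁻¹, fun a b => (h.smooth a b).inv,
    fun a b m hm => by rw [h.real a b m hm]⟩, fun a b c m hm => ?_⟩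
  have e : (h.val b c m)⁻¹ * ((h.val a c m)⁻¹)⁻¹ * (h.val a b m)⁻¹ =
      (h.val b c m * (h.val a c m)⁻¹ * h.val a b m)⁻¹ := by rw [mul_inv, mul_inv]
  rw [H a b c m hm, e, mul_inv_cancel_right]

theorem homotopy_identity_add {G : Type*} [AddCommGroup G]
    {uuu uvv vvv uvc ucc ubb uab ubc bvv bcc : G}
    (h1 : vvv - uvv + uvc - uab = 0) (h2 : bvv - uvv + ubc - ubb = 0)
    (h3 : bcc - ucc + ubc - uuu = 0) :
    uuu = vvv + ((bcc - bvv) - (ucc - uvc) + (ubb - uab)) := by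
  linear_combination (norm := abel) h2 - h1 - h3

theorem homotopy_identity {G : Type*} [CommGroup G]
    {uuu uvv vvv uvc ucc ubb uab ubc bvv bcc : G}
    (h1 : vvv * uvv⁻¹ * uvc * uab⁻¹ = 1) (h2 : bvv * uvv⁻¹ * ubc * ubb⁻¹ = 1)
    (h3 : bcc * ucc⁻¹ * ubc * uuu⁻¹ = 1) :
    uuu = vvv * ((bcc * bvv⁻¹) * (ucc * uvc⁻¹)⁻¹ * (ubb * uab⁻¹)) := by
  simp only [← div_eq_mul_inv] at *
  exact homotopy_identity_add (G := Additive G) h1 h2 h3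

/-- Two refinements of the same cover pull a cocycle back to cohomologous cocycles. -/
theorem exists_homotopy {𝓤 𝓦 : RealCover τ} (g : RealCocycle₂ EM 𝓤)
    (u v : 𝓦.Refinement 𝓤) :
    ∃ h : RealCochain₁ EM 𝓦, ∀ a b c, ∀ m ∈ 𝓦.U a ∩ 𝓦.U b ∩ 𝓦.U c,
      g.val (u.map a) (u.map b) (u.map c) m = g.val (v.map a) (v.map b) (v.map c) m *
        (h.val b c m * (h.val a c m)⁻¹ * h.val a b m) := by
  refine ⟨⟨fun a b m => g.val (u.map a) (u.map b) (v.map b) m *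
      (g.val (u.map a) (v.map a) (v.map b) m)⁻¹, fun a b => ?_, fun a b m hm => ?_⟩, ?_⟩
  · exact ((g.smooth _ _ _).mono fun m hm => ⟨⟨u.subset _ hm.1, u.subset _ hm.2⟩,
      v.subset _ hm.2⟩).mul ((g.smooth _ _ _).mono fun m hm => ⟨⟨u.subset _ hm.1,
        v.subset _ hm.1⟩, v.subset _ hm.2⟩).inv
  · simp only [u.map_bar, v.map_bar]
    rw [g.real _ _ _ m ⟨⟨u.subset _ hm.1, u.subset _ hm.2⟩, v.subset _ hm.2⟩,
      g.real _ _ _ m ⟨⟨u.subset _ hm.1, v.subset _ hm.1⟩, v.subset _ hm.2⟩, mul_inv]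
  · rintro a b c m ⟨⟨ha, hb⟩, hc⟩
    exact homotopy_identity
      (g.cocycle _ _ _ _ m ⟨⟨⟨u.subset _ ha, v.subset _ ha⟩, v.subset _ hb⟩, v.subset _ hc⟩)
      (g.cocycle _ _ _ _ m ⟨⟨⟨u.subset _ ha, u.subset _ hb⟩, v.subset _ hb⟩, v.subset _ hc⟩)
      (g.cocycle _ _ _ _ m ⟨⟨⟨u.subset _ ha, u.subset _ hb⟩, u.subset _ hc⟩, v.subset _ hc⟩)

theorem Cohomologous.trans {x y z : CechPair EM τ} :
    Cohomologous x y → Cohomologous y z → Cohomologous x z := by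
  rintro ⟨𝓦, f, f', h, H⟩ ⟨𝓥, k, k', l, L⟩
  obtain ⟨e, he⟩ := exists_homotopy (𝓦 := 𝓦.inter 𝓥) y.cocycle
    (f'.comp (𝓦.interLeft 𝓥)) (k.comp (𝓦.interRight 𝓥))
  refine ⟨𝓦.inter 𝓥, f.comp (𝓦.interLeft 𝓥), k'.comp (𝓦.interRight 𝓥),
    ⟨fun a b m => h.val a.1 b.1 m * e.val a b m * l.val a.2 b.2 m, fun a b => ?_,
      fun a b m hm => ?_⟩, ?_⟩
  · exact (((h.smooth _ _).mono fun m hm => ⟨hm.1.1, hm.2.1⟩).mul (e.smooth _ _)).mul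
      ((l.smooth _ _).mono fun m hm => ⟨hm.1.2, hm.2.2⟩)
  · have e1 := h.real _ _ m ⟨hm.1.1, hm.2.1⟩
    have e2 := l.real _ _ m ⟨hm.1.2, hm.2.2⟩
    have e3 := e.real _ _ m hm
    rw [e3, mul_inv, mul_inv, ← e1, ← e2]
    rfl
  · rintro a b c m hm
    have e1 := H a.1 b.1 c.1 m ⟨⟨hm.1.1.1, hm.1.2.1⟩, hm.2.1⟩
    have e2 := L a.2 b.2 c.2 m ⟨⟨hm.1.1.2, hm.1.2.2⟩, hm.2.2⟩
    have e3 := he a b c m hm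
    refine e1.trans ((congrArg (· * _) (e3.trans (congrArg (· * _) e2))).trans ?_)
    change _ = z.cocycle.val (k'.map a.2) (k'.map b.2) (k'.map c.2) m * _
    simp only [mul_inv]
    ac_rfl

/-- The relation of being cohomologous. -/
def setoid (EM : Type u) {M : Type u} [NormedAddCommGroup EM] [NormedSpace ℝ EM]
    [TopologicalSpace M] [ChartedSpace EM M] (τ : M → M) : Setoid (CechPair EM τ) where
  r := Cohomologous
  iseqv :=
    { refl := fun x => Cohomologous.of_eq x.cover (RealCover.Refinement.refl _)
        (RealCover.Refinement.refl _) fun _ _ _ _ _ => rfl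
      symm := Cohomologous.symm
      trans := Cohomologous.trans }

/-- The product of two cocycles on the common refinement of their covers. -/
def mul (x y : CechPair EM τ) : CechPair EM τ where
  cover := x.cover.inter y.cover
  cocycle :=
    { val := fun a b c m => x.cocycle.val a.1 b.1 c.1 m * y.cocycle.val a.2 b.2 c.2 m
      smooth := fun a b c =>
        ((x.cocycle.smooth _ _ _).mono fun m hm => ⟨⟨hm.1.1.1, hm.1.2.1⟩, hm.2.1⟩).mul
          ((y.cocycle.smooth _ _ _).mono fun m hm => ⟨⟨hm.1.1.2, hm.1.2.2⟩, hm.2.2⟩)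
      real := fun a b c m hm => by
        have e1 := x.cocycle.real _ _ _ m ⟨⟨hm.1.1.1, hm.1.2.1⟩, hm.2.1⟩
        have e2 := y.cocycle.real _ _ _ m ⟨⟨hm.1.1.2, hm.1.2.2⟩, hm.2.2⟩
        rw [mul_inv, ← e1, ← e2]
        rfl
      cocycle := fun a b c d m hm => by
        have e1 := x.cocycle.cocycle _ _ _ _ m
          ⟨⟨⟨hm.1.1.1.1, hm.1.1.2.1⟩, hm.1.2.1⟩, hm.2.1⟩
        have e2 := y.cocycle.cocycle _ _ _ _ m
          ⟨⟨⟨hm.1.1.1.2, hm.1.1.2.2⟩, hm.1.2.2⟩, hm.2.2⟩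
        refine Eq.trans ?_ ((congrArg₂ (· * ·) e1 e2).trans (mul_one 1))
        simp only [mul_inv]
        ac_rfl }

/-- The inverse cocycle. -/
def inv (x : CechPair EM τ) : CechPair EM τ where
  cover := x.cover
  cocycle :=
    { val := fun a b c m => (x.cocycle.val a b c m)⁻¹
      smooth := fun a b c => (x.cocycle.smooth a b c).inv
      real := fun a b c m hm => by rw [x.cocycle.real a b c m hm]
      cocycle := fun a b c d m hm => by
        rw [← mul_inv, ← mul_inv, ← mul_inv, x.cocycle.cocycle a b c d m hm, inv_one] }

/-- The trivial cocycle. -/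
def one : CechPair EM τ where
  cover := RealCover.trivial τ
  cocycle :=
    { val := fun _ _ _ _ => 1
      smooth := fun _ _ _ => contMDiffOn_const
      real := fun _ _ _ _ _ => by simp
      cocycle := fun _ _ _ _ _ _ => by simp }

theorem Cohomologous.mul {x x' y y' : CechPair EM τ} :
    Cohomologous x x' → Cohomologous y y' → Cohomologous (x.mul y) (x'.mul y') := by
  rintro ⟨𝓦, f, f', h, H⟩ ⟨𝓥, k, k', l, L⟩
  refine ⟨𝓦.inter 𝓥,
    ⟨fun a => (f.map a.1, k.map a.2), fun a => Prod.ext (f.map_bar _) (k.map_bar _),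
      fun a => Set.inter_subset_inter (f.subset _) (k.subset _)⟩,
    ⟨fun a => (f'.map a.1, k'.map a.2), fun a => Prod.ext (f'.map_bar _) (k'.map_bar _),
      fun a => Set.inter_subset_inter (f'.subset _) (k'.subset _)⟩,
    ⟨fun a b m => h.val a.1 b.1 m * l.val a.2 b.2 m, fun a b => ?_, fun a b m hm => ?_⟩, ?_⟩
  · exact ((h.smooth _ _).mono fun m hm => ⟨hm.1.1, hm.2.1⟩).mul
      ((l.smooth _ _).mono fun m hm => ⟨hm.1.2, hm.2.2⟩)
  · have e1 := h.real _ _ m ⟨hm.1.1, hm.2.1⟩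
    have e2 := l.real _ _ m ⟨hm.1.2, hm.2.2⟩
    rw [mul_inv, ← e1, ← e2]
    rfl
  · rintro a b c m hm
    have e1 := H a.1 b.1 c.1 m ⟨⟨hm.1.1.1, hm.1.2.1⟩, hm.2.1⟩
    have e2 := L a.2 b.2 c.2 m ⟨⟨hm.1.1.2, hm.1.2.2⟩, hm.2.2⟩
    refine (congrArg₂ (· * ·) e1 e2).trans ?_
    change _ = (x'.cocycle.val _ _ _ m * y'.cocycle.val _ _ _ m) * _
    simp only [mul_inv]
    ac_rfl

theorem Cohomologous.inv {x x' : CechPair EM τ} :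
    Cohomologous x x' → Cohomologous x.inv x'.inv := by
  rintro ⟨𝓦, f, f', h, H⟩
  refine ⟨𝓦, f, f', ⟨fun a b m => (h.val a b m)⁻¹, fun a b => (h.smooth a b).inv,
    fun a b m hm => by rw [h.real a b m hm]⟩, fun a b c m hm => ?_⟩
  refine (congrArg (·⁻¹) (H a b c m hm)).trans ?_
  change _ = (x'.cocycle.val _ _ _ m)⁻¹ * _
  simp only [mul_inv]

end CechPair

/-- The group `H²(M; ℤ₂, Ū(1))`, the inductive limit over the Real open covers of `(M, τ)` of the
second cohomology of the complex of Real cochains. -/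
def RealH2 (EM : Type u) {M : Type u} [NormedAddCommGroup EM] [NormedSpace ℝ EM]
    [TopologicalSpace M] [ChartedSpace EM M] (τ : M → M) : Type (u + 1) :=
  Quotient (CechPair.setoid EM τ)

namespace RealH2

/-- The class of a Real cocycle. -/
def mk (𝓤 : RealCover τ) (g : RealCocycle₂ EM 𝓤) : RealH2 EM τ :=
  Quotient.mk (CechPair.setoid EM τ) ⟨𝓤, g⟩

instance : Zero (RealH2 EM τ) := ⟨Quotient.mk _ CechPair.one⟩

instance : Add (RealH2 EM τ) :=
  ⟨Quotient.map₂ CechPair.mul fun _ _ h _ _ h' => CechPair.Cohomologous.mul h h'⟩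

instance : Neg (RealH2 EM τ) :=
  ⟨Quotient.map CechPair.inv fun _ _ h => CechPair.Cohomologous.inv h⟩

instance : AddCommGroup (RealH2 EM τ) where
  nsmul := nsmulRec
  zsmul := zsmulRec
  add_assoc := by
    rintro ⟨x⟩ ⟨y⟩ ⟨z⟩
    exact Quotient.sound (CechPair.Cohomologous.of_eq ((x.cover.inter y.cover).inter z.cover)
      (RealCover.Refinement.refl _)
      ⟨fun a => (a.1.1, (a.1.2, a.2)), fun _ => rfl, fun _ _ hm => ⟨hm.1.1, hm.1.2, hm.2⟩⟩
      fun _ _ _ _ _ => mul_assoc _ _ _)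
  zero_add := by
    rintro ⟨x⟩
    exact Quotient.sound (CechPair.Cohomologous.of_eq ((RealCover.trivial τ).inter x.cover)
      (RealCover.Refinement.refl _) (RealCover.interRight _ _) fun _ _ _ _ _ => one_mul _)
  add_zero := by
    rintro ⟨x⟩
    exact Quotient.sound (CechPair.Cohomologous.of_eq (x.cover.inter (RealCover.trivial τ))
      (RealCover.Refinement.refl _) (RealCover.interLeft _ _) fun _ _ _ _ _ => mul_one _)
  neg_add_cancel := by
    rintro ⟨x⟩
    exact Quotient.sound (CechPair.Cohomologous.of_eq (x.cover.inter (RealCover.trivial τ))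
      ⟨fun a => (a.1, a.1), fun _ => rfl, fun _ _ hm => ⟨hm.1, hm.1⟩⟩
      (RealCover.interRight _ _) fun _ _ _ _ _ => inv_mul_cancel _)
  add_comm := by
    rintro ⟨x⟩ ⟨y⟩
    exact Quotient.sound (CechPair.Cohomologous.of_eq (x.cover.inter y.cover)
      (RealCover.Refinement.refl _)
      ⟨fun a => (a.2, a.1), fun _ => rfl, fun _ _ hm => ⟨hm.2, hm.1⟩⟩
      fun _ _ _ _ _ => mul_comm _ _)

end RealH2

/-! ### The Real Dixmier-Douady class -/

namespace RealBundleGerbe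

variable {Z : RealSubmersion EM τ}

/-- `c` is represented by a cocycle `g` of a Real cover `U` obtained from `P` in the following way:
there are smooth sections `s_a : U_a → Y` with `s_ā = inv ∘ s_a ∘ τ` and smooth sections `σ_{ab}` of
the pullbacks of `P` by `(s_a, s_b) : U_{ab} → Y^{[2]}` with `σ_{āb̄} = conj ∘ σ_{ab} ∘ τ`, and
`σ_{ab} σ_{bc} = σ_{ac} g_{abc}` on `U_{abc}`. -/
def IsRealDDClass (P : RealBundleGerbe Z) (c : RealH2 EM τ) : Prop :=
  ∃ (𝓤 : RealCover τ) (g : RealCocycle₂ EM 𝓤) (s : 𝓤.A → M → Z.N)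
    (σ : 𝓤.A → 𝓤.A → M → P.bundle.Tot),
    (∀ a, ContMDiffOn 𝓘(ℝ, EM) Z.I ∞ (s a) (𝓤.U a)) ∧
    (∀ a, ∀ m ∈ 𝓤.U a, s a m ∈ Z.carrier ∧ Z.π (s a m) = m) ∧
    (∀ a, ∀ m ∈ 𝓤.U a, s (𝓤.bar a) (τ m) = Z.inv (s a m)) ∧
    (∀ a b, IsSmoothSectionAlong P.bundle 𝓘(ℝ, EM) (𝓤.U a ∩ 𝓤.U b)
      (fun m => (s a m, s b m)) (σ a b)) ∧
    (∀ a b, ∀ m ∈ 𝓤.U a ∩ 𝓤.U b, σ (𝓤.bar a) (𝓤.bar b) (τ m) = P.conj (σ a b m)) ∧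
    (∀ a b c, ∀ m ∈ 𝓤.U a ∩ 𝓤.U b ∩ 𝓤.U c,
      P.mul (σ a b m) (σ b c m) = g.val a b c m • σ a c m) ∧
    c = RealH2.mk 𝓤 g

/-- The Real Dixmier-Douady class of `P`, the unique `c` with `P.IsRealDDClass c` (the choice
operator would return an arbitrary class if there were no such `c`). -/
def realDD (P : RealBundleGerbe Z) : RealH2 EM τ :=
  Classical.epsilon P.IsRealDDClass

end RealBundleGerbe

end Submersions
end RealGerbe

/-! The whole argument is the classical Čech description of bundle gerbes, carried out
equivariantly. Since the involution of the index set of a Real cover is free, a choice for one index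
of each pair `a`, `ā` determines the choice for the other by applying the involution, and no
compatibility is required at fixed points of `τ`. Hence every local choice of the classical proof
can be made Real after doubling the cover.

Sections `s_a` come from the local normal form of a submersion. Sections `σ_ab` are needed over the
whole of each overlap `U_ab`; in place of a good cover, paracompactness gives a cover so fine that
each member meets only finitely many of the relevant sets, and the bundles in question have sections
over it (`RealSections.exists_of_paracompact`). The quotient of `σ_ab σ_bc` by `σ_ac` is a cocycle
because the product of `P` is associative (`RealSections.exists_hasCocycle`). Two systems `(s, σ)`
and `(s', σ')` are compared on a common refinement by Real sections `ρ_a` of `P` over `(s_a, s'_a)`: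
the functions `h_ab` with `σ_ab ρ_b = h_ab ρ_a σ'_ab` form a cochain whose coboundary is the
quotient of the cocycles (`RealSections.mk_eq_mk_of_sections`).

For `δR`, Real lifts `ρ_a` of `s_a` to `R` give `σ_ab = ρ_a^* ⊗ ρ_b`, whose cocycle is `1`.
Conversely, if the class vanishes, then `σ` can be rescaled so that `σ_ab σ_bc = σ_ac`
(`IsRealDDClass.nonempty_descentData`). Left multiplication by `σ_ba` then glues the bundles with
fibres `P_(s_a(π y), y)` to a Real line bundle `R` over `Y`, and `p ↦ r^* ⊗ r p`, for any `r` in the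
fibre of `R` over the first point of `p`, is an isomorphism `P ≅ δR` (`DescentData.isRealTrivial`).

Tensor products of sections multiply cocycles and the conjugate action inverts them, so the class is
additive and changes sign under duality. The criterion for stable isomorphism is then the vanishing
criterion applied to `Q ⊗ P^*`. -/

namespace RealGerbe

/-! ### Calculus of smooth sections of `U(1)`-bundles along maps. -/

section SmoothSections

variable {E H N E' H' N' E'' H'' N'' : Type u}
  [NormedAddCommGroup E] [NormedSpace ℝ E] [TopologicalSpace H] [TopologicalSpace N]
  [ChartedSpace H N]
  [NormedAddCommGroup E'] [NormedSpace ℝ E'] [TopologicalSpace H'] [TopologicalSpace N']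
  [ChartedSpace H' N']
  [NormedAddCommGroup E''] [NormedSpace ℝ E''] [TopologicalSpace H''] [TopologicalSpace N'']
  [ChartedSpace H'' N'']
  {I : ModelWithCorners ℝ E H} {I' : ModelWithCorners ℝ E' H'} {I'' : ModelWithCorners ℝ E'' H''}
  {S : Set N}

namespace U1Bundle

theorem eq_of_coord_eq (B : U1Bundle I S) {p q : B.Tot} (h : B.proj p = B.proj q) {i : B.ι}
    (hi : B.proj p ∈ B.dom i) (hc : B.coord i p = B.coord i q) : p = q := by
  obtain ⟨z, rfl⟩ := B.exists_smul p q h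
  rw [B.coord_smul i z p hi] at hc
  rw [right_eq_mul.mp hc, one_smul]

/-- Smoothness of circle-valued maps may be tested over the trivialising open sets. -/
theorem contMDiffOn_of_forall_dom (B : U1Bundle I S) {V : Set N'} {f : N' → N} {h : N' → Circle}
    (hf : ContinuousOn f V) (hS : Set.MapsTo f V S)
    (H : ∀ i, ContMDiffOn I' (𝓡 1) ∞ h {x | x ∈ V ∧ f x ∈ B.dom i}) :
    ContMDiffOn I' (𝓡 1) ∞ h V := fun x hx => by
  obtain ⟨i, hi⟩ := B.exists_dom _ (hS hx)
  exact (H i x ⟨hx, hi⟩).mono_of_mem_nhdsWithin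
    (Filter.inter_mem self_mem_nhdsWithin (hf x hx ((B.isOpen_dom i).mem_nhds hi)))

/-- The section that is `1` in the trivialisation number `i`. -/
theorem exists_section_coord_eq_one (B : U1Bundle I S) [Nonempty B.Tot] {V : Set N'} {f : N' → N}
    (hf : ContMDiffOn I' I ∞ f V) (i : B.ι) (h : ∀ x ∈ V, f x ∈ S ∧ f x ∈ B.dom i) :
    ∃ s, IsSmoothSectionAlong B I' V f s ∧ ∀ x ∈ V, B.coord i (s x) = 1 := by
  have key : ∀ x ∈ V, ∃ p, B.proj p = f x ∧ B.coord i p = 1 := fun x hx => by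
    obtain ⟨p, hp⟩ := B.exists_fibre _ (h x hx).1
    refine ⟨(B.coord i p)⁻¹ • p, by rw [B.proj_smul, hp], ?_⟩
    rw [B.coord_smul _ _ _ (by rw [hp]; exact (h x hx).2), inv_mul_cancel]
  choose! s hs hs' using key
  refine ⟨s, ⟨hs, fun j => ?_⟩, hs'⟩
  obtain ⟨g, hg, hgs⟩ := B.transition i j
  refine (hg.comp (hf.mono fun x hx => hx.1) fun x hx =>
    ⟨(h x hx.1).1, (h x hx.1).2, hx.2⟩).congr fun x hx => ?_
  have := hgs (s x) (by rw [hs x hx.1]; exact (h x hx.1).2) (by rw [hs x hx.1]; exact hx.2)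
  rw [this, hs x hx.1, hs' x hx.1, mul_one]
  rfl

end U1Bundle

namespace IsSmoothSectionAlong

variable {B : U1Bundle I S} {V : Set N'} {f : N' → N} {s t : N' → B.Tot}

theorem mapsTo (h : IsSmoothSectionAlong B I' V f s) : Set.MapsTo f V S := fun x hx => by
  rw [← h.proj x hx]
  exact B.proj_mem _

theorem mono (h : IsSmoothSectionAlong B I' V f s) {W : Set N'} (hW : W ⊆ V) :
    IsSmoothSectionAlong B I' W f s :=
  ⟨fun x hx => h.proj x (hW hx), fun i => (h.smooth i).mono fun _ hx => ⟨hW hx.1, hx.2⟩⟩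

theorem congr (h : IsSmoothSectionAlong B I' V f s) {f' : N' → N} (hf : ∀ x ∈ V, f' x = f x)
    (hs : ∀ x ∈ V, t x = s x) : IsSmoothSectionAlong B I' V f' t :=
  ⟨fun x hx => by rw [hs x hx, hf x hx, h.proj x hx], fun i => by
    refine ((h.smooth i).mono ?_).congr ?_
    · rintro x ⟨hx, hi⟩
      exact ⟨hx, by rw [← hf x hx]; exact hi⟩
    · rintro x ⟨hx, -⟩
      rw [hs x hx]⟩

/-- Disjoint members of a cover also need a `σ_ab`, and there any function will do. -/
theorem of_isEmpty (hV : V = ∅) : IsSmoothSectionAlong B I' V f s := by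
  subst hV
  exact ⟨fun _ hx => hx.elim, fun _ _ hx => hx.1.elim⟩

/-- The pullback of a section. -/
theorem comp (h : IsSmoothSectionAlong B I' V f s) {W : Set N''} {φ : N'' → N'}
    (hφ : ContMDiffOn I'' I' ∞ φ W) (hW : Set.MapsTo φ W V) :
    IsSmoothSectionAlong B I'' W (fun x => f (φ x)) fun x => s (φ x) :=
  ⟨fun _ hx => h.proj _ (hW hx), fun i => (h.smooth i).comp (hφ.mono fun _ hx => hx.1)
    fun _ hx => ⟨hW hx.1, hx.2⟩⟩

theorem smul (h : IsSmoothSectionAlong B I' V f s) {z : N' → Circle}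
    (hz : ContMDiffOn I' (𝓡 1) ∞ z V) : IsSmoothSectionAlong B I' V f fun x => z x • s x :=
  ⟨fun x hx => by rw [B.proj_smul, h.proj x hx], fun i =>
    ((hz.mono fun _ hx => hx.1).mul (h.smooth i)).congr fun x hx =>
      B.coord_smul i _ _ (by rw [h.proj x hx.1]; exact hx.2)⟩

/-- In each trivialisation the quotient of two sections is the ratio of their coordinates. The
cocycle of `P` and the cochain that compares two cocycles are quotients of this kind, and owe their
smoothness to this. -/
theorem contMDiffOn_div (h : IsSmoothSectionAlong B I' V f s)
    (h' : IsSmoothSectionAlong B I' V f t) (hf : ContinuousOn f V) :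
    ContMDiffOn I' (𝓡 1) ∞ (fun x => B.div (s x) (t x)) V := by
  refine B.contMDiffOn_of_forall_dom hf h.mapsTo fun i =>
    ((h.smooth i).mul (h'.smooth i).inv).congr fun x hx => ?_
  have e : B.div (s x) (t x) • t x = s x := B.div_smul (by rw [h.proj x hx.1, h'.proj x hx.1])
  have e' := B.coord_smul i (B.div (s x) (t x)) (t x) (by rw [h'.proj x hx.1]; exact hx.2)
  rw [e] at e'
  exact eq_mul_inv_of_mul_eq e'.symm

/-- The smoothness of `F` is known only relative to a trivialisation of the source and one of the
target, so the domain of a trivialisation of `B'` is cut up further by those of `B`. The conjugate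
version below works in the same way. -/
theorem map {S' : Set N''} {B' : U1Bundle I'' S'} {φ : N → N''} {F : B.Tot → B'.Tot} (hF : IsBundleMap B B' φ F)
    (h : IsSmoothSectionAlong B I' V f s) (hf : ContMDiffOn I' I ∞ f V) :
    IsSmoothSectionAlong B' I' V (fun x => φ (f x)) fun x => F (s x) :=
  ⟨fun x hx => by rw [hF.proj, h.proj x hx], fun j => by
    refine B.contMDiffOn_of_forall_dom (hf.continuousOn.mono fun _ hx => hx.1)
      (fun x hx => h.mapsTo hx.1) fun i => ?_
    obtain ⟨g, hg, hgF⟩ := hF.smooth i j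
    refine ((hg.comp (hf.mono fun x hx => hx.1.1) fun x hx =>
      ⟨h.mapsTo hx.1.1, hx.2, hx.1.2⟩).mul
        ((h.smooth i).mono fun x hx => ⟨hx.1.1, hx.2⟩)).congr fun x hx => ?_
    have e := h.proj x hx.1.1
    have := hgF (s x) (by rw [e]; exact hx.2) (by rw [e]; exact hx.1.2)
    rw [e] at this
    exact this⟩

theorem conj {S' : Set N''} {B' : U1Bundle I'' S'} {φ : N → N''} {F : B.Tot → B'.Tot} (hF : IsConjBundleMap B B' φ F)
    (h : IsSmoothSectionAlong B I' V f s) (hf : ContMDiffOn I' I ∞ f V) :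
    IsSmoothSectionAlong B' I' V (fun x => φ (f x)) fun x => F (s x) :=
  ⟨fun x hx => by rw [hF.proj, h.proj x hx], fun j => by
    refine B.contMDiffOn_of_forall_dom (hf.continuousOn.mono fun _ hx => hx.1)
      (fun x hx => h.mapsTo hx.1) fun i => ?_
    obtain ⟨g, hg, hgF⟩ := hF.smooth i j
    refine ((hg.comp (hf.mono fun x hx => hx.1.1) fun x hx =>
      ⟨h.mapsTo hx.1.1, hx.2, hx.1.2⟩).mul
        ((h.smooth i).mono fun x hx => ⟨hx.1.1, hx.2⟩).inv).congr fun x hx => ?_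
    have e := h.proj x hx.1.1
    have := hgF (s x) (by rw [e]; exact hx.2) (by rw [e]; exact hx.1.2)
    rw [e] at this
    exact this⟩

theorem dual (h : IsSmoothSectionAlong B I' V f s) :
    IsSmoothSectionAlong B.dual I' V f s :=
  ⟨h.proj, fun i => (h.smooth i).inv⟩

/-- A section is a total function, but `s x ⊗ t x` makes sense only where both points lie in fibres
over the same point. Hence the existential form; `hne` supplies the irrelevant values outside `V`.
The same applies to `exists_pullback`. -/
theorem exists_tensor {B' : U1Bundle I S} {t : N' → B'.Tot}
    (h : IsSmoothSectionAlong B I' V f s) (h' : IsSmoothSectionAlong B' I' V f t)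
    (hne : Nonempty (B.tensor B').Tot) :
    ∃ r : N' → (B.tensor B').Tot, IsSmoothSectionAlong (B.tensor B') I' V f r ∧
      ∀ x ∈ V, ∃ e : B.proj (s x) = B'.proj (t x),
        r x = Quotient.mk (U1Bundle.tensorSetoid B B') ⟨(s x, t x), e⟩ := by
  have key : ∀ x ∈ V, ∃ r : (B.tensor B').Tot, ∃ e : B.proj (s x) = B'.proj (t x),
      r = Quotient.mk (U1Bundle.tensorSetoid B B') ⟨(s x, t x), e⟩ := fun x hx =>
    ⟨_, (h.proj x hx).trans (h'.proj x hx).symm, rfl⟩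
  choose! r hr using key
  refine ⟨r, ⟨fun x hx => ?_, fun i => ?_⟩, hr⟩
  · obtain ⟨e, he⟩ := hr x hx
    rw [he]
    exact h.proj x hx
  · refine (((h.smooth i.1).mono fun x hx => ⟨hx.1, hx.2.1⟩).mul
      ((h'.smooth i.2).mono fun x hx => ⟨hx.1, hx.2.2⟩)).congr fun x hx => ?_
    obtain ⟨e, he⟩ := hr x hx.1
    rw [he]
    refine U1Bundle.coord_out B B' i.1 i.2 ⟨(s x, t x), e⟩ ?_ ?_
    · rw [h.proj x hx.1]
      exact hx.2.1
    · rw [h.proj x hx.1]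
      exact hx.2.2

theorem exists_pullback {S' : Set N''} {φ : N'' → N} (hφ : ContMDiff I'' I ∞ φ)
    (hS : Set.MapsTo φ S' S) {k : N' → N''} {s : N' → B.Tot}
    (h : IsSmoothSectionAlong B I' V f s) (hk : Set.MapsTo k V S') (hkf : ∀ x ∈ V, φ (k x) = f x)
    (hne : Nonempty (B.pullback I'' S' φ hφ hS).Tot) :
    ∃ r : N' → (B.pullback I'' S' φ hφ hS).Tot,
      IsSmoothSectionAlong (B.pullback I'' S' φ hφ hS) I' V k r ∧
      ∀ x ∈ V, (r x).1 = (k x, s x) := by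
  have key : ∀ x ∈ V, ∃ r : (B.pullback I'' S' φ hφ hS).Tot, r.1 = (k x, s x) := fun x hx =>
    ⟨⟨(k x, s x), hk hx, (h.proj x hx).trans (hkf x hx).symm⟩, rfl⟩
  choose! r hr using key
  refine ⟨r, ⟨fun x hx => congrArg Prod.fst (hr x hx), fun i => ?_⟩, hr⟩
  refine ((h.smooth i).mono ?_).congr fun x hx => ?_
  · rintro x ⟨hx, hi⟩
    have hi : φ (k x) ∈ B.dom i := hi
    rw [hkf x hx] at hi
    exact ⟨hx, hi⟩
  · exact congrArg (fun y => B.coord i y.2) (hr x hx.1)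

end IsSmoothSectionAlong

/-- Smooth sections exist locally. -/
theorem U1Bundle.exists_local_section (B : U1Bundle I S) {V : Set N'} (hV : IsOpen V) {f : N' → N}
    (hf : ContMDiffOn I' I ∞ f V) (hS : Set.MapsTo f V S) {x : N'} (hx : x ∈ V) :
    ∃ (W : Set N') (s : N' → B.Tot), IsOpen W ∧ x ∈ W ∧ W ⊆ V ∧ IsSmoothSectionAlong B I' W f s := by
  obtain ⟨i, hi⟩ := B.exists_dom _ (hS hx)
  obtain ⟨p, -⟩ := B.exists_fibre _ (hS hx)
  have : Nonempty B.Tot := ⟨p⟩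
  obtain ⟨s, hs, -⟩ := B.exists_section_coord_eq_one (V := V ∩ f ⁻¹' B.dom i)
    (hf.mono Set.inter_subset_left) i fun y hy => ⟨hS hy.1, hy.2⟩
  exact ⟨_, s, hf.continuousOn.isOpen_inter_preimage hV (B.isOpen_dom i), ⟨hx, hi⟩,
    Set.inter_subset_left, hs⟩

end SmoothSections

namespace BundleGerbe

variable {EM M : Type u} [NormedAddCommGroup EM] [NormedSpace ℝ EM] [TopologicalSpace M]
  [ChartedSpace EM M] {Z : SurjSubmersion EM M}
  {E' H' N' : Type u} [NormedAddCommGroup E'] [NormedSpace ℝ E'] [TopologicalSpace H']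
  [TopologicalSpace N'] [ChartedSpace H' N'] {I' : ModelWithCorners ℝ E' H'}

/-- The product of two smooth sections of a bundle gerbe. -/
theorem isSmoothSectionAlong_mul (P : BundleGerbe Z) {V : Set N'} {f₁ f₂ f₃ : N' → Z.N}
    (h₁ : ContMDiffOn I' Z.I ∞ f₁ V) (h₂ : ContMDiffOn I' Z.I ∞ f₂ V)
    (h₃ : ContMDiffOn I' Z.I ∞ f₃ V) {s t : N' → P.bundle.Tot}
    (hs : IsSmoothSectionAlong P.bundle I' V (fun x => (f₁ x, f₂ x)) s)
    (ht : IsSmoothSectionAlong P.bundle I' V (fun x => (f₂ x, f₃ x)) t) :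
    IsSmoothSectionAlong P.bundle I' V (fun x => (f₁ x, f₃ x)) fun x => P.mul (s x) (t x) := by
  have hst : ∀ x ∈ V, (P.bundle.proj (s x)).2 = (P.bundle.proj (t x)).1 := fun x hx => by
    rw [hs.proj x hx, ht.proj x hx]
  refine ⟨fun x hx => by rw [P.proj_mul _ _ (hst x hx), hs.proj x hx, ht.proj x hx], fun k => ?_⟩
  -- The trivialisation `k` at the product is given; trivialisations `i` and `j` at the two factors
  -- are brought in locally, so that `smooth_mul` applies.
  refine P.bundle.contMDiffOn_of_forall_dom (f := fun x => (f₁ x, f₂ x))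
    ((h₁.continuousOn.prodMk h₂.continuousOn).mono fun _ hx => hx.1)
    (fun x hx => hs.mapsTo hx.1) fun i => ?_
  refine P.bundle.contMDiffOn_of_forall_dom (f := fun x => (f₂ x, f₃ x))
    ((h₂.continuousOn.prodMk h₃.continuousOn).mono fun _ hx => hx.1.1)
    (fun x hx => ht.mapsTo hx.1.1) fun j => ?_
  obtain ⟨g, hg, hgm⟩ := P.smooth_mul i j k
  have hf : ContMDiffOn I' (Z.I.prod (Z.I.prod Z.I)) ∞ (fun x => (f₁ x, f₂ x, f₃ x)) V :=
    h₁.prodMk (h₂.prodMk h₃)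
  refine ((hg.comp (hf.mono fun x hx => hx.1.1.1) ?_).mul
    (((hs.smooth i).mono ?_).mul ((ht.smooth j).mono ?_))).congr ?_
  · rintro x ⟨⟨⟨hx, hk⟩, hi⟩, hj⟩
    exact ⟨⟨hs.mapsTo hx, ht.mapsTo hx⟩, hi, hj, hk⟩
  · rintro x ⟨⟨⟨hx, hk⟩, hi⟩, hj⟩
    exact ⟨hx, hi⟩
  · rintro x ⟨⟨⟨hx, hk⟩, hi⟩, hj⟩
    exact ⟨hx, hj⟩
  · rintro x ⟨⟨⟨hx, hk⟩, hi⟩, hj⟩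
    have := hgm (s x) (t x) (hst x hx) (by rw [hs.proj x hx]; exact hi)
      (by rw [ht.proj x hx]; exact hj) (by rw [hs.proj x hx, ht.proj x hx]; exact hk)
    rw [hs.proj x hx, ht.proj x hx] at this
    exact this

end BundleGerbe

end RealGerbe

/-! ### Systems of Real sections, their cocycles, and refinements. -/

namespace RealGerbe

variable {EM M : Type u} [NormedAddCommGroup EM] [NormedSpace ℝ EM] [TopologicalSpace M]
  [ChartedSpace EM M] {τ : M → M} {Z : RealSubmersion EM τ}

theorem RealCover.apply_mem_bar (𝓤 : RealCover τ) (hττ : Function.Involutive τ) {a : 𝓤.A} {m : M}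
    (hm : m ∈ 𝓤.U a) : τ m ∈ 𝓤.U (𝓤.bar a) := by
  rw [𝓤.U_bar]
  change τ (τ m) ∈ 𝓤.U a
  rwa [hττ m]

/-- Real sections `s_a` of `π : Y → M` over the members of a Real cover, together with Real
sections `σ_{ab}` of the pullbacks of `P` by `(s_a, s_b)`. -/
structure RealSections (P : RealBundleGerbe Z) (𝓤 : RealCover τ) : Type u where
  s : 𝓤.A → M → Z.N
  σ : 𝓤.A → 𝓤.A → M → P.bundle.Tot
  smooth_s : ∀ a, ContMDiffOn 𝓘(ℝ, EM) Z.I ∞ (s a) (𝓤.U a)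
  s_mem : ∀ a, ∀ m ∈ 𝓤.U a, s a m ∈ Z.carrier ∧ Z.π (s a m) = m
  s_real : ∀ a, ∀ m ∈ 𝓤.U a, s (𝓤.bar a) (τ m) = Z.inv (s a m)
  isSection : ∀ a b, IsSmoothSectionAlong P.bundle 𝓘(ℝ, EM) (𝓤.U a ∩ 𝓤.U b)
    (fun m => (s a m, s b m)) (σ a b)
  σ_real : ∀ a b, ∀ m ∈ 𝓤.U a ∩ 𝓤.U b, σ (𝓤.bar a) (𝓤.bar b) (τ m) = P.conj (σ a b m)

namespace RealSections

variable {P : RealBundleGerbe Z} {𝓤 : RealCover τ}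

/-- `σ_{ab} σ_{bc} = g_{abc} σ_{ac}`. -/
def HasCocycle (D : RealSections P 𝓤) (g : RealCocycle₂ EM 𝓤) : Prop :=
  ∀ a b c, ∀ m ∈ 𝓤.U a ∩ 𝓤.U b ∩ 𝓤.U c,
    P.mul (D.σ a b m) (D.σ b c m) = g.val a b c m • D.σ a c m

theorem isRealDDClass_iff {c : RealH2 EM τ} :
    P.IsRealDDClass c ↔ ∃ (𝓤 : RealCover τ) (D : RealSections P 𝓤) (g : RealCocycle₂ EM 𝓤),
      D.HasCocycle g ∧ c = RealH2.mk 𝓤 g := by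
  constructor
  · rintro ⟨𝓤, g, s, σ, h1, h2, h3, h4, h5, h6, h7⟩
    exact ⟨𝓤, ⟨s, σ, h1, h2, h3, h4, h5⟩, g, h6, h7⟩
  · rintro ⟨𝓤, D, g, h6, h7⟩
    exact ⟨𝓤, g, D.s, D.σ, D.smooth_s, D.s_mem, D.s_real, D.isSection, D.σ_real, h6, h7⟩

variable (D : RealSections P 𝓤)

theorem proj_σ {a b : 𝓤.A} {m : M} (ha : m ∈ 𝓤.U a) (hb : m ∈ 𝓤.U b) :
    P.bundle.proj (D.σ a b m) = (D.s a m, D.s b m) :=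
  (D.isSection a b).proj m ⟨ha, hb⟩

theorem composable {a b c : 𝓤.A} {m : M} (ha : m ∈ 𝓤.U a) (hb : m ∈ 𝓤.U b) (hc : m ∈ 𝓤.U c) :
    (P.bundle.proj (D.σ a b m)).2 = (P.bundle.proj (D.σ b c m)).1 := by
  rw [D.proj_σ ha hb, D.proj_σ hb hc]

theorem isSection_mul (a b c : 𝓤.A) : IsSmoothSectionAlong P.bundle 𝓘(ℝ, EM)
    (𝓤.U a ∩ 𝓤.U b ∩ 𝓤.U c) (fun m => (D.s a m, D.s c m))
    fun m => P.mul (D.σ a b m) (D.σ b c m) :=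
  P.toBundleGerbe.isSmoothSectionAlong_mul
    ((D.smooth_s a).mono fun _ hm => hm.1.1) ((D.smooth_s b).mono fun _ hm => hm.1.2)
    ((D.smooth_s c).mono fun _ hm => hm.2) ((D.isSection a b).mono fun _ hm => hm.1)
    ((D.isSection b c).mono fun _ hm => ⟨hm.1.2, hm.2⟩)

/-- Both `σ_ab σ_bc` and `σ_ac` lie over `(s_a, s_c)`, so they differ by a unique function. It is
Real because the conjugation of `P` respects products and inverts scalars, and it is a cocycle by
associativity. -/
theorem exists_hasCocycle (hττ : Function.Involutive τ) :
    ∃ g : RealCocycle₂ EM 𝓤, D.HasCocycle g := by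
  have key : ∀ a b c, ∀ m ∈ 𝓤.U a ∩ 𝓤.U b ∩ 𝓤.U c,
      P.bundle.div (P.mul (D.σ a b m) (D.σ b c m)) (D.σ a c m) • D.σ a c m =
        P.mul (D.σ a b m) (D.σ b c m) := fun a b c m hm => by
    refine P.bundle.div_smul ?_
    rw [D.proj_σ hm.1.1 hm.2, (D.isSection_mul a b c).proj m hm]
  refine ⟨⟨fun a b c m => P.bundle.div (P.mul (D.σ a b m) (D.σ b c m)) (D.σ a c m),
    fun a b c => ?_, fun a b c m hm => ?_, ?_⟩, fun a b c m hm => (key a b c m hm).symm⟩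
  · exact (D.isSection_mul a b c).contMDiffOn_div
      ((D.isSection a c).mono fun _ hm => ⟨hm.1.1, hm.2⟩)
      (((D.smooth_s a).continuousOn.mono fun _ hm => hm.1.1).prodMk
        ((D.smooth_s c).continuousOn.mono fun _ hm => hm.2))
  · have hm' : τ m ∈ 𝓤.U (𝓤.bar a) ∩ 𝓤.U (𝓤.bar b) ∩ 𝓤.U (𝓤.bar c) :=
      ⟨⟨𝓤.apply_mem_bar hττ hm.1.1, 𝓤.apply_mem_bar hττ hm.1.2⟩, 𝓤.apply_mem_bar hττ hm.2⟩
    refine P.bundle.div_eq ?_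
    rw [D.σ_real a b m hm.1, D.σ_real b c m ⟨hm.1.2, hm.2⟩, D.σ_real a c m ⟨hm.1.1, hm.2⟩,
      ← P.isConj.smul, ← P.conj_mul _ _ (D.composable hm.1.1 hm.1.2 hm.2)]
    exact congrArg P.conj (key a b c m hm)
  · rintro a b c d m ⟨⟨⟨ha, hb⟩, hc⟩, hd⟩
    have e1 := key a b c m ⟨⟨ha, hb⟩, hc⟩
    have e2 := key a c d m ⟨⟨ha, hc⟩, hd⟩
    have e3 := key b c d m ⟨⟨hb, hc⟩, hd⟩
    have e4 := key a b d m ⟨⟨ha, hb⟩, hd⟩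
    -- The two bracketings of `σ_ab σ_bc σ_cd` are `g_abc g_acd` times and `g_bcd g_abd` times
    -- `σ_ad`; since the action is free, the scalars agree.
    have e := P.mul_assoc _ _ _ (D.composable ha hb hc) (D.composable hb hc hd)
    rw [← e1, ← e3, P.smul_mul _ _ _ (D.composable ha hc hd),
      P.mul_smul _ _ _ (D.composable ha hb hd), ← e2, ← e4, ← SemigroupAction.mul_smul,
      ← SemigroupAction.mul_smul] at e
    have e' := P.bundle.smul_right_injective e
    generalize P.bundle.div (P.mul (D.σ a b m) (D.σ b c m)) (D.σ a c m) = x1 at *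
    generalize P.bundle.div (P.mul (D.σ a c m) (D.σ c d m)) (D.σ a d m) = x2 at *
    generalize P.bundle.div (P.mul (D.σ b c m) (D.σ c d m)) (D.σ b d m) = x3 at *
    generalize P.bundle.div (P.mul (D.σ a b m) (D.σ b d m)) (D.σ a d m) = x4 at *
    rw [mul_right_comm x3, ← e', mul_inv_cancel_right, mul_inv_cancel]

/-- The restriction of Real sections to a refinement of the cover. -/
def restrict {𝓦 : RealCover τ} (f : 𝓦.Refinement 𝓤) : RealSections P 𝓦 where
  s := fun a => D.s (f.map a)
  σ := fun a b => D.σ (f.map a) (f.map b)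
  smooth_s := fun a => (D.smooth_s _).mono (f.subset a)
  s_mem := fun a m hm => D.s_mem _ m (f.subset a hm)
  s_real := fun a m hm => by
    rw [f.map_bar]
    exact D.s_real _ m (f.subset a hm)
  isSection := fun a b => (D.isSection _ _).mono fun _ hm => ⟨f.subset a hm.1, f.subset b hm.2⟩
  σ_real := fun a b m hm => by
    rw [f.map_bar, f.map_bar]
    exact D.σ_real _ _ m ⟨f.subset a hm.1, f.subset b hm.2⟩

end RealSections

/-- The pullback of a Real cocycle to a refinement of the cover. -/
def RealCocycle₂.restrict {𝓤 𝓦 : RealCover τ} (g : RealCocycle₂ EM 𝓤) (f : 𝓦.Refinement 𝓤) :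
    RealCocycle₂ EM 𝓦 where
  val := fun a b c => g.val (f.map a) (f.map b) (f.map c)
  smooth := fun a b c => (g.smooth _ _ _).mono fun _ hm =>
    ⟨⟨f.subset a hm.1.1, f.subset b hm.1.2⟩, f.subset c hm.2⟩
  real := fun a b c m hm => by
    rw [f.map_bar, f.map_bar, f.map_bar]
    exact g.real _ _ _ m ⟨⟨f.subset a hm.1.1, f.subset b hm.1.2⟩, f.subset c hm.2⟩
  cocycle := fun a b c d m hm => g.cocycle _ _ _ _ m
    ⟨⟨⟨f.subset a hm.1.1.1, f.subset b hm.1.1.2⟩, f.subset c hm.1.2⟩, f.subset d hm.2⟩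

theorem RealH2.mk_restrict {𝓤 𝓦 : RealCover τ} (g : RealCocycle₂ EM 𝓤) (f : 𝓦.Refinement 𝓤) :
    RealH2.mk 𝓦 (g.restrict f) = RealH2.mk 𝓤 g :=
  Quotient.sound (CechPair.Cohomologous.of_eq 𝓦 (RealCover.Refinement.refl 𝓦) f
    fun _ _ _ _ _ => rfl)

theorem RealSections.HasCocycle.restrict {P : RealBundleGerbe Z} {𝓤 𝓦 : RealCover τ}
    {D : RealSections P 𝓤} {g : RealCocycle₂ EM 𝓤} (h : D.HasCocycle g) (f : 𝓦.Refinement 𝓤) :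
    (D.restrict f).HasCocycle (g.restrict f) := fun a b c m hm =>
  h _ _ _ m ⟨⟨f.subset a hm.1.1, f.subset b hm.1.2⟩, f.subset c hm.2⟩

namespace RealCover

/-- The Real cover formed by the members of a cover and by their preimages under `τ`. -/
def double (hτ : Continuous τ) (hττ : Function.Involutive τ) {X : Type u} (U : X → Set M)
    (hU : ∀ x, IsOpen (U x)) (hcov : ∀ m, ∃ x, m ∈ U x) : RealCover τ where
  A := X × Bool
  U := fun a => match a with
    | (x, true) => U x
    | (x, false) => τ ⁻¹' U x
  isOpen := by
    rintro ⟨x, _ | _⟩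
    · exact (hU x).preimage hτ
    · exact hU x
  exists_mem := fun m => by
    obtain ⟨x, hx⟩ := hcov m
    exact ⟨(x, true), hx⟩
  -- The label is flipped and `x` is kept, so the involution is free even if `τ` fixes points or
  -- preserves some `U x`.
  bar := fun a => (a.1, !a.2)
  bar_bar := fun a => by simp
  bar_ne := fun a h => by
    have := congrArg Prod.snd h
    simp at this
  U_bar := by
    rintro ⟨x, _ | _⟩
    · change U x = τ ⁻¹' (τ ⁻¹' U x)
      rw [← Set.preimage_comp, hττ.comp_self, Set.preimage_id]
    · rfl

/-- A bundle with a Real structure, pulled back to the members of a Real cover, has Real sections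
over a refinement of the cover. -/
theorem exists_refinement_sections {E H N : Type u} [NormedAddCommGroup E] [NormedSpace ℝ E]
    [TopologicalSpace H] [TopologicalSpace N] [ChartedSpace H N] {I : ModelWithCorners ℝ E H}
    {S : Set N} (hτ : ContMDiff 𝓘(ℝ, EM) 𝓘(ℝ, EM) ∞ τ) (hττ : Function.Involutive τ)
    (𝓤 : RealCover τ) {B : U1Bundle I S} {φ : N → N} {F : B.Tot → B.Tot}
    (hF : IsConjBundleMap B B φ F) (hFF : Function.Involutive F) (f : 𝓤.A → M → N)
    (hf : ∀ a, ContMDiffOn 𝓘(ℝ, EM) I ∞ (f a) (𝓤.U a)) (hS : ∀ a, Set.MapsTo (f a) (𝓤.U a) S)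
    (hφ : ∀ a, ∀ m ∈ 𝓤.U a, f (𝓤.bar a) (τ m) = φ (f a m)) :
    ∃ (𝓦 : RealCover τ) (r : 𝓦.Refinement 𝓤) (ρ : 𝓦.A → M → B.Tot),
      (∀ a, IsSmoothSectionAlong B 𝓘(ℝ, EM) (𝓦.U a) (f (r.map a)) (ρ a)) ∧
      ∀ a, ∀ m ∈ 𝓦.U a, ρ (𝓦.bar a) (τ m) = F (ρ a m) := by
  -- The new cover is indexed by pairs of a member of the old one and a point of it, each with a
  -- neighbourhood on which a section exists.
  have key : ∀ x : {x : 𝓤.A × M // x.2 ∈ 𝓤.U x.1}, ∃ (W : Set M) (t : M → B.Tot), IsOpen W ∧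
      x.1.2 ∈ W ∧ W ⊆ 𝓤.U x.1.1 ∧ IsSmoothSectionAlong B 𝓘(ℝ, EM) W (f x.1.1) t := fun x =>
    B.exists_local_section (𝓤.isOpen _) (hf _) (hS _) x.2
  choose W t hWo hxW hWU ht using key
  -- On the first copy the section is the arbitrary one; on the second copy reality forces it to be
  -- `F ∘ t ∘ τ`, a section along the map with the conjugate index.
  refine ⟨double hτ.continuous hττ W hWo fun m => ?_, ⟨fun a => match a with
    | (x, true) => x.1.1
    | (x, false) => 𝓤.bar x.1.1, ?_, ?_⟩, fun a => match a with
    | (x, true) => t x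
    | (x, false) => fun m => F (t x (τ m)), ?_, ?_⟩
  · obtain ⟨a, ha⟩ := 𝓤.exists_mem m
    exact ⟨⟨(a, m), ha⟩, hxW _⟩
  · rintro ⟨x, _ | _⟩
    · exact (𝓤.bar_bar _).symm
    · rfl
  · rintro ⟨x, _ | _⟩
    · intro m hm
      rw [𝓤.U_bar]
      exact hWU x hm
    · exact hWU x
  · rintro ⟨x, _ | _⟩
    · have hm : Set.MapsTo τ (τ ⁻¹' W x) (W x) := fun _ h => h
      refine (((ht x).comp hτ.contMDiffOn hm).conj hF
        (((hf _).mono (hWU x)).comp hτ.contMDiffOn hm)).congr (fun m hm => ?_) fun _ _ => rfl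
      have e := hφ x.1.1 (τ m) (hWU x hm)
      rw [hττ m] at e
      exact e
    · exact ht x
  · rintro ⟨x, _ | _⟩ m hm
    · exact (hFF _).symm
    · change F (t x (τ (τ m))) = F (t x m)
      rw [hττ m]

end RealCover

end RealGerbe

/-! ### Existence of Real sections over a sufficiently fine cover. -/

namespace RealGerbe

variable {EM M : Type u} [NormedAddCommGroup EM] [NormedSpace ℝ EM] [TopologicalSpace M]
  [ChartedSpace EM M] {τ : M → M} {Z : RealSubmersion EM τ}

/-- A surjective submersion has local sections. -/
theorem SurjSubmersion.exists_local_section (Z : SurjSubmersion EM M) (m : M) :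
    ∃ (V : Set M) (s : M → Z.N), IsOpen V ∧ m ∈ V ∧ ContMDiffOn 𝓘(ℝ, EM) Z.I ∞ s V ∧
      ∀ x ∈ V, s x ∈ Z.carrier ∧ Z.π (s x) = x := by
  obtain ⟨y, hy, rfl⟩ := Z.surj_π m
  obtain ⟨F, _, _, V, O, χ, ψ, hV, hyV, hO, hχ, hψ, h1, h2⟩ := Z.submersion y hy
  -- In the normal form `π` is the projection to `M`, so a section is obtained by freezing the fibre
  -- coordinate at its value in `y`.
  have hk : ContMDiff 𝓘(ℝ, EM) (𝓘(ℝ, EM).prod 𝓘(ℝ, F)) ∞ (fun x : M => (x, χ y)) :=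
    contMDiff_id.prodMk contMDiff_const
  exact ⟨{x | (x, χ y) ∈ O}, fun x => ψ (x, χ y), hO.preimage hk.continuous, (h1 y hy hyV).1,
    hψ.comp hk.contMDiffOn fun _ hx => hx, fun x hx => ⟨(h2 _ hx).1, (h2 _ hx).2.2.1⟩⟩

/-- The sections `s_x` together with the sections `inv ∘ s_x ∘ τ`. -/
def RealSubmersion.double (Z : RealSubmersion EM τ) {X : Type u} (s : X → M → Z.N) :
    X × Bool → M → Z.N
  | (x, true) => s x
  | (x, false) => fun m => Z.inv (s x (τ m))

namespace RealSubmersion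

variable {X : Type u} {U : X → Set M} {s : X → M → Z.N}

theorem double_mem (hτ : Continuous τ) (hττ : Function.Involutive τ) (hU : ∀ x, IsOpen (U x))
    (hcov : ∀ m, ∃ x, m ∈ U x) (hs : ∀ x, ∀ m ∈ U x, s x m ∈ Z.carrier ∧ Z.π (s x m) = m) :
    ∀ a, ∀ m ∈ (RealCover.double hτ hττ U hU hcov).U a,
      Z.double s a m ∈ Z.carrier ∧ Z.π (Z.double s a m) = m := by
  rintro ⟨x, _ | _⟩ m hm
  · have h := hs x (τ m) hm
    refine ⟨Z.inv_mem _ h.1, (Z.π_inv _ h.1).trans ?_⟩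
    rw [h.2, hττ m]
  · exact hs x m hm

theorem smooth_double (hτ : ContMDiff 𝓘(ℝ, EM) 𝓘(ℝ, EM) ∞ τ) (hττ : Function.Involutive τ)
    (hU : ∀ x, IsOpen (U x)) (hcov : ∀ m, ∃ x, m ∈ U x)
    (hs : ∀ x, ∀ m ∈ U x, s x m ∈ Z.carrier ∧ Z.π (s x m) = m)
    (h : ∀ x, ContMDiffOn 𝓘(ℝ, EM) Z.I ∞ (s x) (U x)) :
    ∀ a, ContMDiffOn 𝓘(ℝ, EM) Z.I ∞ (Z.double s a)
      ((RealCover.double hτ.continuous hττ U hU hcov).U a) := by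
  rintro ⟨x, _ | _⟩
  · exact Z.smooth_inv.comp ((h x).comp hτ.contMDiffOn fun _ hm => hm) fun m hm => (hs x _ hm).1
  · exact h x

theorem double_real (hτ : Continuous τ) (hττ : Function.Involutive τ) (hU : ∀ x, IsOpen (U x))
    (hcov : ∀ m, ∃ x, m ∈ U x) (hs : ∀ x, ∀ m ∈ U x, s x m ∈ Z.carrier ∧ Z.π (s x m) = m) :
    ∀ a, ∀ m ∈ (RealCover.double hτ hττ U hU hcov).U a,
      Z.double s ((RealCover.double hτ hττ U hU hcov).bar a) (τ m) = Z.inv (Z.double s a m) := by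
  rintro ⟨x, _ | _⟩ m hm
  · exact (Z.inv_inv _ (hs x (τ m) hm).1).symm
  · change Z.inv (s x (τ (τ m))) = Z.inv (s x m)
    rw [hττ m]

end RealSubmersion

/-- Sections over the pairs whose first index lies in one half of a doubled cover suffice. -/
theorem RealSections.nonempty_of_half (P : RealBundleGerbe Z)
    (hτ : ContMDiff 𝓘(ℝ, EM) 𝓘(ℝ, EM) ∞ τ) (hττ : Function.Involutive τ) {X : Type u}
    {U : X → Set M} {s : X → M → Z.N} (hU : ∀ x, IsOpen (U x)) (hcov : ∀ m, ∃ x, m ∈ U x)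
    (hs : ∀ x, ∀ m ∈ U x, s x m ∈ Z.carrier ∧ Z.π (s x m) = m)
    (h : ∀ x, ContMDiffOn 𝓘(ℝ, EM) Z.I ∞ (s x) (U x))
    (hσ : ∀ x b, ∃ σ : M → P.bundle.Tot, IsSmoothSectionAlong P.bundle 𝓘(ℝ, EM)
      (U x ∩ (RealCover.double hτ.continuous hττ U hU hcov).U b)
      (fun m => (s x m, Z.double s b m)) σ) :
    Nonempty (RealSections P (RealCover.double hτ.continuous hττ U hU hcov)) := by
  choose σ hσ using hσ
  have smooth := RealSubmersion.smooth_double hτ hττ hU hcov hs h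
  have real := RealSubmersion.double_real hτ.continuous hττ hU hcov hs
  -- The involution sends the pairs with first index `(x, true)` bijectively to those with first
  -- index `(x, false)`. Hence the sections for the former are free, and those for the latter are
  -- defined by the reality condition.
  refine ⟨Z.double s, fun a b => match a with
      | (x, true) => σ x b
      | (x, false) => fun m =>
        P.conj (σ x ((RealCover.double hτ.continuous hττ U hU hcov).bar b) (τ m)),
    smooth, RealSubmersion.double_mem hτ.continuous hττ hU hcov hs, real, ?_, ?_⟩
  · rintro ⟨x, _ | _⟩ b
    · have hm : Set.MapsTo τ
          ((RealCover.double hτ.continuous hττ U hU hcov).U (x, false) ∩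
            (RealCover.double hτ.continuous hττ U hU hcov).U b)
          (U x ∩ (RealCover.double hτ.continuous hττ U hU hcov).U
            ((RealCover.double hτ.continuous hττ U hU hcov).bar b)) := fun m hm =>
        ⟨hm.1, RealCover.apply_mem_bar _ hττ hm.2⟩
      refine (((hσ x _).comp hτ.contMDiffOn hm).conj P.isConj ?_).congr (fun m hm => ?_)
        fun _ _ => rfl
      · refine ContMDiffOn.comp (t := U x ∩ (RealCover.double hτ.continuous hττ U hU hcov).U
          ((RealCover.double hτ.continuous hττ U hU hcov).bar b))
          (g := fun m => (s x m, Z.double s _ m)) ?_ hτ.contMDiffOn hm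
        exact ((h x).mono Set.inter_subset_left).prodMk ((smooth _).mono Set.inter_subset_right)
      · refine Prod.ext rfl ?_
        have e := real _ (τ m) (RealCover.apply_mem_bar _ hττ hm.2)
        rw [hττ m, RealCover.bar_bar] at e
        exact e
    · exact hσ x b
  · rintro ⟨x, _ | _⟩ b m hm
    · exact (P.conj_conj _).symm
    · change P.conj (σ x (RealCover.bar _ (RealCover.bar _ b)) (τ (τ m))) = P.conj (σ x b m)
      rw [RealCover.bar_bar, hττ m]

/-- A family and its preimage under a continuous map are both locally finite, and near a given point
the two finite index sets are simply put together. -/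
theorem locallyFinite_double {v : M → Set M} (hv : LocallyFinite v) (hτ : Continuous τ) :
    LocallyFinite fun a : M × Bool => if a.2 then v a.1 else τ ⁻¹' v a.1 := fun x => by
  obtain ⟨t, ht, hf⟩ := hv x
  obtain ⟨t', ht', hf'⟩ := hv.preimage_continuous hτ x
  refine ⟨t ∩ t', Filter.inter_mem ht ht',
    ((hf.image fun i => (i, true)).union (hf'.image fun i => (i, false))).subset ?_⟩
  rintro ⟨i, _ | _⟩ ⟨m, hm, hmt⟩
  · exact Or.inr ⟨i, ⟨m, by simpa using hm, hmt.2⟩, rfl⟩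
  · exact Or.inl ⟨i, ⟨m, by simpa using hm, hmt.1⟩, rfl⟩

/-- Local triviality gives sections of `P` over `(s_a, s_b)` only near a point, and the
neighbourhood depends on both indices. Take a locally finite cover `v` on whose members `π` has
sections, and shrink it to `w` with closures inside `v`. Near a point `x` only finitely many
closures, or preimages of closures under `τ`, matter, so one neighbourhood `U x` serves all of them
at once. The sets `U x` carry only the sections inherited from `v`; therefore `U x` handles every
second index, and no smallness of the second member is needed. -/
theorem RealSections.exists_of_paracompact [T2Space M] [ParacompactSpace M]
    (hτ : ContMDiff 𝓘(ℝ, EM) 𝓘(ℝ, EM) ∞ τ) (hττ : Function.Involutive τ)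
    (P : RealBundleGerbe Z) : ∃ 𝓤 : RealCover τ, Nonempty (RealSections P 𝓤) := by
  choose V s₀ hVo hmV hs₀ hs₀' using Z.exists_local_section
  obtain ⟨v, hvo, hvc, hvf, hvV⟩ := precise_refinement V hVo
    (Set.eq_univ_of_forall fun m => Set.mem_iUnion.mpr ⟨m, hmV m⟩)
  obtain ⟨w, hwc, hwo, hwv⟩ := exists_iUnion_eq_closure_subset hvo hvf.point_finite hvc
  have hvc' : ∀ m, ∃ x, m ∈ v x := fun m => Set.mem_iUnion.mp (hvc ▸ Set.mem_univ m)
  have hwc' : ∀ m, ∃ x, m ∈ w x := fun m => Set.mem_iUnion.mp (hwc ▸ Set.mem_univ m)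
  choose i hi using hwc'
  set 𝓥 := RealCover.double hτ.continuous hττ v hvo hvc'
  -- Closed sets are used so that `x ∉ K b` persists on a neighbourhood of `x`, while `K b ⊆ 𝓥.U b`
  -- keeps the section with index `b` available at the points of `K b`.
  set K : M × Bool → Set M := fun a => if a.2 then closure (w a.1) else τ ⁻¹' closure (w a.1)
  have hKc : ∀ a, IsClosed (K a) := by
    rintro ⟨x, _ | _⟩
    · simpa [K] using isClosed_closure.preimage hτ.continuous
    · simp [K]
  have hKf : LocallyFinite K :=
    locallyFinite_double (hvf.subset hwv) hτ.continuous
  have hKv : ∀ a, K a ⊆ 𝓥.U a := by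
    rintro ⟨x, _ | _⟩ m hm
    · exact hwv x (by simpa [K] using hm)
    · exact hwv x (by simpa [K] using hm)
  have hsv : ∀ x, ∀ m ∈ v x, s₀ x m ∈ Z.carrier ∧ Z.π (s₀ x m) = m := fun x m hm =>
    hs₀' x m (hvV x hm)
  have smooth := RealSubmersion.smooth_double hτ hττ hvo hvc' hsv fun x => (hs₀ x).mono (hvV x)
  have mem := RealSubmersion.double_mem hτ.continuous hττ hvo hvc' hsv
  have key : ∀ x, ∃ U : Set M, IsOpen U ∧ x ∈ U ∧ U ⊆ w (i x) ∧ ∀ b, (U ∩ K b).Nonempty →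
      ∃ σ : M → P.bundle.Tot, IsSmoothSectionAlong P.bundle 𝓘(ℝ, EM) U
        (fun m => (s₀ (i x) m, Z.double s₀ b m)) σ := fun x => by
    have hb : ∀ b ∈ {b | x ∈ K b}, ∃ O ∈ nhds x, ∃ σ : M → P.bundle.Tot,
        IsSmoothSectionAlong P.bundle 𝓘(ℝ, EM) O
          (fun m => (s₀ (i x) m, Z.double s₀ b m)) σ := fun b hb => by
      obtain ⟨O, σ, hO, hxO, -, hσ⟩ := P.bundle.exists_local_section
        (V := 𝓥.U (i x, true) ∩ 𝓥.U b) (f := fun m => (s₀ (i x) m, Z.double s₀ b m))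
        ((𝓥.isOpen _).inter (𝓥.isOpen _))
        (((smooth (i x, true)).mono Set.inter_subset_left).prodMk
          ((smooth b).mono Set.inter_subset_right))
        (fun m hm => ⟨(mem (i x, true) m hm.1).1, (mem b m hm.2).1,
          (mem (i x, true) m hm.1).2.trans (mem b m hm.2).2.symm⟩)
        (x := x) ⟨hwv _ (subset_closure (hi x)), hKv b hb⟩
      exact ⟨O, hO.mem_nhds hxO, σ, hσ⟩
    choose! O hO σ hσ using hb
    -- The middle factor is a neighbourhood because `K` is locally finite and closed, the last one
    -- because it is a finite intersection. A set inside all three meets `K b` only if `x ∈ K b`,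
    -- and then a section over it is at hand.
    have hn : w (i x) ∩ ((⋂ b, ⋂ _ : x ∉ K b, (K b)ᶜ) ∩ ⋂ b ∈ {b | x ∈ K b}, O b) ∈ nhds x :=
      Filter.inter_mem ((hwo _).mem_nhds (hi x)) (Filter.inter_mem
        (hKf.iInter_compl_mem_nhds hKc x) ((Filter.biInter_mem (hKf.point_finite x)).mpr hO))
    obtain ⟨U, hUs, hUo, hxU⟩ := mem_nhds_iff.mp hn
    refine ⟨U, hUo, hxU, fun m hm => (hUs hm).1, fun b hUb => ?_⟩
    have hxb : x ∈ K b := by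
      by_contra hxb
      obtain ⟨m, hm, hmb⟩ := hUb
      exact Set.mem_iInter₂.mp (hUs hm).2.1 b hxb hmb
    exact ⟨σ b hxb, (hσ b hxb).mono fun m hm => Set.mem_iInter₂.mp (hUs hm).2.2 b hxb⟩
  choose U hUo hxU hUw hUσ using key
  refine ⟨_, RealSections.nonempty_of_half P hτ hττ (U := U) (s := fun x => s₀ (i x)) hUo
    (fun m => ⟨m, hxU m⟩)
    (fun x m hm => hsv _ m (hwv _ (subset_closure (hUw x hm))))
    (fun x => (hs₀ _).mono fun m hm => hvV _ (hwv _ (subset_closure (hUw x hm)))) fun x b => ?_⟩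
  -- The member of the new cover with index `b = (y, β)` lies in `K (i y, β)` and carries the
  -- section with that index. Either `U x` meets this set and `key` provides `σ`, or the overlap is
  -- empty and a constant function serves.
  by_cases hb : (U x ∩ K (i b.1, b.2)).Nonempty
  · obtain ⟨σ, hσ⟩ := hUσ x _ hb
    refine ⟨σ, (hσ.mono Set.inter_subset_left).congr (fun m _ => Prod.ext rfl ?_) fun _ _ => rfl⟩
    obtain ⟨y, _ | _⟩ := b <;> rfl
  · obtain ⟨p, -⟩ := P.bundle.exists_fibre (s₀ x x, s₀ x x)
      ⟨(hs₀' x x (hmV x)).1, (hs₀' x x (hmV x)).1, rfl⟩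
    refine ⟨fun _ => p, IsSmoothSectionAlong.of_isEmpty (Set.eq_empty_of_forall_notMem ?_)⟩
    rintro m ⟨hm, hmb⟩
    refine hb ⟨m, hm, ?_⟩
    obtain ⟨y, _ | _⟩ := b
    · simpa [K] using subset_closure (hUw y hmb)
    · simpa [K] using subset_closure (hUw y hmb)

end RealGerbe

/-! ### Independence of the choices. -/

namespace RealGerbe

variable {EM M : Type u} [NormedAddCommGroup EM] [NormedSpace ℝ EM] [TopologicalSpace M]
  [ChartedSpace EM M] {τ : M → M} {Z : RealSubmersion EM τ}

theorem RealH2.mk_eq_mk_of_coboundary {𝓤 : RealCover τ} {g g' : RealCocycle₂ EM 𝓤}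
    (h : RealCochain₁ EM 𝓤) (H : ∀ a b c, ∀ m ∈ 𝓤.U a ∩ 𝓤.U b ∩ 𝓤.U c,
      g.val a b c m = g'.val a b c m * (h.val b c m * (h.val a c m)⁻¹ * h.val a b m)) :
    RealH2.mk 𝓤 g = RealH2.mk 𝓤 g' :=
  Quotient.sound ⟨𝓤, RealCover.Refinement.refl 𝓤, RealCover.Refinement.refl 𝓤, h, H⟩

/-- Sections `ρ_a` of the pullbacks of `P` by `(s_a, s'_a)` show that two cocycles of `P` on the
same cover are cohomologous. -/
theorem RealSections.mk_eq_mk_of_sections {P : RealBundleGerbe Z}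
    {𝓤 : RealCover τ} {D D' : RealSections P 𝓤} {g g' : RealCocycle₂ EM 𝓤} (hD : D.HasCocycle g)
    (hD' : D'.HasCocycle g') (ρ : 𝓤.A → M → P.bundle.Tot)
    (hρ : ∀ a, IsSmoothSectionAlong P.bundle 𝓘(ℝ, EM) (𝓤.U a) (fun m => (D.s a m, D'.s a m)) (ρ a))
    (hρ' : ∀ a, ∀ m ∈ 𝓤.U a, ρ (𝓤.bar a) (τ m) = P.conj (ρ a m)) :
    RealH2.mk 𝓤 g = RealH2.mk 𝓤 g' := by
  -- There are two routes from `s_a` to `s'_b`, through `s_b` and through `s'_a`. The cochain `h_ab`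
  -- is the quotient of `σ_ab ρ_b` by `ρ_a σ'_ab`.
  have hl : ∀ a b, IsSmoothSectionAlong P.bundle 𝓘(ℝ, EM) (𝓤.U a ∩ 𝓤.U b)
      (fun m => (D.s a m, D'.s b m)) fun m => P.mul (D.σ a b m) (ρ b m) := fun a b =>
    P.toBundleGerbe.isSmoothSectionAlong_mul
      ((D.smooth_s a).mono Set.inter_subset_left) ((D.smooth_s b).mono Set.inter_subset_right)
      ((D'.smooth_s b).mono Set.inter_subset_right) (D.isSection a b)
      ((hρ b).mono Set.inter_subset_right)
  have hr : ∀ a b, IsSmoothSectionAlong P.bundle 𝓘(ℝ, EM) (𝓤.U a ∩ 𝓤.U b)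
      (fun m => (D.s a m, D'.s b m)) fun m => P.mul (ρ a m) (D'.σ a b m) := fun a b =>
    P.toBundleGerbe.isSmoothSectionAlong_mul
      ((D.smooth_s a).mono Set.inter_subset_left) ((D'.smooth_s a).mono Set.inter_subset_left)
      ((D'.smooth_s b).mono Set.inter_subset_right) ((hρ a).mono Set.inter_subset_left)
      (D'.isSection a b)
  have key : ∀ a b, ∀ m ∈ 𝓤.U a ∩ 𝓤.U b,
      P.bundle.div (P.mul (D.σ a b m) (ρ b m)) (P.mul (ρ a m) (D'.σ a b m)) •
        P.mul (ρ a m) (D'.σ a b m) = P.mul (D.σ a b m) (ρ b m) := fun a b m hm =>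
    P.bundle.div_smul (((hr a b).proj m hm).trans ((hl a b).proj m hm).symm)
  have cl : ∀ a b, ∀ m ∈ 𝓤.U a ∩ 𝓤.U b,
      (P.bundle.proj (D.σ a b m)).2 = (P.bundle.proj (ρ b m)).1 := fun a b m hm => by
    rw [D.proj_σ hm.1 hm.2, (hρ b).proj m hm.2]
  have cr : ∀ a b, ∀ m ∈ 𝓤.U a ∩ 𝓤.U b,
      (P.bundle.proj (ρ a m)).2 = (P.bundle.proj (D'.σ a b m)).1 := fun a b m hm => by
    rw [D'.proj_σ hm.1 hm.2, (hρ a).proj m hm.1]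
  refine RealH2.mk_eq_mk_of_coboundary ⟨fun a b m =>
    P.bundle.div (P.mul (D.σ a b m) (ρ b m)) (P.mul (ρ a m) (D'.σ a b m)), fun a b => ?_,
      fun a b m hm => ?_⟩ ?_
  · exact (hl a b).contMDiffOn_div (hr a b)
      (((D.smooth_s a).continuousOn.mono Set.inter_subset_left).prodMk
        ((D'.smooth_s b).continuousOn.mono Set.inter_subset_right))
  · refine P.bundle.div_eq ?_
    rw [D.σ_real a b m hm, D'.σ_real a b m hm, hρ' a m hm.1, hρ' b m hm.2,
      ← P.conj_mul _ _ (cl a b m hm), ← P.conj_mul _ _ (cr a b m hm), ← P.isConj.smul,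
      key a b m hm]
  · rintro a b c m ⟨⟨ha, hb⟩, hc⟩
    have e1 := key a b m ⟨ha, hb⟩
    have e2 := key b c m ⟨hb, hc⟩
    have e3 := key a c m ⟨ha, hc⟩
    have e4 := hD a b c m ⟨⟨ha, hb⟩, hc⟩
    have e5 := hD' a b c m ⟨⟨ha, hb⟩, hc⟩
    have c1 := D.composable ha hb hc
    have c2 := D'.composable ha hb hc
    have c3 : (P.bundle.proj (P.mul (ρ b m) (D'.σ b c m))).1 =
        (P.bundle.proj (D.σ a b m)).2 := by
      rw [(hr b c).proj m ⟨hb, hc⟩, D.proj_σ ha hb]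
    have c4 : (P.bundle.proj (P.mul (ρ a m) (D'.σ a b m))).2 =
        (P.bundle.proj (D'.σ b c m)).1 := by
      rw [(hr a b).proj m ⟨ha, hb⟩, D'.proj_σ hb hc]
    -- `σ_ab σ_bc ρ_c` is computed twice by moving `ρ` to the left: the bracketing `(σ_ab σ_bc) ρ_c`
    -- yields `g_abc h_ac` and `σ_ab (σ_bc ρ_c)` yields `h_bc h_ab g'_abc`, both times `ρ_a σ'_ac`.
    have e := P.mul_assoc _ _ _ c1 (cl b c m ⟨hb, hc⟩)
    rw [e4, P.smul_mul _ _ _ (cl a c m ⟨ha, hc⟩), ← e3, ← e2, P.mul_smul _ _ _ c3.symm,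
      ← P.mul_assoc _ _ _ (cl a b m ⟨ha, hb⟩) (cr b c m ⟨hb, hc⟩), ← e1, P.smul_mul _ _ _ c4,
      P.mul_assoc _ _ _ (cr a b m ⟨ha, hb⟩) c2, e5, P.mul_smul _ _ _ (cr a c m ⟨ha, hc⟩),
      ← SemigroupAction.mul_smul, ← SemigroupAction.mul_smul, ← SemigroupAction.mul_smul] at e
    have e' := P.bundle.smul_right_injective e
    dsimp only
    generalize P.bundle.div (P.mul (D.σ a b m) (ρ b m)) _ = x1 at *
    generalize P.bundle.div (P.mul (D.σ b c m) (ρ c m)) _ = x2 at *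
    generalize P.bundle.div (P.mul (D.σ a c m) (ρ c m)) _ = x3 at *
    rw [eq_mul_inv_of_mul_eq e']
    ac_rfl

/-- On the common refinement of the two covers the pairs `(s_a, s'_b)` map equivariantly to the
fibre product of `Y` with itself. A further refinement carries Real sections of `P` along them,
which are the `ρ` required for the comparison; passing to refinements does not change the classes.
-/
theorem RealBundleGerbe.IsRealDDClass.unique (hτ : ContMDiff 𝓘(ℝ, EM) 𝓘(ℝ, EM) ∞ τ)
    (hττ : Function.Involutive τ) {P : RealBundleGerbe Z} {c c' : RealH2 EM τ}
    (h : P.IsRealDDClass c) (h' : P.IsRealDDClass c') : c = c' := by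
  obtain ⟨𝓤, D, g, hD, rfl⟩ := RealSections.isRealDDClass_iff.mp h
  obtain ⟨𝓤', D', g', hD', rfl⟩ := RealSections.isRealDDClass_iff.mp h'
  obtain ⟨𝓦, r, ρ, hρ, hρ'⟩ := RealCover.exists_refinement_sections hτ hττ (𝓤.inter 𝓤') P.isConj
    P.conj_conj (fun a m => (D.s a.1 m, D'.s a.2 m))
    (fun a => ((D.smooth_s _).mono Set.inter_subset_left).prodMk
      ((D'.smooth_s _).mono Set.inter_subset_right))
    (fun a m hm => ⟨(D.s_mem _ m hm.1).1, (D'.s_mem _ m hm.2).1,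
      (D.s_mem _ m hm.1).2.trans (D'.s_mem _ m hm.2).2.symm⟩)
    (fun a m hm => Prod.ext (D.s_real _ m hm.1) (D'.s_real _ m hm.2))
  rw [← RealH2.mk_restrict g ((𝓤.interLeft 𝓤').comp r),
    ← RealH2.mk_restrict g' ((𝓤.interRight 𝓤').comp r)]
  exact RealSections.mk_eq_mk_of_sections (hD.restrict _) (hD'.restrict _) ρ hρ hρ'

theorem RealBundleGerbe.isRealDDClass_realDD [T2Space M] [ParacompactSpace M]
    (hτ : ContMDiff 𝓘(ℝ, EM) 𝓘(ℝ, EM) ∞ τ) (hττ : Function.Involutive τ) (P : RealBundleGerbe Z) :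
    P.IsRealDDClass P.realDD := by
  obtain ⟨𝓤, ⟨D⟩⟩ := RealSections.exists_of_paracompact hτ hττ P
  obtain ⟨g, hg⟩ := D.exists_hasCocycle hττ
  exact Classical.epsilon_spec (p := P.IsRealDDClass)
    ⟨_, RealSections.isRealDDClass_iff.mpr ⟨𝓤, D, g, hg, rfl⟩⟩

/-- One direction is uniqueness. The other is existence, and guarantees that the choice operator in
`realDD` returns a genuine class. -/
theorem RealBundleGerbe.isRealDDClass_iff [T2Space M] [ParacompactSpace M]
    (hτ : ContMDiff 𝓘(ℝ, EM) 𝓘(ℝ, EM) ∞ τ) (hττ : Function.Involutive τ) (P : RealBundleGerbe Z)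
    (c : RealH2 EM τ) : P.IsRealDDClass c ↔ c = P.realDD :=
  ⟨fun h => h.unique hτ hττ (P.isRealDDClass_realDD hτ hττ),
    fun h => h ▸ P.isRealDDClass_realDD hτ hττ⟩

end RealGerbe

/-! ### Classes of duals, isomorphic gerbes, tensor products and `δR`. -/

namespace RealGerbe

variable {EM M : Type u} [NormedAddCommGroup EM] [NormedSpace ℝ EM] [TopologicalSpace M]
  [ChartedSpace EM M] {τ : M → M} {Z W : RealSubmersion EM τ}

/-- Covers the case of an empty base in the additivity statement, where the tensor product may have
no element to serve as default value of a section. -/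
theorem RealH2.subsingleton [IsEmpty M] : Subsingleton (RealH2 EM τ) :=
  ⟨by
    rintro ⟨x⟩ ⟨y⟩
    exact Quotient.sound (CechPair.Cohomologous.of_eq (x.cover.inter y.cover)
      (RealCover.interLeft _ _) (RealCover.interRight _ _) fun _ _ _ m => isEmptyElim m)⟩

theorem RealH2.mk_eq_zero {𝓤 : RealCover τ} {g : RealCocycle₂ EM 𝓤}
    (h : ∀ a b c, ∀ m ∈ 𝓤.U a ∩ 𝓤.U b ∩ 𝓤.U c, g.val a b c m = 1) : RealH2.mk 𝓤 g = 0 :=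
  Quotient.sound (CechPair.Cohomologous.of_eq (𝓤.inter (RealCover.trivial τ))
    (RealCover.interLeft _ _) (RealCover.interRight _ _)
    fun _ _ _ m hm => h _ _ _ m ⟨⟨hm.1.1.1, hm.1.2.1⟩, hm.2.1⟩)

namespace RealBundleGerbe

/-- The same sections serve for `P^*`; reading the scalar through the conjugate action inverts the
cocycle. -/
theorem IsRealDDClass.dual {P : RealBundleGerbe Z} {c : RealH2 EM τ} (h : P.IsRealDDClass c) :
    P.dual.IsRealDDClass (-c) := by
  obtain ⟨𝓤, D, g, hD, rfl⟩ := RealSections.isRealDDClass_iff.mp h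
  refine RealSections.isRealDDClass_iff.mpr ⟨𝓤, ⟨D.s, D.σ, D.smooth_s, D.s_mem, D.s_real,
    fun a b => (D.isSection a b).dual, D.σ_real⟩, (CechPair.inv ⟨𝓤, g⟩).cocycle,
    fun a b c m hm => ?_, rfl⟩
  change P.mul (D.σ a b m) (D.σ b c m) = (g.val a b c m)⁻¹⁻¹ • D.σ a c m
  rw [inv_inv]
  exact hD a b c m hm

/-- The images `φ ∘ σ_ab` over the same `s_a` have the same cocycle, because `φ` is multiplicative
and equivariant. -/
theorem IsRealDDClass.of_iso {P Q : RealBundleGerbe Z} (φ : Iso P Q) {c : RealH2 EM τ}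
    (h : P.IsRealDDClass c) : Q.IsRealDDClass c := by
  obtain ⟨𝓤, D, g, hD, rfl⟩ := RealSections.isRealDDClass_iff.mp h
  refine RealSections.isRealDDClass_iff.mpr ⟨𝓤, ⟨D.s, fun a b m => φ.toFun (D.σ a b m), D.smooth_s,
    D.s_mem, D.s_real, fun a b => (D.isSection a b).map φ.isBundleMap
      (((D.smooth_s a).mono Set.inter_subset_left).prodMk
        ((D.smooth_s b).mono Set.inter_subset_right)), fun a b m hm => ?_⟩, g,
    fun a b c m hm => ?_, rfl⟩
  · rw [D.σ_real a b m hm, φ.map_conj]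
  · change Q.mul (φ.toFun _) (φ.toFun _) = _
    rw [← φ.map_mul _ _ (D.composable hm.1.1 hm.1.2 hm.2), hD a b c m hm, φ.isBundleMap.smul]

/-- The element `p ⊗ q` of `P ⊗ Q` over `y`. -/
def tensorMk (P : RealBundleGerbe Z) (Q : RealBundleGerbe W)
    {y : (Z.fibreProd W).N × (Z.fibreProd W).N} (hy : y ∈ (Z.fibreProd W).fib2)
    {p : P.bundle.Tot} (hp : P.bundle.proj p = (y.1.1, y.2.1))
    {q : Q.bundle.Tot} (hq : Q.bundle.proj q = (y.1.2, y.2.2)) : (P.tensor Q).bundle.Tot :=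
  Quotient.mk _ ⟨(⟨(y, p), hy, hp⟩, ⟨(y, q), hy, hq⟩), rfl⟩

section TensorMk

variable {P : RealBundleGerbe Z} {Q : RealBundleGerbe W}
  {y y' : (Z.fibreProd W).N × (Z.fibreProd W).N} {hy : y ∈ (Z.fibreProd W).fib2}
  {hy' : y' ∈ (Z.fibreProd W).fib2} {p p' : P.bundle.Tot} {q q' : Q.bundle.Tot}

/-- The base point enters the type of the membership proofs, so it must be replaced together with
the factors `p` and `q`. -/
theorem tensorMk_congr {hp : P.bundle.proj p = (y.1.1, y.2.1)}
    {hq : Q.bundle.proj q = (y.1.2, y.2.2)} {hp' : P.bundle.proj p' = (y'.1.1, y'.2.1)}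
    {hq' : Q.bundle.proj q' = (y'.1.2, y'.2.2)} (ey : y = y') (ep : p = p') (eq : q = q') :
    tensorMk P Q hy hp hq = tensorMk P Q hy' hp' hq' := by
  subst ey ep eq
  rfl

theorem tensorMk_smul {z w : Circle} (hp : P.bundle.proj p = (y.1.1, y.2.1))
    (hq : Q.bundle.proj q = (y.1.2, y.2.2)) (hp' : P.bundle.proj (z • p) = (y.1.1, y.2.1))
    (hq' : Q.bundle.proj (w • q) = (y.1.2, y.2.2)) :
    tensorMk P Q hy hp' hq' = (z * w) • tensorMk P Q hy hp hq := by
  refine Quotient.sound ⟨w, Subtype.ext (Prod.ext rfl ?_), Subtype.ext (Prod.ext rfl ?_)⟩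
  · change w • z • p = (z * w) • p
    rw [← SemigroupAction.mul_smul, mul_comm]
  · exact inv_smul_smul w q

theorem conj_tensorMk (hp : P.bundle.proj p = (y.1.1, y.2.1))
    (hq : Q.bundle.proj q = (y.1.2, y.2.2)) :
    (P.tensor Q).conj (tensorMk P Q hy hp hq) = tensorMk P Q ((Z.fibreProd W).mapsTo_inv hy)
      (p := P.conj p) (q := Q.conj q) (by rw [P.isConj.proj, hp]; rfl)
      (by rw [Q.isConj.proj, hq]; rfl) :=
  rfl

theorem tensorMk_mul (hp : P.bundle.proj p = (y.1.1, y.2.1))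
    (hq : Q.bundle.proj q = (y.1.2, y.2.2)) (hp' : P.bundle.proj p' = (y'.1.1, y'.2.1))
    (hq' : Q.bundle.proj q' = (y'.1.2, y'.2.2)) (h : y.2 = y'.1)
    (hyy : (y.1, y'.2) ∈ (Z.fibreProd W).fib2) :
    (P.tensor Q).mul (tensorMk P Q hy hp hq) (tensorMk P Q hy' hp' hq') =
      tensorMk P Q hyy (p := P.mul p p') (q := Q.mul q q')
        (by rw [P.proj_mul _ _ (by rw [hp, hp', h]), hp, hp'])
        (by rw [Q.proj_mul _ _ (by rw [hq, hq', h]), hq, hq']) := by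
  refine (BundleGerbe.tensorMul_mk _ _ _ _ h).trans ?_
  exact congrArg (Quotient.mk _) (Subtype.ext (Prod.ext
    (Subtype.ext (BundleGerbe.pullbackMul_val _ _ _ _ h))
    (Subtype.ext (BundleGerbe.pullbackMul_val _ _ _ _ h))))

end TensorMk

/-- The factors are first lifted to the pullbacks over the fibre product and then tensored. A point
of `M` produces elements of all the total spaces involved, which are the default values outside `V`.
-/
theorem exists_tensor_section [Nonempty M] {P : RealBundleGerbe Z} {Q : RealBundleGerbe W}
    {V : Set M} {f₁ f₂ : M → Z.N} {k₁ k₂ : M → W.N} {s : M → P.bundle.Tot} {t : M → Q.bundle.Tot}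
    (hs : IsSmoothSectionAlong P.bundle 𝓘(ℝ, EM) V (fun m => (f₁ m, f₂ m)) s)
    (ht : IsSmoothSectionAlong Q.bundle 𝓘(ℝ, EM) V (fun m => (k₁ m, k₂ m)) t)
    (h₁ : ∀ m ∈ V, Z.π (f₁ m) = W.π (k₁ m)) (h₂ : ∀ m ∈ V, Z.π (f₂ m) = W.π (k₂ m)) :
    ∃ r : M → (P.tensor Q).bundle.Tot,
      IsSmoothSectionAlong (P.tensor Q).bundle 𝓘(ℝ, EM) V
        (fun m => ((f₁ m, k₁ m), (f₂ m, k₂ m))) r ∧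
      ∀ m ∈ V, ∃ (hy : ((f₁ m, k₁ m), (f₂ m, k₂ m)) ∈ (Z.fibreProd W).fib2)
        (hp : P.bundle.proj (s m) = (f₁ m, f₂ m)) (hq : Q.bundle.proj (t m) = (k₁ m, k₂ m)),
        r m = tensorMk P Q hy hp hq := by
  obtain ⟨m₀⟩ := ‹Nonempty M›
  obtain ⟨y₀, hy₀, e₀⟩ := (Z.fibreProd W).surj_π m₀
  have hyy : (y₀, y₀) ∈ (Z.fibreProd W).fib2 := ⟨hy₀, hy₀, rfl⟩
  obtain ⟨t₀, -⟩ := (P.tensor Q).bundle.exists_fibre _ hyy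
  have hk : Set.MapsTo (fun m => ((f₁ m, k₁ m), (f₂ m, k₂ m))) V (Z.fibreProd W).fib2 :=
    fun m hm => ⟨⟨(hs.mapsTo hm).1, (ht.mapsTo hm).1, h₁ m hm⟩,
      ⟨(hs.mapsTo hm).2.1, (ht.mapsTo hm).2.1, h₂ m hm⟩, (hs.mapsTo hm).2.2⟩
  have fst : ContMDiff (Z.fibreProd W).I Z.I ∞ (fun y : (Z.fibreProd W).N => y.1) :=
    contMDiff_fst (I := Z.I) (J := W.I)
  have snd : ContMDiff (Z.fibreProd W).I W.I ∞ (fun y : (Z.fibreProd W).N => y.2) :=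
    contMDiff_snd (I := Z.I) (J := W.I)
  have hP : Nonempty (P.toBundleGerbe.pullbackBundle (Z' := (Z.fibreProd W).toSurjSubmersion) fst
    (fun _ hy => hy.1) fun _ _ => rfl).Tot := ⟨t₀.out.1.1⟩
  have hQ : Nonempty (Q.toBundleGerbe.pullbackBundle (Z' := (Z.fibreProd W).toSurjSubmersion) snd
    (fun _ hy => hy.2.1) fun _ hy => hy.2.2.symm).Tot := ⟨t₀.out.1.2⟩
  obtain ⟨p, hp, hp'⟩ := IsSmoothSectionAlong.exists_pullback (fst.prodMap fst)
    (BundleGerbe.mapsTo_fib2 (Z' := (Z.fibreProd W).toSurjSubmersion) (fun _ hy => hy.1)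
      fun _ _ => rfl) hs hk (fun _ _ => rfl) hP
  obtain ⟨q, hq, hq'⟩ := IsSmoothSectionAlong.exists_pullback (snd.prodMap snd)
    (BundleGerbe.mapsTo_fib2 (Z' := (Z.fibreProd W).toSurjSubmersion) (fun _ hy => hy.2.1)
      fun _ hy => hy.2.2.symm) ht hk (fun _ _ => rfl) hQ
  obtain ⟨r, hr, hr'⟩ := hp.exists_tensor hq ⟨t₀⟩
  refine ⟨r, hr, fun m hm => ⟨hk hm, hs.proj m hm, ht.proj m hm, ?_⟩⟩
  obtain ⟨e, he⟩ := hr' m hm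
  rw [he]
  exact congrArg (Quotient.mk _) (Subtype.ext (Prod.ext (Subtype.ext (hp' m hm))
    (Subtype.ext (hq' m hm))))

/-- On the common refinement the pairs `(s_a, s'_a')` are sections of `Y ×_M X`, and `σ ⊗ σ'` are
sections of `P ⊗ Q` over them. As products are formed factorwise, the scalars multiply. -/
theorem IsRealDDClass.tensor [Nonempty M] {P : RealBundleGerbe Z} {Q : RealBundleGerbe W}
    {c c' : RealH2 EM τ} (h : P.IsRealDDClass c) (h' : Q.IsRealDDClass c')
    (hττ : Function.Involutive τ) : (P.tensor Q).IsRealDDClass (c + c') := by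
  obtain ⟨𝓤, D, g, hD, rfl⟩ := RealSections.isRealDDClass_iff.mp h
  obtain ⟨𝓥, D', g', hD', rfl⟩ := RealSections.isRealDDClass_iff.mp h'
  have key := fun a b : (𝓤.inter 𝓥).A => exists_tensor_section (P := P) (Q := Q)
    (V := (𝓤.inter 𝓥).U a ∩ (𝓤.inter 𝓥).U b)
    ((D.isSection a.1 b.1).mono fun m hm => ⟨hm.1.1, hm.2.1⟩)
    ((D'.isSection a.2 b.2).mono fun m hm => ⟨hm.1.2, hm.2.2⟩)
    (fun m hm => (D.s_mem _ m hm.1.1).2.trans (D'.s_mem _ m hm.1.2).2.symm)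
    (fun m hm => (D.s_mem _ m hm.2.1).2.trans (D'.s_mem _ m hm.2.2).2.symm)
  choose r hr hr' using key
  refine RealSections.isRealDDClass_iff.mpr ⟨𝓤.inter 𝓥,
    ⟨fun a m => (D.s a.1 m, D'.s a.2 m), r, fun a => ?_, fun a m hm => ?_, fun a m hm => ?_, hr,
      fun a b m hm => ?_⟩, (CechPair.mul ⟨𝓤, g⟩ ⟨𝓥, g'⟩).cocycle, fun a b c m hm => ?_, rfl⟩
  · exact ((D.smooth_s _).mono Set.inter_subset_left).prodMk
      ((D'.smooth_s _).mono Set.inter_subset_right)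
  · have e1 := D.s_mem _ m hm.1
    have e2 := D'.s_mem _ m hm.2
    exact ⟨⟨e1.1, e2.1, e1.2.trans e2.2.symm⟩, e1.2⟩
  · exact Prod.ext (D.s_real _ m hm.1) (D'.s_real _ m hm.2)
  · obtain ⟨hy, hp, hq, e⟩ := hr' a b m hm
    obtain ⟨hy', hp', hq', e'⟩ := hr' _ _ (τ m)
      ⟨RealCover.apply_mem_bar _ hττ hm.1, RealCover.apply_mem_bar _ hττ hm.2⟩
    rw [e, e']
    refine Eq.trans ?_ (conj_tensorMk (hy := hy) hp hq).symm
    refine tensorMk_congr (Prod.ext (Prod.ext ?_ ?_) (Prod.ext ?_ ?_)) ?_ ?_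
    · exact D.s_real _ m hm.1.1
    · exact D'.s_real _ m hm.1.2
    · exact D.s_real _ m hm.2.1
    · exact D'.s_real _ m hm.2.2
    · exact D.σ_real _ _ m ⟨hm.1.1, hm.2.1⟩
    · exact D'.σ_real _ _ m ⟨hm.1.2, hm.2.2⟩
  · obtain ⟨hy, hp, hq, e⟩ := hr' a b m hm.1
    obtain ⟨hy', hp', hq', e'⟩ := hr' b c m ⟨hm.1.2, hm.2⟩
    obtain ⟨hy'', hp'', hq'', e''⟩ := hr' a c m ⟨hm.1.1, hm.2⟩
    change (P.tensor Q).mul (r a b m) (r b c m) =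
      (g.val a.1 b.1 c.1 m * g'.val a.2 b.2 c.2 m) • r a c m
    rw [e, e', e'']
    refine (tensorMk_mul (hy := hy) (hy' := hy') hp hq hp' hq' rfl hy'').trans
      (Eq.trans ?_ (tensorMk_smul (hy := hy'') hp'' hq'' (by rw [U1Bundle.proj_smul, hp''])
        (by rw [U1Bundle.proj_smul, hq''])))
    exact tensorMk_congr rfl (hD _ _ _ m ⟨⟨hm.1.1.1, hm.1.2.1⟩, hm.2.1⟩)
      (hD' _ _ _ m ⟨⟨hm.1.1.2, hm.1.2.2⟩, hm.2.2⟩)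

end RealBundleGerbe

/-- The coordinate of `s^* ⊗ t` is the coordinate of `t` divided by that of `s`. The section `r` is
prescribed only on `V`, since elsewhere `s` and `t` need not lie over the same point of `M`. -/
theorem BundleGerbe.isSmoothSectionAlong_deltaMk {Z : SurjSubmersion EM M}
    (R : U1Bundle Z.I Z.carrier) {E' H' N' : Type u} [NormedAddCommGroup E'] [NormedSpace ℝ E']
    [TopologicalSpace H'] [TopologicalSpace N'] [ChartedSpace H' N']
    {I' : ModelWithCorners ℝ E' H'} {V : Set N'} {f₁ f₂ : N' → Z.N} {s t : N' → R.Tot}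
    (hs : IsSmoothSectionAlong R I' V f₁ s) (ht : IsSmoothSectionAlong R I' V f₂ t)
    {r : N' → (BundleGerbe.deltaBundle R).Tot}
    (hr : ∀ x ∈ V, ∃ h, r x = BundleGerbe.deltaMk R (s x) (t x) h) :
    IsSmoothSectionAlong (BundleGerbe.deltaBundle R) I' V (fun x => (f₁ x, f₂ x)) r := by
  refine ⟨fun x hx => ?_, fun i => ?_⟩
  · obtain ⟨h, e⟩ := hr x hx
    rw [e]
    exact Prod.ext (hs.proj x hx) (ht.proj x hx)
  · refine (((ht.smooth i.1).mono ?_).mul ((hs.smooth i.2).mono ?_).inv).congr ?_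
    · exact fun x hx => ⟨hx.1, hx.2.1⟩
    · exact fun x hx => ⟨hx.1, hx.2.2⟩
    · intro x hx
      obtain ⟨h, e⟩ := hr x hx.1
      rw [e]
      refine BundleGerbe.coord_deltaMk R h i.1 i.2 ?_ ?_
      · rw [ht.proj x hx.1]
        exact hx.2.1
      · rw [hs.proj x hx.1]
        exact hx.2.2

open Classical in
/-- The class of `δR` vanishes. -/
theorem RealLineBundle.isRealDDClass_delta [T2Space M] [ParacompactSpace M]
    (hτ : ContMDiff 𝓘(ℝ, EM) 𝓘(ℝ, EM) ∞ τ) (hττ : Function.Involutive τ) (R : RealLineBundle Z) :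
    R.delta.IsRealDDClass 0 := by
  -- Only the sections `s_a` of `D` matter here. They are lifted to Real sections `ρ_a` of `R` on a
  -- refinement, and the `σ` of `D` are discarded.
  obtain ⟨𝓤, ⟨D⟩⟩ := RealSections.exists_of_paracompact hτ hττ R.delta
  obtain ⟨𝓦, f, ρ, hρ, hρ'⟩ := RealCover.exists_refinement_sections hτ hττ 𝓤 R.isConj R.conj_conj
    D.s D.smooth_s (fun a m hm => (D.s_mem a m hm).1) D.s_real
  have hπ : ∀ a, ∀ m ∈ 𝓦.U a, Z.π (R.proj (ρ a m)) = m := fun a m hm => by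
    rw [(hρ a).proj m hm]
    exact (D.s_mem _ m (f.subset a hm)).2
  have hab : ∀ a b, ∀ m ∈ 𝓦.U a ∩ 𝓦.U b, Z.π (R.proj (ρ a m)) = Z.π (R.proj (ρ b m)) :=
    fun a b m hm => (hπ a m hm.1).trans (hπ b m hm.2).symm
  -- `σ_ab = ρ_a^* ⊗ ρ_b`; the other branch is never reached on an overlap and only supplies a value
  -- elsewhere.
  let σ : 𝓦.A → 𝓦.A → M → (BundleGerbe.deltaBundle R.toU1Bundle).Tot := fun a b m =>
    if h : Z.π (R.proj (ρ a m)) = Z.π (R.proj (ρ b m)) then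
      BundleGerbe.deltaMk R.toU1Bundle (ρ a m) (ρ b m) h
    else D.σ (f.map a) (f.map b) m
  have hσ : ∀ a b, ∀ m ∈ 𝓦.U a ∩ 𝓦.U b, ∃ h,
      σ a b m = BundleGerbe.deltaMk R.toU1Bundle (ρ a m) (ρ b m) h := fun a b m hm =>
    ⟨hab a b m hm, dif_pos (hab a b m hm)⟩
  refine RealSections.isRealDDClass_iff.mpr ⟨𝓦, ⟨(D.restrict f).s, σ, (D.restrict f).smooth_s,
    (D.restrict f).s_mem, (D.restrict f).s_real, fun a b =>
      BundleGerbe.isSmoothSectionAlong_deltaMk R.toU1Bundle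
        ((hρ a).mono Set.inter_subset_left) ((hρ b).mono Set.inter_subset_right) (hσ a b),
    fun a b m hm => ?_⟩, ⟨fun _ _ _ _ => 1, fun _ _ _ => contMDiffOn_const,
      fun _ _ _ _ _ => by simp, fun _ _ _ _ _ _ => by simp⟩, fun a b c m hm => ?_,
    (RealH2.mk_eq_zero fun _ _ _ _ _ => rfl).symm⟩
  · obtain ⟨h, e⟩ := hσ a b m hm
    obtain ⟨h', e'⟩ := hσ _ _ (τ m) ⟨𝓦.apply_mem_bar hττ hm.1, 𝓦.apply_mem_bar hττ hm.2⟩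
    rw [e, e']
    refine Eq.trans ?_ (R.deltaConj_mk h).symm
    congr 1
    · exact hρ' a m hm.1
    · exact hρ' b m hm.2
  -- The middle factors `ρ_b` and `ρ_b^*` contract to `1`, so the cocycle is constantly `1`.
  · obtain ⟨h, e⟩ := hσ a b m hm.1
    obtain ⟨h', e'⟩ := hσ b c m ⟨hm.1.2, hm.2⟩
    obtain ⟨h'', e''⟩ := hσ a c m ⟨hm.1.1, hm.2⟩
    change BundleGerbe.deltaMul R.toU1Bundle (σ a b m) (σ b c m) = (1 : Circle) • σ a c m
    rw [e, e', e'', BundleGerbe.deltaMul_mk R.toU1Bundle h h' rfl,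
      R.toU1Bundle.div_eq (one_smul Circle (ρ b m))]

end RealGerbe

/-! ### Descent: a Real bundle gerbe of class zero comes from a Real line bundle. -/

namespace RealGerbe

variable {EM M : Type u} [NormedAddCommGroup EM] [NormedSpace ℝ EM] [TopologicalSpace M]
  [ChartedSpace EM M] {τ : M → M} {Z : RealSubmersion EM τ}

/-- Real sections that are strictly multiplicative, with the choice of a member of the cover for
each point of `M`. -/
structure DescentData (P : RealBundleGerbe Z) : Type (u + 1) where
  cover : RealCover τ
  D : RealSections P cover
  strict : ∀ a b c, ∀ m ∈ cover.U a ∩ cover.U b ∩ cover.U c,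
    P.mul (D.σ a b m) (D.σ b c m) = D.σ a c m
  idx : M → cover.A
  mem_idx : ∀ m, m ∈ cover.U (idx m)

/-- Vanishing of the class means that on some refinement `g` is the coboundary of a Real cochain
`h`. Replacing `σ_ab` by `h_ab⁻¹ σ_ab` keeps it Real and turns the cocycle into `1`. -/
theorem RealBundleGerbe.IsRealDDClass.nonempty_descentData {P : RealBundleGerbe Z}
    (h : P.IsRealDDClass 0) : Nonempty (DescentData P) := by
  obtain ⟨𝓤, D, g, hD, e⟩ := RealSections.isRealDDClass_iff.mp h
  -- Zero is represented by the constant cocycle on the trivial cover, which accounts for the factor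
  -- `1` in `H`; the refinement `f'` plays no further role.
  obtain ⟨𝓦, f, f', h, H⟩ := Quotient.exact e.symm
  change 𝓦.Refinement 𝓤 at f
  have H : ∀ a b c, ∀ m ∈ 𝓦.U a ∩ 𝓦.U b ∩ 𝓦.U c, g.val (f.map a) (f.map b) (f.map c) m =
      1 * (h.val b c m * (h.val a c m)⁻¹ * h.val a b m) := H
  choose idx hidx using 𝓦.exists_mem
  refine ⟨𝓦, ⟨(D.restrict f).s, fun a b m => (h.val a b m)⁻¹ • (D.restrict f).σ a b m,
    (D.restrict f).smooth_s, (D.restrict f).s_mem, (D.restrict f).s_real,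
    fun a b => ((D.restrict f).isSection a b).smul (h.smooth a b).inv, fun a b m hm => ?_⟩,
    fun a b c m hm => ?_, idx, hidx⟩
  · rw [h.real a b m hm, (D.restrict f).σ_real a b m hm, P.isConj.smul]
  · have e : P.mul ((D.restrict f).σ a b m) ((D.restrict f).σ b c m) =
        (1 * (h.val b c m * (h.val a c m)⁻¹ * h.val a b m)) • (D.restrict f).σ a c m :=
      (hD.restrict f a b c m hm).trans (congrArg (· • _) (H a b c m hm))
    have hc := (D.restrict f).composable hm.1.1 hm.1.2 hm.2
    change P.mul ((h.val a b m)⁻¹ • (D.restrict f).σ a b m)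
      ((h.val b c m)⁻¹ • (D.restrict f).σ b c m) = (h.val a c m)⁻¹ • (D.restrict f).σ a c m
    rw [P.smul_mul _ _ _ (by rw [P.bundle.proj_smul]; exact hc), P.mul_smul _ _ _ hc, e,
      ← SemigroupAction.mul_smul, ← SemigroupAction.mul_smul]
    congr 1
    generalize h.val a b m = x
    generalize h.val b c m = y
    rw [one_mul, mul_right_comm y, mul_assoc, mul_assoc, inv_mul_cancel_left,
      inv_mul_cancel_left]

namespace BundleGerbe

variable {Z : SurjSubmersion EM M} (P : BundleGerbe Z)

/-- An idempotent of a bundle gerbe is a left unit. -/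
theorem mul_eq_of_idempotent {e q : P.bundle.Tot} (hee : P.mul e e = e)
    (he : (P.bundle.proj e).2 = (P.bundle.proj e).1)
    (h : (P.bundle.proj e).2 = (P.bundle.proj q).1) : P.mul e q = q := by
  -- `e q` and `q` lie in one fibre, so `e q = z q`. Associativity gives `z q = z² q`, whence `z =
  -- 1`.
  obtain ⟨z, hz⟩ := P.bundle.exists_smul q (P.mul e q) (by
    rw [P.proj_mul _ _ h, ← he, h])
  have h1 := P.mul_assoc e e q he h
  rw [hee, ← hz, P.mul_smul _ _ _ h, ← hz, ← SemigroupAction.mul_smul] at h1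
  rw [← hz, left_eq_mul.mp (P.bundle.smul_right_injective h1), one_smul]

theorem π_proj (p : P.bundle.Tot) :
    Z.π (P.bundle.proj p).1 = Z.π (P.bundle.proj p).2 :=
  (P.bundle.proj_mem p).2.2

end BundleGerbe

namespace DescentData

variable {P : RealBundleGerbe Z} (X : DescentData P)

/-- The total space of the bundle over `Y` with the fibre `P_{(s_a(π y), y)}` over `y`, for the
chosen index `a` of `π y`. -/
def Tot : Type u :=
  {p : P.bundle.Tot // (P.bundle.proj p).1 =
    X.D.s (X.idx (Z.π (P.bundle.proj p).2)) (Z.π (P.bundle.proj p).2)}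

variable {X}

/-- The projection of `X.Tot` to `Y`. -/
def pt (r : X.Tot) : Z.N := (P.bundle.proj r.1).2

theorem pt_mem (r : X.Tot) : pt r ∈ Z.carrier := (P.bundle.proj_mem r.1).2.1

theorem proj_val (r : X.Tot) :
    P.bundle.proj r.1 = (X.D.s (X.idx (Z.π (pt r))) (Z.π (pt r)), pt r) :=
  Prod.ext r.2 rfl

/-- Strictness for the indices `a, a, a` makes `σ_aa` idempotent, hence a left unit. -/
theorem σ_self_mul {a : X.cover.A} {m : M} (hm : m ∈ X.cover.U a) {q : P.bundle.Tot}
    (hq : (P.bundle.proj q).1 = X.D.s a m) : P.mul (X.D.σ a a m) q = q := by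
  have e := X.D.proj_σ hm hm
  exact P.toBundleGerbe.mul_eq_of_idempotent (X.strict a a a m ⟨⟨hm, hm⟩, hm⟩)
    (by rw [e]) (by rw [e, hq])

/-- This is the gluing condition: the identifications of the fibres `P_(s_a(π y), y)` for different
`a` by left multiplication compose correctly exactly because the cocycle has been made trivial. -/
theorem σ_mul_σ_mul {a b c : X.cover.A} {m : M} (ha : m ∈ X.cover.U a) (hb : m ∈ X.cover.U b)
    (hc : m ∈ X.cover.U c) {q : P.bundle.Tot} (hq : (P.bundle.proj q).1 = X.D.s c m) :
    P.mul (X.D.σ a b m) (P.mul (X.D.σ b c m) q) = P.mul (X.D.σ a c m) q := by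
  rw [← P.mul_assoc _ _ _ (X.D.composable ha hb hc) (by rw [X.D.proj_σ hb hc, hq]),
    X.strict a b c m ⟨⟨ha, hb⟩, hc⟩]

theorem proj_σ_mul {a b : X.cover.A} {m : M} (ha : m ∈ X.cover.U a) (hb : m ∈ X.cover.U b)
    {q : P.bundle.Tot} (hq : (P.bundle.proj q).1 = X.D.s b m) :
    P.bundle.proj (P.mul (X.D.σ a b m) q) = (X.D.s a m, (P.bundle.proj q).2) := by
  rw [P.proj_mul _ _ (by rw [X.D.proj_σ ha hb, hq]), X.D.proj_σ ha hb]

/-- The representative of `r` in `P_{(s_a(π y), y)}`. -/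
def toChart (a : X.cover.A) (r : X.Tot) : P.bundle.Tot :=
  P.mul (X.D.σ a (X.idx (Z.π (pt r))) (Z.π (pt r))) r.1

theorem proj_toChart {a : X.cover.A} {r : X.Tot} (ha : Z.π (pt r) ∈ X.cover.U a) :
    P.bundle.proj (toChart a r) = (X.D.s a (Z.π (pt r)), pt r) :=
  proj_σ_mul ha (X.mem_idx _) r.2

theorem σ_mul_toChart {a b : X.cover.A} {r : X.Tot} (ha : Z.π (pt r) ∈ X.cover.U a)
    (hb : Z.π (pt r) ∈ X.cover.U b) :
    P.mul (X.D.σ b a (Z.π (pt r))) (toChart a r) = toChart b r :=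
  σ_mul_σ_mul hb ha (X.mem_idx _) r.2

/-- The element of `X.Tot` with the representative `q` in `P_{(s_a(π y), y)}`. -/
def ofChart (a : X.cover.A) (q : P.bundle.Tot)
    (ha : Z.π (P.bundle.proj q).2 ∈ X.cover.U a)
    (hq : (P.bundle.proj q).1 = X.D.s a (Z.π (P.bundle.proj q).2)) : X.Tot :=
  ⟨P.mul (X.D.σ (X.idx (Z.π (P.bundle.proj q).2)) a (Z.π (P.bundle.proj q).2)) q, by
    rw [proj_σ_mul (X.mem_idx _) ha hq]⟩

theorem pt_ofChart {a : X.cover.A} {q : P.bundle.Tot}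
    (ha : Z.π (P.bundle.proj q).2 ∈ X.cover.U a)
    (hq : (P.bundle.proj q).1 = X.D.s a (Z.π (P.bundle.proj q).2)) :
    pt (ofChart a q ha hq) = (P.bundle.proj q).2 := by
  change (P.bundle.proj (P.mul _ q)).2 = _
  rw [proj_σ_mul (X.mem_idx _) ha hq]

theorem toChart_ofChart {a : X.cover.A} {q : P.bundle.Tot}
    (ha : Z.π (P.bundle.proj q).2 ∈ X.cover.U a)
    (hq : (P.bundle.proj q).1 = X.D.s a (Z.π (P.bundle.proj q).2)) :
    toChart a (ofChart a q ha hq) = q := by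
  unfold toChart
  rw [pt_ofChart]
  exact (σ_mul_σ_mul ha (X.mem_idx _) ha hq).trans (σ_self_mul ha hq)

/-- The choice `idx` is arbitrary, in general neither continuous nor compatible with `τ`. Identities
in `X.Tot` are therefore tested on the representatives for a convenient common index, where `idx` no
longer appears. -/
theorem toChart_inj {a : X.cover.A} {r r' : X.Tot} (ha : Z.π (pt r) ∈ X.cover.U a)
    (ha' : Z.π (pt r') ∈ X.cover.U a) (h : toChart a r = toChart a r') : r = r' := by
  have key : ∀ {r : X.Tot}, Z.π (pt r) ∈ X.cover.U a →
      P.mul (X.D.σ (X.idx (Z.π (pt r))) a (Z.π (pt r))) (toChart a r) = r.1 := fun {r} hr => by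
    rw [σ_mul_toChart hr (X.mem_idx _)]
    exact σ_self_mul (X.mem_idx _) r.2
  have e : pt r = pt r' := by
    have := congrArg (fun q => (P.bundle.proj q).2) h
    simpa only [proj_toChart ha, proj_toChart ha'] using this
  refine Subtype.ext ?_
  rw [← key ha, ← key ha', e, h]

instance : MulAction Circle X.Tot where
  smul z r := ⟨z • r.1, by
    rw [P.bundle.proj_smul]
    exact r.2⟩
  one_smul r := Subtype.ext (one_smul _ _)
  mul_smul z w r := Subtype.ext (mul_smul _ _ _)

theorem pt_smul (z : Circle) (r : X.Tot) : pt (z • r) = pt r :=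
  congrArg Prod.snd (P.bundle.proj_smul z r.1)

theorem toChart_smul (a : X.cover.A) (z : Circle) {r : X.Tot} (ha : Z.π (pt r) ∈ X.cover.U a) :
    toChart a (z • r) = z • toChart a r := by
  unfold toChart
  rw [pt_smul]
  exact P.mul_smul z _ _ (by rw [X.D.proj_σ ha (X.mem_idx _), proj_val])

theorem exists_pt_eq {y : Z.N} (hy : y ∈ Z.carrier) : ∃ r : X.Tot, pt r = y := by
  have h := X.D.s_mem _ _ (X.mem_idx (Z.π y))
  obtain ⟨p, hp⟩ := P.bundle.exists_fibre (X.D.s (X.idx (Z.π y)) (Z.π y), y) ⟨h.1, hy, h.2⟩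
  exact ⟨⟨p, by rw [hp]⟩, congrArg Prod.snd hp⟩

theorem exists_smul_eq {r r' : X.Tot} (h : pt r = pt r') : ∃ z : Circle, z • r = r' := by
  obtain ⟨z, hz⟩ := P.bundle.exists_smul r.1 r'.1 (by rw [proj_val, proj_val, h])
  exact ⟨z, Subtype.ext hz⟩

theorem contMDiffOn_s_π (a : X.cover.A) : ContMDiffOn Z.I Z.I ∞ (fun y => X.D.s a (Z.π y))
    {y | y ∈ Z.carrier ∧ Z.π y ∈ X.cover.U a} :=
  (X.D.smooth_s a).comp (Z.smooth_π.mono fun _ hy => hy.1) fun _ hy => hy.2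

variable (X) in
/-- The open sets over which a trivialisation of `P` and the sections `s_a` trivialise `X.Tot`. -/
def Chart : Type u :=
  {i : Set Z.N × X.cover.A × P.bundle.ι // IsOpen i.1 ∧ ∀ y ∈ Z.carrier, y ∈ i.1 →
    Z.π y ∈ X.cover.U i.2.1 ∧ (X.D.s i.2.1 (Z.π y), y) ∈ P.bundle.dom i.2.2}

/-- Continuity of `y ↦ (s_a(π y), y)` is known only within `Z.carrier`, so the conditions on a chart
cut out a relative neighbourhood. It is realised by an open set `O` of the ambient manifold, and
this is why a chart imposes its conditions only at points of the carrier. -/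
theorem exists_chart {y : Z.N} (hy : y ∈ Z.carrier) : ∃ i : X.Chart, y ∈ i.1.1 := by
  have hs := X.D.s_mem _ _ (X.mem_idx (Z.π y))
  obtain ⟨j, hj⟩ := P.bundle.exists_dom (X.D.s (X.idx (Z.π y)) (Z.π y), y) ⟨hs.1, hy, hs.2⟩
  have hV : {x | x ∈ Z.carrier ∧ Z.π x ∈ X.cover.U (X.idx (Z.π y))} ∈ nhdsWithin y Z.carrier :=
    Filter.inter_mem self_mem_nhdsWithin (Z.smooth_π.continuousOn y hy
      ((X.cover.isOpen _).mem_nhds (X.mem_idx _)))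
  have hf : ContinuousOn (fun x => (X.D.s (X.idx (Z.π y)) (Z.π x), x))
      {x | x ∈ Z.carrier ∧ Z.π x ∈ X.cover.U (X.idx (Z.π y))} :=
    (contMDiffOn_s_π _).continuousOn.prodMk continuousOn_id
  have hn := (hf y ⟨hy, X.mem_idx _⟩).mono_of_mem_nhdsWithin hV
    ((P.bundle.isOpen_dom j).mem_nhds hj)
  obtain ⟨O, hO, hyO, hOs⟩ := mem_nhdsWithin.mp (Filter.inter_mem hV hn)
  exact ⟨⟨(O, X.idx (Z.π y), j), hO, fun x hx hxO => ⟨(hOs ⟨hxO, hx⟩).1.2, (hOs ⟨hxO, hx⟩).2⟩⟩, hyO⟩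

/-- Over a chart there are smooth sections of the pullback of `P` by `y ↦ (s_a(π y), y)`. -/
theorem exists_chart_section [Nonempty P.bundle.Tot] (i : X.Chart) {T : Set Z.N}
    (hT : ∀ y ∈ T, y ∈ Z.carrier ∧ y ∈ i.1.1) : ∃ q : Z.N → P.bundle.Tot,
      IsSmoothSectionAlong P.bundle Z.I T (fun y => (X.D.s i.1.2.1 (Z.π y), y)) q ∧
      ∀ r : X.Tot, pt r ∈ T →
        toChart i.1.2.1 r = P.bundle.coord i.1.2.2 (toChart i.1.2.1 r) • q (pt r) := by
  have hT' : ∀ y ∈ T, Z.π y ∈ X.cover.U i.1.2.1 ∧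
      (X.D.s i.1.2.1 (Z.π y), y) ∈ P.bundle.dom i.1.2.2 := fun y hy =>
    i.2.2 y (hT y hy).1 (hT y hy).2
  obtain ⟨q, hq, hq'⟩ := P.bundle.exists_section_coord_eq_one (I' := Z.I) (V := T)
    (f := fun y => (X.D.s i.1.2.1 (Z.π y), y))
    (((contMDiffOn_s_π i.1.2.1).mono fun y hy => ⟨(hT y hy).1, (hT' y hy).1⟩).prodMk
      contMDiffOn_id) i.1.2.2 fun y hy =>
      ⟨⟨(X.D.s_mem _ _ (hT' y hy).1).1, (hT y hy).1, (X.D.s_mem _ _ (hT' y hy).1).2⟩,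
        (hT' y hy).2⟩
  refine ⟨q, hq, fun r hr => ?_⟩
  have hr' := hT' _ hr
  refine P.bundle.eq_of_coord_eq (i := i.1.2.2) ?_ ?_ ?_
  · rw [proj_toChart hr'.1, P.bundle.proj_smul, hq.proj _ hr]
  · rw [proj_toChart hr'.1]
    exact hr'.2
  · rw [P.bundle.coord_smul _ _ _ (by rw [hq.proj _ hr]; exact hr'.2), hq' _ hr, mul_one]

theorem contMDiffOn_s_π_chart (i : X.Chart) {T : Set Z.N}
    (hT : ∀ y ∈ T, y ∈ Z.carrier ∧ y ∈ i.1.1) :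
    ContMDiffOn Z.I Z.I ∞ (fun y => X.D.s i.1.2.1 (Z.π y)) T :=
  (contMDiffOn_s_π i.1.2.1).mono fun y hy => ⟨(hT y hy).1, (i.2.2 y (hT y hy).1 (hT y hy).2).1⟩

variable (X) in
/-- The bundle over `Y` with the fibres `P_{(s_a(π y), y)}`. -/
def bundle : U1Bundle Z.I Z.carrier where
  Tot := X.Tot
  proj := pt
  proj_mem := pt_mem
  proj_smul := pt_smul
  exists_fibre := fun _ hy => exists_pt_eq hy
  exists_smul := fun _ _ h => exists_smul_eq h
  ι := X.Chart
  dom := fun i => i.1.1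
  isOpen_dom := fun i => i.2.1
  exists_dom := fun _ hy => exists_chart hy
  coord := fun i r => P.bundle.coord i.1.2.2 (toChart i.1.2.1 r)
  coord_smul := fun i z r hr => by
    have h := i.2.2 _ (pt_mem r) hr
    rw [toChart_smul _ _ h.1, P.bundle.coord_smul _ _ _ (by rw [proj_toChart h.1]; exact h.2)]
  transition := fun i j => by
    rcases isEmpty_or_nonempty P.bundle.Tot with _ | _
    · exact ⟨fun _ => 1, contMDiffOn_const, fun r => isEmptyElim r.1⟩
    obtain ⟨q, hq, hq'⟩ := exists_chart_section i
      (T := {y | y ∈ Z.carrier ∧ y ∈ i.1.1 ∧ y ∈ j.1.1}) fun y hy => ⟨hy.1, hy.2.1⟩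
    have hi := contMDiffOn_s_π_chart i
      (T := {y | y ∈ Z.carrier ∧ y ∈ i.1.1 ∧ y ∈ j.1.1}) fun y hy => ⟨hy.1, hy.2.1⟩
    have hj := contMDiffOn_s_π_chart j
      (T := {y | y ∈ Z.carrier ∧ y ∈ i.1.1 ∧ y ∈ j.1.1}) fun y hy => ⟨hy.1, hy.2.2⟩
    -- With `q` the section of coordinate `1` in chart `i`, the transition function from `i` to `j`
    -- is the coordinate of `σ_ji(π y) q(y)`, where `σ_ji` has the cover indices of the two charts.
    have hm := P.toBundleGerbe.isSmoothSectionAlong_mul hj hi contMDiffOn_id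
      ((X.D.isSection j.1.2.1 i.1.2.1).comp (Z.smooth_π.mono fun y hy => hy.1) fun y hy =>
        ⟨(j.2.2 y hy.1 hy.2.2).1, (i.2.2 y hy.1 hy.2.1).1⟩) hq
    refine ⟨_, (hm.smooth j.1.2.2).mono fun y hy => ⟨hy, (j.2.2 y hy.1 hy.2.2).2⟩,
      fun r hri hrj => ?_⟩
    have hr : pt r ∈ {y | y ∈ Z.carrier ∧ y ∈ i.1.1 ∧ y ∈ j.1.1} := ⟨pt_mem r, hri, hrj⟩
    have ei := i.2.2 _ (pt_mem r) hri
    have ej := j.2.2 _ (pt_mem r) hrj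
    rw [← σ_mul_toChart ei.1 ej.1]
    conv_lhs => rw [hq' r hr]
    rw [P.mul_smul _ _ _ (by rw [X.D.proj_σ ej.1 ei.1, hq.proj _ hr]),
      P.bundle.coord_smul _ _ _ (by rw [hm.proj _ hr]; exact ej.2), mul_comm]

/-- The Real structure of `X.Tot`. -/
def conj (r : X.Tot) : X.Tot :=
  -- Conjugation in `P` leads from index `a` to `ā`, which need not be the index chosen at `τ (π
  -- y)`; `ofChart` corrects this.
  ofChart (X.cover.bar (X.idx (Z.π (pt r)))) (P.conj r.1)
    (by
      rw [P.isConj.proj, X.cover.U_bar]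
      have h := Z.inv_mem _ (pt_mem r)
      change τ (Z.π (Z.inv (pt r))) ∈ X.cover.U _
      rw [← Z.π_inv _ h, Z.inv_inv _ (pt_mem r)]
      exact X.mem_idx _)
    (by
      rw [P.isConj.proj, proj_val]
      change Z.inv _ = X.D.s _ (Z.π (Z.inv (pt r)))
      rw [Z.π_inv _ (pt_mem r), X.D.s_real _ _ (X.mem_idx _)])

theorem pt_conj (r : X.Tot) : pt (conj r) = Z.inv (pt r) := by
  unfold conj
  rw [pt_ofChart, P.isConj.proj]
  rfl

/-- At points `π y`, that `τ` squares to the identity follows from `inv` being an involution of `Y`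
that covers it. -/
theorem apply_mem_bar {a : X.cover.A} {r : X.Tot} (ha : Z.π (pt r) ∈ X.cover.U a) :
    τ (Z.π (pt r)) ∈ X.cover.U (X.cover.bar a) := by
  have h := Z.inv_mem _ (pt_mem r)
  rw [X.cover.U_bar, ← Z.π_inv _ (pt_mem r)]
  change τ _ ∈ X.cover.U _
  rw [← Z.π_inv _ h, Z.inv_inv _ (pt_mem r)]
  exact ha

theorem π_pt_conj (r : X.Tot) : Z.π (pt (conj r)) = τ (Z.π (pt r)) := by
  rw [pt_conj, Z.π_inv _ (pt_mem r)]

theorem π_pt_conj_mem {a : X.cover.A} {r : X.Tot} (ha : Z.π (pt r) ∈ X.cover.U a) :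
    Z.π (pt (conj r)) ∈ X.cover.U (X.cover.bar a) := by
  rw [π_pt_conj]
  exact apply_mem_bar ha

/-- The reality of `σ` says that the gluing maps commute with conjugation. Hence in the charts `a`
and `ā` the Real structure of the line bundle is just that of `P`, and its properties are inherited
from there. -/
theorem toChart_conj {a : X.cover.A} {r : X.Tot} (ha : Z.π (pt r) ∈ X.cover.U a) :
    toChart (X.cover.bar a) (conj r) = P.conj (toChart a r) := by
  have hb := apply_mem_bar ha
  have hb' := apply_mem_bar (X.mem_idx (Z.π (pt r)))
  have e : toChart (X.cover.bar (X.idx (Z.π (pt r)))) (conj r) = P.conj r.1 := toChart_ofChart _ _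
  rw [← σ_mul_toChart (a := X.cover.bar (X.idx (Z.π (pt r)))) (by rwa [π_pt_conj])
    (by rwa [π_pt_conj]), e, π_pt_conj, X.D.σ_real _ _ _ ⟨ha, X.mem_idx _⟩]
  exact (P.conj_mul _ _ (by rw [X.D.proj_σ ha (X.mem_idx _), proj_val])).symm

theorem conj_conj (r : X.Tot) : conj (conj r) = r := by
  have h := X.mem_idx (Z.π (pt r))
  have hb := π_pt_conj_mem h
  refine toChart_inj (a := X.idx (Z.π (pt r))) ?_ h ?_
  · rwa [pt_conj, pt_conj, Z.inv_inv _ (pt_mem r)]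
  · conv_lhs => rw [← X.cover.bar_bar (X.idx (Z.π (pt r)))]
    rw [toChart_conj hb, toChart_conj h, P.conj_conj]

theorem conj_smul (z : Circle) (r : X.Tot) : conj (z • r) = z⁻¹ • conj r := by
  have h := X.mem_idx (Z.π (pt r))
  have hz : Z.π (pt (z • r)) ∈ X.cover.U (X.idx (Z.π (pt r))) := by rwa [pt_smul]
  have hb := π_pt_conj_mem h
  refine toChart_inj (π_pt_conj_mem hz) (by rwa [pt_smul]) ?_
  rw [toChart_conj hz, toChart_smul _ _ h, P.isConj.smul, toChart_smul _ _ hb, toChart_conj h]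

theorem isConj : IsConjBundleMap X.bundle X.bundle Z.inv (conj (X := X)) where
  proj := pt_conj
  smul := conj_smul
  smooth := fun i j => by
    rcases isEmpty_or_nonempty P.bundle.Tot with _ | _
    · exact ⟨fun _ => 1, contMDiffOn_const, fun r => isEmptyElim r.1⟩
    set T := {y | y ∈ Z.carrier ∧ y ∈ i.1.1 ∧ Z.inv y ∈ j.1.1}
    have hTi : ∀ y ∈ T, y ∈ Z.carrier ∧ y ∈ i.1.1 := fun y hy => ⟨hy.1, hy.2.1⟩
    have hπi : ∀ y ∈ T, Z.π (Z.inv y) ∈ X.cover.U (X.cover.bar i.1.2.1) := fun y hy => by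
      obtain ⟨r, rfl⟩ := exists_pt_eq (X := X) hy.1
      rw [Z.π_inv _ hy.1]
      exact apply_mem_bar (i.2.2 _ hy.1 hy.2.1).1
    have hπj : ∀ y ∈ T, Z.π (Z.inv y) ∈ X.cover.U j.1.2.1 ∧
        (X.D.s j.1.2.1 (Z.π (Z.inv y)), Z.inv y) ∈ P.bundle.dom j.1.2.2 := fun y hy =>
      j.2.2 _ (Z.inv_mem _ hy.1) hy.2.2
    have hinv : ContMDiffOn Z.I Z.I ∞ Z.inv T := Z.smooth_inv.mono fun y hy => hy.1
    obtain ⟨q, hq, hq'⟩ := exists_chart_section i hTi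
    have hc := (hq.conj P.isConj ((contMDiffOn_s_π_chart i hTi).prodMk contMDiffOn_id)).congr
      (t := fun y => P.conj (q y)) (f' := fun y => (X.D.s (X.cover.bar i.1.2.1) (Z.π (Z.inv y)),
        Z.inv y)) (fun y hy => by
          rw [Z.π_inv _ hy.1, X.D.s_real _ _ (i.2.2 _ hy.1 hy.2.1).1]
          rfl) fun _ _ => rfl
    have h1 : ContMDiffOn Z.I Z.I ∞ (fun y => X.D.s j.1.2.1 (Z.π (Z.inv y))) T :=
      (contMDiffOn_s_π j.1.2.1).comp hinv fun y hy => ⟨Z.inv_mem _ hy.1, (hπj y hy).1⟩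
    have h2 : ContMDiffOn Z.I Z.I ∞ (fun y => X.D.s (X.cover.bar i.1.2.1) (Z.π (Z.inv y))) T :=
      (contMDiffOn_s_π (X.cover.bar i.1.2.1)).comp hinv fun y hy => ⟨Z.inv_mem _ hy.1, hπi y hy⟩
    -- In the charts `i` and `j` the conjugation is given by the coordinate of `σ_jā(π (inv y))
    -- conj(q(y))`, with `a` the cover index of `i` and `q` the section of coordinate `1` in `i`.
    have hm := P.toBundleGerbe.isSmoothSectionAlong_mul h1 h2 hinv
      ((X.D.isSection j.1.2.1 (X.cover.bar i.1.2.1)).comp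
        (Z.smooth_π.comp hinv fun y hy => Z.inv_mem _ hy.1) fun y hy => ⟨(hπj y hy).1, hπi y hy⟩) hc
    refine ⟨_, (hm.smooth j.1.2.2).mono fun y hy => ⟨hy, (hπj y hy).2⟩,
      fun (r : X.Tot) hri hrj => ?_⟩
    have hr : pt r ∈ T := ⟨pt_mem r, hri, hrj⟩
    have ei := (i.2.2 _ hr.1 hr.2.1).1
    have ei' := hπi _ hr
    have ej := hπj _ hr
    rw [← pt_conj] at ei' ej
    change P.bundle.coord j.1.2.2 (toChart j.1.2.1 (conj r)) = _
    rw [← σ_mul_toChart ei' ej.1, toChart_conj ei]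
    conv_lhs => rw [hq' r hr]
    rw [P.isConj.smul, pt_conj, P.mul_smul _ _ _ (by
      rw [X.D.proj_σ (hπj _ hr).1 (hπi _ hr), hc.proj _ hr]),
      P.bundle.coord_smul _ _ _ (by rw [hm.proj _ hr]; exact (hπj _ hr).2), mul_comm]
    rfl

variable (X) in
/-- The Real line bundle over `Y` with the fibres `P_{(s_a(π y), y)}`. -/
def lineBundle : RealLineBundle Z where
  toU1Bundle := X.bundle
  conj := conj
  isConj := isConj
  conj_conj := conj_conj

/-- The product of `r` in the fibre over `y₁` with an element of `P_{(y₁, y₂)}`. -/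
def act (r : X.Tot) (p : P.bundle.Tot) (h : pt r = (P.bundle.proj p).1) : X.Tot :=
  ⟨P.mul r.1 p, by
    have e : Z.π (P.bundle.proj p).2 = Z.π (pt r) := by rw [h, P.toBundleGerbe.π_proj]
    rw [P.proj_mul _ _ h, e]
    exact r.2⟩

theorem pt_act {r : X.Tot} {p : P.bundle.Tot} (h : pt r = (P.bundle.proj p).1) :
    pt (act r p h) = (P.bundle.proj p).2 := by
  change (P.bundle.proj (P.mul r.1 p)).2 = _
  rw [P.proj_mul _ _ h]

theorem π_pt_act {r : X.Tot} {p : P.bundle.Tot} (h : pt r = (P.bundle.proj p).1) :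
    Z.π (pt (act r p h)) = Z.π (pt r) := by
  rw [pt_act, h, P.toBundleGerbe.π_proj]

/-- Gluing multiplies on the left and `act` on the right, so associativity makes them commute. -/
theorem toChart_act {a : X.cover.A} {r : X.Tot} {p : P.bundle.Tot}
    (h : pt r = (P.bundle.proj p).1) (ha : Z.π (pt r) ∈ X.cover.U a) :
    toChart a (act r p h) = P.mul (toChart a r) p := by
  unfold toChart
  rw [π_pt_act]
  exact (P.mul_assoc _ _ _ (by rw [X.D.proj_σ ha (X.mem_idx _), proj_val]) h).symm

theorem conj_act {r : X.Tot} {p : P.bundle.Tot} (h : pt r = (P.bundle.proj p).1)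
    (h' : pt (conj r) = (P.bundle.proj (P.conj p)).1) :
    conj (act r p h) = act (conj r) (P.conj p) h' := by
  have ha := X.mem_idx (Z.π (pt r))
  have hb := π_pt_conj_mem ha
  refine toChart_inj (a := X.cover.bar (X.idx (Z.π (pt r)))) ?_ ?_ ?_
  · exact π_pt_conj_mem (by rwa [π_pt_act])
  · rwa [π_pt_act]
  · rw [toChart_conj (by rwa [π_pt_act]), toChart_act h ha, toChart_act h' hb, toChart_conj ha,
      P.conj_mul _ _ (by rw [proj_toChart ha, ← h])]

/-- The element `r^* ⊗ r p` of `δR` for `p` in `P_{(y₁, y₂)}` and `r` in `R_{y₁}`. -/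
def deltaAct (r : X.Tot) (p : P.bundle.Tot) (h : pt r = (P.bundle.proj p).1) :
    X.lineBundle.delta.bundle.Tot :=
  BundleGerbe.deltaMk X.bundle r (act r p h) (π_pt_act h).symm

/-- In `r^* ⊗ r p` the phase of `r` occurs once conjugated and once not, and cancels. The map `p ↦
r^* ⊗ r p` therefore does not depend on `r`, and each of its properties can be proved with a
suitable `r`. -/
theorem deltaAct_smul_left {r : X.Tot} {p : P.bundle.Tot} (h : pt r = (P.bundle.proj p).1)
    (z : Circle) (h' : pt (z • r) = (P.bundle.proj p).1) :
    deltaAct (z • r) p h' = deltaAct r p h := by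
  have e : act (z • r) p h' = z • act r p h := Subtype.ext (P.smul_mul z r.1 p h)
  have e' := BundleGerbe.deltaMk_smul X.bundle (π_pt_act h).symm z z
  rw [mul_inv_cancel, one_smul] at e'
  rw [deltaAct, deltaAct, ← e']
  congr 1

theorem deltaAct_congr {r r' : X.Tot} {p p' : P.bundle.Tot} (h : pt r = (P.bundle.proj p).1)
    (h' : pt r' = (P.bundle.proj p').1) (e : p = p') : deltaAct r p h = deltaAct r' p' h' := by
  subst e
  obtain ⟨z, rfl⟩ := exists_smul_eq (h.trans h'.symm)
  exact (deltaAct_smul_left h z h').symm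

theorem exists_pt_eq_fst (p : P.bundle.Tot) : ∃ r : X.Tot, pt r = (P.bundle.proj p).1 :=
  exists_pt_eq (P.bundle.proj_mem p).1

variable (X) in
/-- The isomorphism `p ↦ r^* ⊗ r p` of `P` with `δR`. -/
def isoFun (p : P.bundle.Tot) : X.lineBundle.delta.bundle.Tot :=
  deltaAct (exists_pt_eq_fst (X := X) p).choose p (exists_pt_eq_fst (X := X) p).choose_spec

theorem isoFun_eq {r : X.Tot} {p : P.bundle.Tot} (h : pt r = (P.bundle.proj p).1) :
    X.isoFun p = deltaAct r p h :=
  deltaAct_congr _ _ rfl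

theorem isoFun_mul {p q : P.bundle.Tot} (h : (P.bundle.proj p).2 = (P.bundle.proj q).1) :
    X.isoFun (P.mul p q) = X.lineBundle.delta.mul (X.isoFun p) (X.isoFun q) := by
  obtain ⟨r, hr⟩ := exists_pt_eq_fst (X := X) p
  -- For `q` the representative `r p` is used, so that `(r^* ⊗ r p) ((r p)^* ⊗ r p q)` contracts to
  -- `r^* ⊗ r p q`.
  have hrp : pt (act r p hr) = (P.bundle.proj q).1 := (pt_act hr).trans h
  have hpq : pt r = (P.bundle.proj (P.mul p q)).1 := by rw [P.proj_mul _ _ h, hr]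
  rw [isoFun_eq hr, isoFun_eq hrp, isoFun_eq hpq]
  refine Eq.trans ?_ (BundleGerbe.deltaMul_mk X.bundle (π_pt_act hr).symm (π_pt_act hrp).symm
    rfl).symm
  rw [X.bundle.div_eq (one_smul Circle (act r p hr)), one_smul]
  unfold deltaAct
  congr 1
  exact Subtype.ext (P.mul_assoc r.1 p q hr h).symm

theorem isoFun_conj (p : P.bundle.Tot) :
    X.isoFun (P.conj p) = X.lineBundle.delta.conj (X.isoFun p) := by
  obtain ⟨r, hr⟩ := exists_pt_eq_fst (X := X) p
  -- For the conjugate of `p` the representative is the conjugate of `r`.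
  have hr' : pt (conj r) = (P.bundle.proj (P.conj p)).1 := by
    rw [pt_conj, hr, P.isConj.proj]
    rfl
  rw [isoFun_eq hr, isoFun_eq hr']
  refine Eq.trans ?_ (X.lineBundle.deltaConj_mk (π_pt_act hr).symm).symm
  unfold deltaAct
  congr 1
  exact (conj_act hr hr').symm

theorem isoFun_smul (z : Circle) (p : P.bundle.Tot) : X.isoFun (z • p) = z • X.isoFun p := by
  obtain ⟨r, hr⟩ := exists_pt_eq_fst (X := X) p
  have hr' : pt r = (P.bundle.proj (z • p)).1 := by rw [P.bundle.proj_smul, hr]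
  rw [isoFun_eq hr, isoFun_eq hr']
  refine Eq.trans ?_ (BundleGerbe.deltaMk_smul_right X.bundle (π_pt_act hr).symm z)
  unfold deltaAct
  congr 1
  exact Subtype.ext (P.mul_smul z r.1 p hr)

theorem proj_isoFun (p : P.bundle.Tot) :
    X.lineBundle.delta.bundle.proj (X.isoFun p) = P.bundle.proj p := by
  obtain ⟨r, hr⟩ := exists_pt_eq_fst (X := X) p
  rw [isoFun_eq hr]
  exact Prod.ext hr (pt_act hr)

end DescentData

end RealGerbe

/-! ### Smoothness of the isomorphism `P ≅ δR`, and the conclusions. -/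

namespace RealGerbe

variable {EM M : Type u} [NormedAddCommGroup EM] [NormedSpace ℝ EM] [TopologicalSpace M]
  [ChartedSpace EM M] {τ : M → M} {Z : RealSubmersion EM τ}

namespace DescentData

variable {P : RealBundleGerbe Z} {X : DescentData P}

/-- With `q` and `t` the sections of coordinate `1` in the chart `i₁` and in the trivialisation `j`,
the function `g` at `(y₁, y₂)` is the coordinate of `σ(π y₁) q(y₁) t(y₁, y₂)`, where `σ` changes the
index of `i₁` to that of `i₂`. It is smooth as a product of smooth sections, and the coordinate of
`r` cancels. -/
theorem smooth_isoFun (j : P.bundle.ι) (i₂ i₁ : X.Chart) : ∃ g : Z.N × Z.N → Circle,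
    ContMDiffOn (Z.I.prod Z.I) (𝓡 1) ∞ g
      {y | y ∈ Z.fib2 ∧ y ∈ P.bundle.dom j ∧ y.2 ∈ i₂.1.1 ∧ y.1 ∈ i₁.1.1} ∧
    ∀ p, P.bundle.proj p ∈ P.bundle.dom j → (P.bundle.proj p).2 ∈ i₂.1.1 →
      (P.bundle.proj p).1 ∈ i₁.1.1 → X.lineBundle.delta.bundle.coord (i₂, i₁) (X.isoFun p) =
        g (P.bundle.proj p) * P.bundle.coord j p := by
  rcases isEmpty_or_nonempty P.bundle.Tot with _ | _
  · exact ⟨fun _ => 1, contMDiffOn_const, fun p => isEmptyElim p⟩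
  set T := {y : Z.N × Z.N | y ∈ Z.fib2 ∧ y ∈ P.bundle.dom j ∧ y.2 ∈ i₂.1.1 ∧ y.1 ∈ i₁.1.1}
  have h₁ : ∀ y ∈ T, Z.π y.1 ∈ X.cover.U i₁.1.2.1 := fun y hy =>
    (i₁.2.2 _ hy.1.1 hy.2.2.2).1
  have h₂ : ∀ y ∈ T, Z.π y.1 ∈ X.cover.U i₂.1.2.1 ∧
      (X.D.s i₂.1.2.1 (Z.π y.1), y.2) ∈ P.bundle.dom i₂.1.2.2 := fun y hy => by
    rw [hy.1.2.2]
    exact i₂.2.2 _ hy.1.2.1 hy.2.2.1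
  have fst : ContMDiffOn (Z.I.prod Z.I) Z.I ∞ (Prod.fst : Z.N × Z.N → Z.N) T :=
    contMDiffOn_fst
  have snd : ContMDiffOn (Z.I.prod Z.I) Z.I ∞ (Prod.snd : Z.N × Z.N → Z.N) T :=
    contMDiffOn_snd
  obtain ⟨q, hq, hq'⟩ := exists_chart_section i₁ (T := {y | y ∈ Z.carrier ∧ y ∈ i₁.1.1})
    fun _ hy => hy
  obtain ⟨t, ht, ht'⟩ := P.bundle.exists_section_coord_eq_one (I' := Z.I.prod Z.I) (V := T)
    (f := fun y => (y.1, y.2)) (fst.prodMk snd) j fun y hy => ⟨hy.1, hy.2.1⟩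
  have s₁ : ContMDiffOn (Z.I.prod Z.I) Z.I ∞ (fun y => X.D.s i₁.1.2.1 (Z.π y.1)) T :=
    (contMDiffOn_s_π i₁.1.2.1).comp fst fun y hy => ⟨hy.1.1, h₁ y hy⟩
  have s₂ : ContMDiffOn (Z.I.prod Z.I) Z.I ∞ (fun y => X.D.s i₂.1.2.1 (Z.π y.1)) T :=
    (contMDiffOn_s_π i₂.1.2.1).comp fst fun y hy => ⟨hy.1.1, (h₂ y hy).1⟩
  have hqt := P.toBundleGerbe.isSmoothSectionAlong_mul s₁ fst snd
    (hq.comp fst fun y hy => ⟨hy.1.1, hy.2.2.2⟩) ht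
  have hm := P.toBundleGerbe.isSmoothSectionAlong_mul s₂ s₁ snd
    ((X.D.isSection i₂.1.2.1 i₁.1.2.1).comp (Z.smooth_π.comp fst fun y hy => hy.1.1)
      fun y hy => ⟨(h₂ y hy).1, h₁ y hy⟩) hqt
  refine ⟨_, (hm.smooth i₂.1.2.2).mono fun y hy => ⟨hy, (h₂ y hy).2⟩, fun p hj hi₂ hi₁ => ?_⟩
  have hp : P.bundle.proj p ∈ T := ⟨P.bundle.proj_mem p, hj, hi₂, hi₁⟩
  obtain ⟨r, hr⟩ := exists_pt_eq_fst (X := X) p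
  have e₁ : Z.π (pt r) ∈ X.cover.U i₁.1.2.1 := by
    rw [hr]
    exact h₁ _ hp
  have e₂ : Z.π (pt r) ∈ X.cover.U i₂.1.2.1 := by
    rw [hr]
    exact (h₂ _ hp).1
  have er : toChart i₁.1.2.1 r =
      P.bundle.coord i₁.1.2.2 (toChart i₁.1.2.1 r) • q (P.bundle.proj p).1 := by
    have := hq' r ⟨pt_mem r, by rw [hr]; exact hi₁⟩
    rwa [hr] at this
  have ep : p = P.bundle.coord j p • t (P.bundle.proj p) := by
    refine P.bundle.eq_of_coord_eq (i := j) ?_ hj ?_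
    · rw [P.bundle.proj_smul, ht.proj _ hp]
    · rw [P.bundle.coord_smul _ _ _ (by rw [ht.proj _ hp]; exact hj), ht' _ hp, mul_one]
  have cqt : (P.bundle.proj (q (P.bundle.proj p).1)).2 =
      (P.bundle.proj (t (P.bundle.proj p))).1 := by
    rw [ht.proj _ hp, hq.proj _ ⟨hp.1.1, hi₁⟩]
  have cm : (P.bundle.proj (X.D.σ i₂.1.2.1 i₁.1.2.1 (Z.π (P.bundle.proj p).1))).2 =
      (P.bundle.proj (P.mul (q (P.bundle.proj p).1) (t (P.bundle.proj p)))).1 := by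
    rw [hqt.proj _ hp, X.D.proj_σ (h₂ _ hp).1 (h₁ _ hp)]
  -- In chart `i₁` the product `r p` is a multiple of `q t`, the scalar being the coordinate of `r`
  -- times that of `p`; left multiplication by `σ` then moves this to chart `i₂`.
  have key : toChart i₂.1.2.1 (act r p hr) =
      (P.bundle.coord i₁.1.2.2 (toChart i₁.1.2.1 r) * P.bundle.coord j p) •
        P.mul (X.D.σ i₂.1.2.1 i₁.1.2.1 (Z.π (P.bundle.proj p).1))
          (P.mul (q (P.bundle.proj p).1) (t (P.bundle.proj p))) := by
    have e : toChart i₁.1.2.1 (act r p hr) =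
        (P.bundle.coord i₁.1.2.2 (toChart i₁.1.2.1 r) * P.bundle.coord j p) •
          P.mul (q (P.bundle.proj p).1) (t (P.bundle.proj p)) := by
      rw [toChart_act hr e₁]
      refine (congrArg₂ P.mul er ep).trans ?_
      rw [P.smul_mul _ _ _ (by rw [P.bundle.proj_smul]; exact cqt), P.mul_smul _ _ _ cqt,
        ← SemigroupAction.mul_smul]
    rw [← σ_mul_toChart (a := i₁.1.2.1) (by rwa [π_pt_act]) (by rwa [π_pt_act]), e, π_pt_act, hr,
      P.mul_smul _ _ _ cm]
  rw [isoFun_eq hr]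
  refine (BundleGerbe.coord_deltaMk X.bundle (π_pt_act hr).symm i₂ i₁ ?_ ?_).trans ?_
  · change pt (act r p hr) ∈ i₂.1.1
    rwa [pt_act]
  · change pt r ∈ i₁.1.1
    rwa [hr]
  · change P.bundle.coord i₂.1.2.2 (toChart i₂.1.2.1 (act r p hr)) *
      (P.bundle.coord i₁.1.2.2 (toChart i₁.1.2.1 r))⁻¹ = _
    rw [key, P.bundle.coord_smul _ _ _ (by rw [hm.proj _ hp]; exact (h₂ _ hp).2)]
    refine mul_inv_eq_iff_eq_mul.mpr ?_
    ac_rfl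

theorem isRealTrivial (X : DescentData P) : P.IsRealTrivial :=
  ⟨X.lineBundle, ⟨X.isoFun,
    ⟨proj_isoFun, isoFun_smul, fun j i => (smooth_isoFun j i.1 i.2).imp fun _ h =>
      ⟨h.1, fun p hp hi => h.2 p hp hi.1 hi.2⟩⟩, fun _ _ => isoFun_mul, isoFun_conj⟩⟩

end DescentData

namespace RealBundleGerbe

variable [T2Space M] [ParacompactSpace M] {W : RealSubmersion EM τ}

theorem realDD_eq_zero_iff (hτ : ContMDiff 𝓘(ℝ, EM) 𝓘(ℝ, EM) ∞ τ) (hττ : Function.Involutive τ)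
    (P : RealBundleGerbe Z) : P.realDD = 0 ↔ P.IsRealTrivial := by
  constructor
  · intro h
    have h0 := P.isRealDDClass_realDD hτ hττ
    rw [h] at h0
    obtain ⟨X⟩ := h0.nonempty_descentData
    exact X.isRealTrivial
  · rintro ⟨R, ⟨φ⟩⟩
    exact ((P.isRealDDClass_realDD hτ hττ).of_iso φ).unique hτ hττ
      (R.isRealDDClass_delta hτ hττ)

theorem realDD_tensor (hτ : ContMDiff 𝓘(ℝ, EM) 𝓘(ℝ, EM) ∞ τ) (hττ : Function.Involutive τ)
    (P : RealBundleGerbe Z) (Q : RealBundleGerbe W) :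
    (P.tensor Q).realDD = P.realDD + Q.realDD := by
  -- Tensor sections were constructed over a nonempty base; over an empty one there is only one
  -- class.
  rcases isEmpty_or_nonempty M with _ | _
  · exact RealH2.subsingleton.elim _ _
  · exact (((P.tensor Q).isRealDDClass_iff hτ hττ _).mp
      ((P.isRealDDClass_realDD hτ hττ).tensor (Q.isRealDDClass_realDD hτ hττ) hττ)).symm

theorem realDD_dual (hτ : ContMDiff 𝓘(ℝ, EM) 𝓘(ℝ, EM) ∞ τ) (hττ : Function.Involutive τ)
    (P : RealBundleGerbe Z) : P.dual.realDD = -P.realDD :=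
  ((P.dual.isRealDDClass_iff hτ hττ _).mp (P.isRealDDClass_realDD hτ hττ).dual).symm

/-- By additivity and duality the class of `Q ⊗ P^*` is the difference of the two classes, and its
vanishing is Real triviality. -/
theorem isRealStablyIso_iff (hτ : ContMDiff 𝓘(ℝ, EM) 𝓘(ℝ, EM) ∞ τ) (hττ : Function.Involutive τ)
    (P : RealBundleGerbe Z) (Q : RealBundleGerbe W) :
    P.IsRealStablyIso Q ↔ P.realDD = Q.realDD := by
  rw [IsRealStablyIso, ← realDD_eq_zero_iff hτ hττ, realDD_tensor hτ hττ, realDD_dual hτ hττ,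
    add_neg_eq_zero, eq_comm]

end RealBundleGerbe

end RealGerbe

/-- The Real Dixmier-Douady class of a Real bundle gerbe is well defined, it vanishes exactly for
the Real trivial Real bundle gerbes, it is additive, and it agrees for two Real bundle gerbes
exactly if they are Real stably isomorphic. -/
theorem mainTheorem5 {EM M : Type u} [NormedAddCommGroup EM] [NormedSpace ℝ EM]
    [FiniteDimensional ℝ EM] [TopologicalSpace M] [ChartedSpace EM M]
    [IsManifold 𝓘(ℝ, EM) ∞ M] [T2Space M] [ParacompactSpace M]
    (τ : M → M) (hτ : ContMDiff 𝓘(ℝ, EM) 𝓘(ℝ, EM) ∞ τ) (hττ : Function.Involutive τ) :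
    (∀ (Y : RealGerbe.RealSubmersion EM τ) (P : RealGerbe.RealBundleGerbe Y),
      ∀ c, P.IsRealDDClass c ↔ c = P.realDD) ∧
    (∀ (Y : RealGerbe.RealSubmersion EM τ) (P : RealGerbe.RealBundleGerbe Y),
      P.realDD = 0 ↔ P.IsRealTrivial) ∧
    (∀ (Y X : RealGerbe.RealSubmersion EM τ) (P : RealGerbe.RealBundleGerbe Y)
      (Q : RealGerbe.RealBundleGerbe X), (P.tensor Q).realDD = P.realDD + Q.realDD) ∧
    (∀ (Y X : RealGerbe.RealSubmersion EM τ) (P : RealGerbe.RealBundleGerbe Y)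
      (Q : RealGerbe.RealBundleGerbe X), P.IsRealStablyIso Q ↔ P.realDD = Q.realDD) := by
  refine ⟨fun _ P => P.isRealDDClass_iff hτ hττ, fun _ P => P.realDD_eq_zero_iff hτ hττ,
    fun _ _ P Q => P.realDD_tensor hτ hττ Q, fun _ _ P Q => P.isRealStablyIso_iff hτ hττ Q⟩
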